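/- **Model of computation.** Algorithms are programs for a unit-cost random access machine with words of $O(\log N)$ bits, where $N$ is the size of the input (for a query: the size of the preprocessed graph plus the length of the query). **Orthogonal Vectors Hypothesis (OVH).** For no constant $\epsilon>0$ is there an algorithm that, given two families $X,Y$ of $n$ binary vectors of length $d$ each, decides in time $O(\mathrm{poly}(d)\,n^{2-\epsilon})$ whether there are $x\in X$, $y\in Y$ with $x\cdot y=0$. **Elastic founder graphs.** Let $A$ be a multiple sequence alignment, i.e. an $m\times n$ matrix over $\Sigma\cup\{\text{-}\}$, and let the columns be partitioned into $b$ consecutive intervals (segments) $I_1,\dots,I_b$ such that no row of $A$ consists of gaps only inside a segment. For a row $t$ and an interval $I$ of columns let $\mathrm{spell}(A[t,I])$ be the string in row $t$ and columns $I$ with the gap symbols removed. The elastic founder graph (EFG) induced by this segmentation is the node-labeled directed graph $G=(V,E,\ell)$, $V=V^1\sqcup\dots\sqcup V^b$, in which distinct nodes of the same block $V^k$ have distinct labels, $\{\ell(v):v\in V^k\}=\{\mathrm{spell}(A[t,I_k]):1\le t\le m\}$, and $(v,w)\in E$ if and only if for some $k<b$ and some row $t$ one has $v\in V^k$, $w\in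 V^{k+1}$ and $\mathrm{spell}(A[t,I_k\cup I_{k+1}])=\ell(v)\ell(w)$. A string $Q$ occurs in $G$ if it is a substring of the concatenation of the node labels along some directed path of $G$. **Theorem.** Assume OVH. Let $\alpha,\beta,\delta>0$ with $\beta+\delta<2$. Then there is no pair of algorithms (preprocessing, query) such that the first preprocesses any given EFG $G=(V,E,\ell)$ in time $O(|E|^\alpha)$, and the second, started on the memory contents left by the first, decides for any nonempty query string $Q$ whether $Q$ occurs in $G$ in time $O(|Q|+|E|^\delta|Q|^\beta)$. This holds over every alphabet of size $\sigma\ge 4$, in particular over an alphabet of size $4$. Moreover, for every $L\in\{4,5,\dots\}\cup\{\infty\}$, it holds even if the algorithms are only required to work on EFGs that have at least one edge and all of whose node labels have length at most $L$. -/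

import Mathlib

/-! ### The machine model

A random access machine with logarithmic word length. A machine has registers and arrays (memory
banks), both named by natural numbers; a program is a finite text, so it mentions only finitely
many of them. Every register and every array cell holds a natural number. Each executed
instruction and each evaluated test costs one unit of time. All numbers that are ever written must
be at most the word bound `W`; an execution in which a larger number would be written does not
exist. Below, `W` is always a fixed power of the input size, that is, words have `O(log N)` bits on
inputs of size `N`. -/

/-- The word operations. Subtraction is truncated; comparisons return `0` or `1`. -/
inductive WordOp where
  | add | sub | mul | div | mod | lt | eq | and | or | xor | shiftLeft | shiftRight

/-- The value of a word operation. -/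
def WordOp.eval : WordOp → ℕ → ℕ → ℕ
  | .add, x, y => x + y
  | .sub, x, y => x - y
  | .mul, x, y => x * y
  | .div, x, y => x / y
  | .mod, x, y => x % y
  | .lt, x, y => if x < y then 1 else 0
  | .eq, x, y => if x = y then 1 else 0
  | .and, x, y => x &&& y
  | .or, x, y => x ||| y
  | .xor, x, y => x ^^^ y
  | .shiftLeft, x, y => x <<< y
  | .shiftRight, x, y => x >>> y

/-- Programs of the random access machine, with structured control flow. -/
inductive RamProgram where
  /-- Do nothing. -/
  | skip : RamProgram
  /-- `const x n` is the assignment `r[x] := n`. -/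
  | const (x n : ℕ) : RamProgram
  /-- `op o x y z` is the assignment `r[x] := o(r[y], r[z])`. -/
  | op (o : WordOp) (x y z : ℕ) : RamProgram
  /-- `load x a y` is the assignment `r[x] := A_a[r[y]]`. -/
  | load (x a y : ℕ) : RamProgram
  /-- `store a y z` is the assignment `A_a[r[y]] := r[z]`. -/
  | store (a y z : ℕ) : RamProgram
  /-- Sequential composition. -/
  | seq (p q : RamProgram) : RamProgram
  /-- `ite x p q` runs `p` if `r[x] ≠ 0` and `q` otherwise. -/
  | ite (x : ℕ) (p q : RamProgram) : RamProgram
  /-- `loop x p` runs `p` as long as `r[x] ≠ 0`. -/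
  | loop (x : ℕ) (p : RamProgram) : RamProgram

/-- The memory contents of the machine: `reg x` is the content of register `x` and `arr a i` is the
content of cell `i` of array `a`. -/
structure RamState where
  reg : ℕ → ℕ
  arr : ℕ → ℕ → ℕ

namespace RamState

/-- Write `v` into register `x`. -/
def setReg (s : RamState) (x v : ℕ) : RamState :=
  { s with reg := Function.update s.reg x v }

/-- Write `v` into cell `i` of array `a`. -/
def setArr (s : RamState) (a i v : ℕ) : RamState :=
  { s with arr := Function.update s.arr a (Function.update (s.arr a) i v) }

/-- The initial state on a given input: the input is written in array `0`, everything else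
is zero. -/
def init (input : List ℕ) : RamState where
  reg := fun _ => 0
  arr := fun a i => if a = 0 then input.getD i 0 else 0

/-- The state in which the processing of a query starts: the query is written over the first cells
of array `1` and its length into register `0`; all other contents are kept. -/
def withQuery (s : RamState) (query : List ℕ) : RamState where
  reg := Function.update s.reg 0 query.length
  arr := Function.update s.arr 1 (fun i => query.getD i (s.arr 1 i))

end RamState

/-- `RamExec W p s t s'`: started in state `s`, the program `p` halts after exactly `t` steps in
state `s'`, and no number larger than `W` is written on the way. -/
inductive RamExec (W : ℕ) : RamProgram → RamState → ℕ → RamState → Prop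
  | skip (s : RamState) : RamExec W .skip s 1 s
  | const (s : RamState) (x n : ℕ) (h : n ≤ W) :
      RamExec W (.const x n) s 1 (s.setReg x n)
  | op (s : RamState) (o : WordOp) (x y z : ℕ) (h : o.eval (s.reg y) (s.reg z) ≤ W) :
      RamExec W (.op o x y z) s 1 (s.setReg x (o.eval (s.reg y) (s.reg z)))
  | load (s : RamState) (x a y : ℕ) (h : s.arr a (s.reg y) ≤ W) :
      RamExec W (.load x a y) s 1 (s.setReg x (s.arr a (s.reg y)))
  | store (s : RamState) (a y z : ℕ) (h : s.reg z ≤ W) :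
      RamExec W (.store a y z) s 1 (s.setArr a (s.reg y) (s.reg z))
  | seq (p q : RamProgram) (s s' s'' : RamState) (t t' : ℕ)
      (hp : RamExec W p s t s') (hq : RamExec W q s' t' s'') :
      RamExec W (.seq p q) s (t + t') s''
  | iteTrue (x : ℕ) (p q : RamProgram) (s s' : RamState) (t : ℕ)
      (hx : s.reg x ≠ 0) (hp : RamExec W p s t s') :
      RamExec W (.ite x p q) s (1 + t) s'
  | iteFalse (x : ℕ) (p q : RamProgram) (s s' : RamState) (t : ℕ)
      (hx : s.reg x = 0) (hq : RamExec W q s t s') :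
      RamExec W (.ite x p q) s (1 + t) s'
  | loopDone (x : ℕ) (p : RamProgram) (s : RamState) (hx : s.reg x = 0) :
      RamExec W (.loop x p) s 1 s
  | loopStep (x : ℕ) (p : RamProgram) (s s' s'' : RamState) (t t' : ℕ)
      (hx : s.reg x ≠ 0) (hp : RamExec W p s t s') (hl : RamExec W (.loop x p) s' t' s'') :
      RamExec W (.loop x p) s (1 + t + t') s''

/-! ### The Orthogonal Vectors Hypothesis -/

/-- The input of the Orthogonal Vectors problem for two families `X`, `Y` of `n` binary vectors of
length `d`: the numbers `n` and `d`, then the vectors of `X`, then the vectors of `Y`. -/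
def encodeOV {n d : ℕ} (X Y : Fin n → Fin d → Bool) : List ℕ :=
  [n, d] ++ (List.ofFn fun i => List.ofFn fun h => (X i h).toNat).flatten
    ++ (List.ofFn fun j => List.ofFn fun h => (Y j h).toNat).flatten

/-- Some vector of `X` is orthogonal to some vector of `Y`. -/
def HasOrthogonalPair {n d : ℕ} (X Y : Fin n → Fin d → Bool) : Prop :=
  ∃ i j, ∑ h, (X i h).toNat * (Y j h).toNat = 0

/-- The program `p` solves Orthogonal Vectors in time `O(poly(d) n ^ e)`. The answer is "yes" if
register `0` is nonzero at the end. -/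
def SolvesOVInTime (p : RamProgram) (e : ℝ) : Prop :=
  ∃ (C : ℝ) (k c : ℕ), ∀ n d : ℕ, 1 ≤ n → 1 ≤ d → ∀ X Y : Fin n → Fin d → Bool,
    ∃ (t : ℕ) (s : RamState),
      RamExec (((encodeOV X Y).length + 2) ^ c) p (RamState.init (encodeOV X Y)) t s ∧
      (t : ℝ) ≤ C * (d : ℝ) ^ k * (n : ℝ) ^ e ∧
      (s.reg 0 ≠ 0 ↔ HasOrthogonalPair X Y)

/-- The Orthogonal Vectors Hypothesis: for no `ε > 0` can an algorithm solve Orthogonal Vectors in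
time `O(poly(d) n ^ (2 - ε))`. -/
def OVH : Prop :=
  ∀ ε : ℝ, 0 < ε → ¬ ∃ p : RamProgram, SolvesOVInTime p (2 - ε)

/-! ### Elastic founder graphs -/

/-- A finite directed graph whose nodes are labeled by strings over the alphabet `Fin σ`; the edge
set is given by a list without repetitions. -/
structure LabeledGraph (σ : ℕ) where
  numNodes : ℕ
  label : Fin numNodes → List (Fin σ)
  edges : List (Fin numNodes × Fin numNodes)
  edges_nodup : edges.Nodup

/-- For row `t` of a multiple sequence alignment `A` (`none` is the gap symbol), the string
in the columns `lo, …, hi - 1` (columns are numbered from `0`) with its gaps removed. -/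
def spellSegment {σ m n : ℕ} (A : Fin m → Fin n → Option (Fin σ)) (t : Fin m) (lo hi : ℕ) :
    List (Fin σ) :=
  (((List.ofFn (A t)).take hi).drop lo).reduceOption

namespace LabeledGraph

variable {σ : ℕ}

/-- The number of edges. -/
def numEdges (G : LabeledGraph σ) : ℕ := G.edges.length

/-- `G` is induced by the segmentation of the multiple sequence alignment `A` into the `b` segments
`[cut k, cut (k + 1))`, where `block v` is the block of the node `v`. -/
structure IsInducedBy (G : LabeledGraph σ) {m n b : ℕ} (A : Fin m → Fin n → Option (Fin σ))
    (cut : Fin (b + 1) → ℕ) (block : Fin G.numNodes → Fin b) : Prop where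
  cut_strictMono : StrictMono cut
  cut_zero : cut 0 = 0
  cut_last : cut (Fin.last b) = n
  /-- The segmentation is proper: no segment of a row consists of gaps only. -/
  proper : ∀ (t : Fin m) (k : Fin b), spellSegment A t (cut k.castSucc) (cut k.succ) ≠ []
  /-- The labels in block `k` are exactly the strings in segment `k`. -/
  labels : ∀ k : Fin b, {x | ∃ t, spellSegment A t (cut k.castSucc) (cut k.succ) = x} =
    {x | ∃ v, block v = k ∧ G.label v = x}
  /-- Different nodes of a block have different labels. -/
  label_inj : ∀ v w, block v = block w → G.label v = G.label w → v = w
  /-- The edges connect nodes of consecutive blocks whose labels are spelled by some row. -/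
  mem_edges : ∀ v w, (v, w) ∈ G.edges ↔
    (block w : ℕ) = block v + 1 ∧
    ∃ t, spellSegment A t (cut (block v).castSucc) (cut (block w).succ) = G.label v ++ G.label w

/-- Elastic founder graphs: the graphs induced by a segmentation of some multiple sequence
alignment. -/
def IsElasticFounderGraph (G : LabeledGraph σ) : Prop :=
  ∃ (m n b : ℕ) (A : Fin m → Fin n → Option (Fin σ)) (cut : Fin (b + 1) → ℕ)
    (block : Fin G.numNodes → Fin b), G.IsInducedBy A cut block

/-- The string `Q` occurs in `G`: it is a substring of the concatenation of the labels along some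
directed path of `G`. -/
def Occurs (G : LabeledGraph σ) (Q : List (Fin σ)) : Prop :=
  ∃ P : List (Fin G.numNodes), P.IsChain (fun v w => (v, w) ∈ G.edges) ∧
    Q <:+: (P.map G.label).flatten

/-- The graph as an input of a machine: the numbers of nodes and edges, then the edges as pairs of
node numbers, then for each node the length of its label followed by its label. -/
def encode (G : LabeledGraph σ) : List ℕ :=
  [G.numNodes, G.edges.length] ++ (G.edges.map fun e => [(e.1 : ℕ), (e.2 : ℕ)]).flatten
    ++ (List.ofFn fun v => (G.label v).length :: (G.label v).map Fin.val).flatten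

end LabeledGraph

/-- The programs `pre` and `query` form an indexing scheme for string matching in elastic founder
graphs over an alphabet of size `σ`, with at least one edge and with node labels of length at
most `L`: `pre` preprocesses such a graph `G = (V, E, ℓ)` in time `O(|E| ^ α)`, and `query`,
started on the memory contents left by `pre`, decides for any nonempty query string `Q` in time
`O(|Q| + |E| ^ δ |Q| ^ β)` whether `Q` occurs in `G`; the answer is "yes" if register `0` is
nonzero at the end. For `L = ⊤` there is no restriction on the labels. -/
def IndexesEFGs (σ : ℕ) (L : ℕ∞) (α β δ : ℝ) (pre query : RamProgram) : Prop :=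
  ∃ (C : ℝ) (c : ℕ), ∀ G : LabeledGraph σ, G.IsElasticFounderGraph → 1 ≤ G.numEdges →
    (∀ v, ((G.label v).length : ℕ∞) ≤ L) →
    ∃ (t : ℕ) (s : RamState),
      RamExec ((G.encode.length + 2) ^ c) pre (RamState.init G.encode) t s ∧
      (t : ℝ) ≤ C * (G.numEdges : ℝ) ^ α ∧
      ∀ Q : List (Fin σ), Q ≠ [] →
        ∃ (t' : ℕ) (s' : RamState),
          RamExec ((G.encode.length + Q.length + 2) ^ c) query
            (s.withQuery (Q.map Fin.val)) t' s' ∧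
          (t' : ℝ) ≤ C * ((Q.length : ℝ) + (G.numEdges : ℝ) ^ δ * (Q.length : ℝ) ^ β) ∧
          (s'.reg 0 ≠ 0 ↔ G.Occurs Q)

/-! ### The graph of a family of vectors

The graph consists of blocks of six nodes each. A block is either a separator or it stands for one
bit of a vector; this is its kind (`none` or `some bit`). Nodes `0, 1` of a block form the lane
that is read before the vector that is tested, nodes `2, 3` the lane of that vector, and nodes
`4, 5` the lane that is read afterwards. -/

/-! An indexing scheme with these time bounds would solve Orthogonal Vectors in time `O(poly(d) n ^
(2 - ε))`. Both families are cut into groups of about `g = n ^ (1 / k)` vectors. A group of `Y`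
becomes a graph with `O(g d)` edges, a group of `X` a query with `O(g d)` letters. There are about
`n / g` graphs, and preprocessing them costs at most `n ^ (3 / 2)` up to powers of `d`, once `k ≥ 2
α`. There are about `(n / g) ^ 2` queries, each of cost `(g d) ^ η` with `η = max 1 (β + δ) < 2`;
against `n ^ 2` this saves a factor `g ^ (2 - η)`, which is a fixed power of `n`
(`time_ovProgram_le`).

The gadget. A query is `333`, then a triple `22z` for every bit `z` of its vectors, with `z = 3`
after each vector, then `33`. The three lanes of the graph are the three ways to shift the triples
against the blocks: a node of lane 0 reads `22z`, a node of lane 1 reads `2z2`, a node of lane 2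
reads `z22`. Lanes 0 and 2 accept both bits. Lane 1 accepts the bit 1 only where the vector of the
graph has the bit 0, for otherwise the label there is `232`. At a separator, the labels `2232` and
`2322` are one letter longer and lead from lane 0 to lane 1 and from lane 1 to lane 2. The beginning
`333` fits only on the separator node that leads to lane 0, and lane 0 cannot finish a query. So an
occurrence has to read some whole vector in lane 1, which makes it orthogonal to the vector of the
graph next to it (`orthogonal_of_lane`, `exists_orthogonal_of_infix`). Conversely, an orthogonal
pair that is far enough from the ends of query and graph gives an occurrence (`flatMap_blockLabel`,
`occurs_of_orthogonal`). Groups overlap and are continued periodically, so that each pair is far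
enough from the ends for some choice of groups (`exists_occurs_iff`).

The graph is an elastic founder graph because every edge extends to a path through all blocks, and
these paths are the rows of an alignment. No row spells an additional edge: of two adjacent blocks
one has all labels of length three, so the concatenation of two labels determines both of them
(`blockGraph_isElasticFounderGraph`).

The machine. Many queries have to be started on the memory left by one preprocessing, which a query
may destroy and which is too expensive to copy for each query. Therefore both programs are simulated
inside one array, with a log of all overwritten cells (`achieves_compile`). Undoing the log takes
time proportional to the number of writes, hence the rollback after a query costs no more than
writing and answering it, up to a constant factor (`achieves_undoAll`). -/

/-- The label of node `q` in a block of the given kind. -/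
def blockLabel : Option Bool → ℕ → List ℕ
  | none, 0 => [2, 2, 3]
  | none, 1 => [2, 2, 3, 2]
  | none, 2 => [2, 3, 2]
  | none, 3 => [2, 3, 2, 2]
  | none, 4 => [3, 2, 2]
  | none, _ => [3, 3, 3]
  | some _, 0 => [2, 2, 0]
  | some _, 1 => [2, 2, 1]
  | some _, 2 => [2, 0, 2]
  | some b, 3 => [2, 1 + 2 * b.toNat, 2]
  | some _, 4 => [0, 2, 2]
  | some _, _ => [1, 2, 2]

/-- The lane in which a path continues after node `q` of a block of the given kind. -/
def nextLane (κ : Option Bool) (q : ℕ) : ℕ :=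
  (q + if κ = none then 1 else 0) / 2 % 3

lemma blockLabel_lt_four (κ : Option Bool) (q : ℕ) : ∀ a ∈ blockLabel κ q, a < 4 := by
  rcases κ with _ | _ | _ <;> unfold blockLabel <;> split <;> simp_all

lemma blockLabel_length_le (κ : Option Bool) (q : ℕ) : (blockLabel κ q).length ≤ 4 := by
  rcases κ with _ | _ | _ <;> unfold blockLabel <;> split <;> simp_all

lemma blockLabel_ne_nil (κ : Option Bool) (q : ℕ) : blockLabel κ q ≠ [] := by
  rcases κ with _ | _ | _ <;> unfold blockLabel <;> split <;> simp_all

lemma blockLabel_some_length (b : Bool) (q : ℕ) : (blockLabel (some b) q).length = 3 := by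
  unfold blockLabel; split <;> simp_all

lemma blockLabel_injective (κ : Option Bool) {q q' : ℕ} (hq : q < 6) (hq' : q' < 6)
    (h : blockLabel κ q = blockLabel κ q') : q = q' := by
  rcases κ with _ | _ | _ <;> interval_cases q <;> interval_cases q' <;> simp_all [blockLabel]

lemma nextLane_lt (κ : Option Bool) (q : ℕ) : nextLane κ q < 3 := Nat.mod_lt _ (by norm_num)

/-- Every lane can be entered from the preceding block, whatever its kind; this is what allows paths
to be extended backwards. -/
lemma exists_nextLane_eq (κ : Option Bool) {q' : ℕ} (hq' : q' < 6) :
    ∃ q < 6, nextLane κ q = q' / 2 := by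
  rcases κ with _ | _
  · rcases (by omega : q' / 2 = 0 ∨ q' / 2 = 1 ∨ q' / 2 = 2) with h | h | h
    · exact ⟨0, by norm_num, by simp [nextLane, h]⟩
    · exact ⟨1, by norm_num, by simp [nextLane, h]⟩
    · exact ⟨3, by norm_num, by simp [nextLane, h]⟩
  · exact ⟨q', hq', by simp [nextLane]; omega⟩

/-- The letter with number `a`. -/
def letter {σ : ℕ} (hσ : 4 ≤ σ) (a : ℕ) : Fin σ :=
  ⟨a % 4, (Nat.mod_lt _ (by norm_num)).trans_le hσ⟩

lemma val_letter {σ : ℕ} (hσ : 4 ≤ σ) {a : ℕ} (ha : a < 4) : (letter hσ a : ℕ) = a :=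
  Nat.mod_eq_of_lt ha

lemma map_val_map_letter {σ : ℕ} (hσ : 4 ≤ σ) {l : List ℕ} (hl : ∀ a ∈ l, a < 4) :
    (l.map (letter hσ)).map Fin.val = l := by
  rw [List.map_map]
  conv_rhs => rw [← List.map_id l]
  exact List.map_congr_left fun a ha => val_letter hσ (hl a ha)

/-- The target of edge number `e`; its source is `e / 2`. -/
def edgeTarget (κ : ℕ → Option Bool) (e : ℕ) : ℕ :=
  6 * (e / 12 + 1) + 2 * nextLane (κ (e / 12)) (e / 2 % 6) + e % 2

lemma edgeTarget_lt {κ : ℕ → Option Bool} {K e : ℕ} (he : e < 12 * (K - 1)) :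
    edgeTarget κ e < 6 * K := by
  have := nextLane_lt (κ (e / 12)) (e / 2 % 6)
  unfold edgeTarget
  omega

/-- The graph with `K` blocks of kinds `κ 0, …, κ (K - 1)`. -/
def blockGraph {σ : ℕ} (hσ : 4 ≤ σ) (κ : ℕ → Option Bool) (K : ℕ) : LabeledGraph σ where
  numNodes := 6 * K
  label v := (blockLabel (κ (v / 6)) (v % 6)).map (letter hσ)
  edges := List.ofFn fun e : Fin (12 * (K - 1)) =>
    (⟨e / 2, by omega⟩, ⟨edgeTarget κ e, edgeTarget_lt e.2⟩)
  edges_nodup := by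
    rw [List.nodup_ofFn]
    -- The source determines `e / 2`, hence block and lane; the target then differs only by `e % 2`.
    intro e e' h
    simp only [Prod.mk.injEq, Fin.mk.injEq] at h
    obtain ⟨h1, h2⟩ := h
    have h12 : (e : ℕ) / 12 = e' / 12 := by omega
    unfold edgeTarget at h2
    rw [h12, h1] at h2
    exact Fin.ext (by omega)

section BlockGraph

variable {σ : ℕ} (hσ : 4 ≤ σ) (κ : ℕ → Option Bool) (K : ℕ)

lemma numEdges_blockGraph : (blockGraph hσ κ K).numEdges = 12 * (K - 1) := by
  simp [LabeledGraph.numEdges, blockGraph]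

lemma mem_edges_blockGraph (v w : Fin (blockGraph hσ κ K).numNodes) :
    (v, w) ∈ (blockGraph hσ κ K).edges ↔
      (w : ℕ) / 6 = v / 6 + 1 ∧ nextLane (κ (v / 6)) (v % 6) = w % 6 / 2 := by
  have hl := nextLane_lt (κ (v / 6)) (v % 6)
  have hv : (v : ℕ) < 6 * K := v.2
  have hw : (w : ℕ) < 6 * K := w.2
  rw [show (v, w) ∈ (blockGraph hσ κ K).edges ↔ ∃ e : Fin (12 * (K - 1)),
      (e : ℕ) / 2 = v ∧ edgeTarget κ e = w from
    List.mem_ofFn.trans (exists_congr fun e =>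
      (Prod.mk.injEq _ _ _ _).to_iff.trans (and_congr Fin.ext_iff Fin.ext_iff))]
  constructor
  · rintro ⟨e, h1, h2⟩
    have h12 : (e : ℕ) / 12 = v / 6 := by omega
    unfold edgeTarget at h2
    rw [h12, h1] at h2
    omega
  · rintro ⟨h1, h2⟩
    refine ⟨⟨2 * v + w % 2, by omega⟩, by dsimp only; omega, ?_⟩
    have e1 : (2 * (v : ℕ) + w % 2) / 12 = v / 6 := by omega
    have e2 : (2 * (v : ℕ) + w % 2) / 2 = v := by omega
    simp only [edgeTarget, e1, e2, h2]
    omega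

lemma label_blockGraph_length_le (v : Fin (blockGraph hσ κ K).numNodes) :
    ((blockGraph hσ κ K).label v).length ≤ 4 := by
  simpa [blockGraph] using blockLabel_length_le _ _

/-- A row of the alignment has to cross all blocks, so a single edge must be part of such a path.
Forwards every node has a successor; backwards `exists_nextLane_eq` supplies a predecessor. -/
lemma exists_blockPath_through (k : ℕ) {q : ℕ} (hq : q < 6) {r : ℕ} (hr : r < 2) :
    ∃ f : ℕ → ℕ, (∀ i, f i < 6) ∧ (∀ i, nextLane (κ i) (f i) = f (i + 1) / 2) ∧ f k = q ∧
      f (k + 1) = 2 * nextLane (κ k) q + r := by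
  have forward : ∀ (k q r : ℕ), q < 6 → r < 2 → ∃ f : ℕ → ℕ, (∀ i, f i < 6) ∧
      (∀ i, k ≤ i → nextLane (κ i) (f i) = f (i + 1) / 2) ∧ f k = q ∧
      f (k + 1) = 2 * nextLane (κ k) q + r := by
    intro k q r hq hr
    let g : ℕ → ℕ := fun i => Nat.rec (2 * nextLane (κ k) q + r)
      (fun j a => 2 * nextLane (κ (k + 1 + j)) a) i
    have hg : ∀ i, g i < 6 := by
      intro i
      cases i with
      | zero => have := nextLane_lt (κ k) q; change 2 * nextLane (κ k) q + r < 6; omega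
      | succ j =>
        have := nextLane_lt (κ (k + 1 + j)) (g j)
        change 2 * nextLane (κ (k + 1 + j)) (g j) < 6
        omega
    refine ⟨fun i => if i ≤ k then q else g (i - (k + 1)), fun i => ?_, fun i hi => ?_, by simp,
      by simp [g]⟩
    · dsimp only; split
      · exact hq
      · exact hg _
    · rcases hi.eq_or_lt with rfl | hi
      · simp [g]; omega
      · have e1 : ¬ i ≤ k := by omega
        have e2 : ¬ i + 1 ≤ k := by omega
        have e3 : i + 1 - (k + 1) = i - (k + 1) + 1 := by omega
        have e4 : k + 1 + (i - (k + 1)) = i := by omega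
        simp only [e1, e2, if_false, e3]
        change _ = 2 * nextLane (κ (k + 1 + (i - (k + 1)))) (g (i - (k + 1))) / 2
        rw [e4]; omega
  have backward : ∀ (k q : ℕ), q < 6 → ∃ f : ℕ → ℕ, (∀ i, f i < 6) ∧
      (∀ i, i < k → nextLane (κ i) (f i) = f (i + 1) / 2) ∧ f k = q := by
    intro k
    induction k with
    | zero => exact fun q hq => ⟨fun _ => q, fun _ => hq, by simp, rfl⟩
    | succ k ih =>
      intro q hq
      obtain ⟨p, hp, hpq⟩ := exists_nextLane_eq (κ k) hq
      obtain ⟨f, h1, h2, h3⟩ := ih p hp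
      refine ⟨fun i => if i ≤ k then f i else q, fun i => ?_, fun i hi => ?_, by simp⟩
      · dsimp only; split
        · exact h1 i
        · exact hq
      · rcases (Nat.lt_succ_iff.mp hi).eq_or_lt with rfl | hi
        · simp [h3, hpq]
        · have e1 : i ≤ k := by omega
          have e2 : i + 1 ≤ k := by omega
          simp only [e1, e2, if_true]
          exact h2 i hi
  obtain ⟨f, f1, f2, f3, f4⟩ := forward k q r hq hr
  obtain ⟨g, g1, g2, g3⟩ := backward k q hq
  refine ⟨fun i => if i ≤ k then g i else f i, fun i => ?_, fun i => ?_, by simp [g3],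
    by simp [f4]⟩
  · dsimp only; split
    · exact g1 i
    · exact f1 i
  · rcases lt_trichotomy i k with hi | rfl | hi
    · have e1 : i ≤ k := by omega
      have e2 : i + 1 ≤ k := by omega
      simp only [e1, e2, if_true]
      exact g2 i hi
    · have := f2 i le_rfl
      simp only [le_refl, if_true, g3, ← f3, this, add_le_iff_nonpos_right, nonpos_iff_eq_zero,
        one_ne_zero, if_false]
    · have e1 : ¬ i ≤ k := by omega
      have e2 : ¬ i + 1 ≤ k := by omega
      simp only [e1, e2, if_false]
      exact f2 i hi.le

end BlockGraph

/-! ### The alignment that induces a block graph -/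

lemma spellSegment_append {σ m n : ℕ} (A : Fin m → Fin n → Option (Fin σ)) (t : Fin m)
    {lo mid hi : ℕ} (h1 : lo ≤ mid) (h2 : mid ≤ hi) :
    spellSegment A t lo hi = spellSegment A t lo mid ++ spellSegment A t mid hi := by
  unfold spellSegment
  rw [← List.reduceOption_append]
  congr 1
  set l := List.ofFn (A t)
  have e : l.take hi = l.take mid ++ (l.take hi).drop mid := by
    conv_lhs => rw [← List.take_append_drop mid (l.take hi), List.take_take, min_eq_left h2]
  by_cases hm : mid ≤ l.length
  · conv_lhs => rw [e]
    rw [List.drop_append_of_le_length]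
    simp [hm]; omega
  · push Not at hm
    rw [List.take_of_length_le (by omega : l.length ≤ hi),
      List.take_of_length_le (by omega : l.length ≤ mid),
      List.drop_of_length_le (by omega : l.length ≤ mid), List.append_nil]

/-- Four columns suffice for a label: `x[i]?` is `none`, the gap symbol, behind the last letter. -/
lemma spellSegment_four {σ m n : ℕ} (A : Fin m → Fin n → Option (Fin σ)) (t : Fin m) {lo : ℕ}
    (h : lo + 4 ≤ n) {x : List (Fin σ)} (hx : x.length ≤ 4)
    (hA : ∀ i (hi : i < 4), A t ⟨lo + i, by omega⟩ = x[i]?) :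
    spellSegment A t lo (lo + 4) = x := by
  have e : ((List.ofFn (A t)).take (lo + 4)).drop lo = [x[0]?, x[1]?, x[2]?, x[3]?] := by
    apply List.ext_getElem
    · simp; omega
    · intro i h1 h2
      have hi : i < 4 := by simpa using h2
      simp only [List.getElem_drop, List.getElem_take, List.getElem_ofFn, hA i hi]
      interval_cases i <;> rfl
  unfold spellSegment
  rw [e]
  match x, hx with
  | [], _ => rfl
  | [_], _ => rfl
  | [_, _], _ => rfl
  | [_, _, _], _ => rfl
  | [_, _, _, _], _ => rfl

section BlockGraph

variable {σ : ℕ} (hσ : 4 ≤ σ) (κ : ℕ → Option Bool) (K : ℕ)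

/-- Each block gets four columns. Row `e` is a path through node `e / 2` and through the node of its
next lane selected by `e % 2`, so the rows cover all nodes and edges. The hypothesis `hκ` excludes
adjacent separators, whose labels of lengths three and four could be cut in several ways. -/
lemma blockGraph_isElasticFounderGraph (hκ : ∀ k, κ k ≠ none ∨ κ (k + 1) ≠ none) :
    (blockGraph hσ κ K).IsElasticFounderGraph := by
  have hrow : ∀ e : Fin (12 * K), ∃ f : ℕ → ℕ, (∀ i, f i < 6) ∧
      (∀ i, nextLane (κ i) (f i) = f (i + 1) / 2) ∧ f (e / 12) = e / 2 % 6 ∧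
      f (e / 12 + 1) = 2 * nextLane (κ (e / 12)) (e / 2 % 6) + e % 2 := fun e =>
    exists_blockPath_through κ (e / 12) (Nat.mod_lt _ (by norm_num)) (Nat.mod_lt _ (by norm_num))
  choose R hR6 hR hR1 hR2 using hrow
  let word : ℕ → ℕ → List (Fin σ) := fun k q => (blockLabel (κ k) q).map (letter hσ)
  have word_inj : ∀ k q q', q < 6 → q' < 6 → word k q = word k q' → q = q' := by
    intro k q q' hq hq' h
    have := congrArg (List.map Fin.val) h
    simp only [word, map_val_map_letter hσ (blockLabel_lt_four _ _)] at this
    exact blockLabel_injective _ hq hq' this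
  let A : Fin (12 * K) → Fin (4 * K) → Option (Fin σ) := fun t i =>
    (word (i / 4) (R t (i / 4)))[(i : ℕ) % 4]?
  have spell : ∀ t k, k < K → spellSegment A t (4 * k) (4 * (k + 1)) = word k (R t k) := by
    intro t k hk
    refine spellSegment_four A t (by omega) ?_ ?_
    · simpa [word] using blockLabel_length_le _ _
    · intro i hi
      have e1 : (4 * k + i) / 4 = k := by omega
      have e2 : (4 * k + i) % 4 = i := by omega
      simp only [A, e1, e2]
  refine ⟨12 * K, 4 * K, K, A, fun k => 4 * k, fun v => ⟨(v : ℕ) / 6, ?_⟩, ?_⟩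
  · have := v.2; change (v : ℕ) < 6 * K at this; omega
  constructor
  · intro a b h
    have : (a : ℕ) < b := h
    change 4 * (a : ℕ) < 4 * b
    omega
  · simp
  · simp
  · intro t k
    have := spell t k k.2
    simp only [Fin.val_castSucc, Fin.val_succ, this]
    simpa [word] using blockLabel_ne_nil _ _
  · intro k
    ext x
    simp only [Fin.val_castSucc, Fin.val_succ, Set.mem_ofPred_eq]
    constructor
    · rintro ⟨t, rfl⟩
      have := hR6 t k
      refine ⟨⟨6 * k + R t k, by change _ < 6 * K; omega⟩, Fin.ext (by dsimp only; omega), ?_⟩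
      rw [spell t k k.2]
      have e1 : (6 * (k : ℕ) + R t k) / 6 = k := by omega
      have e2 : (6 * (k : ℕ) + R t k) % 6 = R t k := by omega
      simp only [blockGraph, word, e1, e2]
    · rintro ⟨v, rfl, rfl⟩
      have hv : (v : ℕ) < 6 * K := v.2
      -- Row `2 * v` passes through node `v`; this also covers the last block, which has no outgoing
      -- edges.
      refine ⟨⟨2 * v, by omega⟩, ?_⟩
      rw [spell _ _ (by dsimp only; omega)]
      have := hR1 ⟨2 * v, by omega⟩
      have e1 : 2 * (v : ℕ) / 12 = v / 6 := by omega
      have e2 : 2 * (v : ℕ) / 2 = v := by omega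
      simp only [e1, e2] at this
      simp only [this, word, blockGraph]
  · intro v w h1 h2
    have h1 : (v : ℕ) / 6 = w / 6 := congrArg Fin.val h1
    have h2 : word (v / 6) (v % 6) = word (w / 6) (w % 6) := h2
    rw [← h1] at h2
    have := word_inj _ _ _ (Nat.mod_lt _ (by norm_num)) (Nat.mod_lt _ (by norm_num)) h2
    exact Fin.ext (by omega)
  · intro v w
    have hv : (v : ℕ) < 6 * K := v.2
    have hw : (w : ℕ) < 6 * K := w.2
    refine (mem_edges_blockGraph hσ κ K v w).trans ?_
    refine and_congr_right fun hvw => ?_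
    have sp : ∀ t, spellSegment A t (4 * ((v : ℕ) / 6)) (4 * ((w : ℕ) / 6 + 1)) =
        word (v / 6) (R t (v / 6)) ++ word (w / 6) (R t (w / 6)) := by
      intro t
      rw [spellSegment_append A t (mid := 4 * ((w : ℕ) / 6)) (by omega) (by omega),
        spell _ _ (by omega), hvw, spell _ _ (by omega)]
    simp only [Fin.val_castSucc, Fin.val_succ, sp]
    change _ ↔ ∃ t, _ = word (v / 6) (v % 6) ++ word (w / 6) (w % 6)
    constructor
    · intro h
      -- The row whose number is that of the edge from `v` to `w`.
      refine ⟨⟨2 * v + w % 2, by omega⟩, ?_⟩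
      have h1 := hR1 ⟨2 * v + w % 2, by omega⟩
      have h2 := hR2 ⟨2 * v + w % 2, by omega⟩
      have e1 : (2 * (v : ℕ) + w % 2) / 12 = v / 6 := by omega
      have e2 : (2 * (v : ℕ) + w % 2) / 2 = v := by omega
      have e3 : (2 * (v : ℕ) + w % 2) % 2 = w % 2 := by omega
      simp only [e1, e2, e3, h] at h1 h2
      rw [hvw, h1, h2]
      congr 2
      omega
    · rintro ⟨t, ht⟩
      have hlen : ∀ k, κ k ≠ none → ∀ q, (word k q).length = 3 := by
        intro k hk q
        obtain ⟨b, hb⟩ := Option.ne_none_iff_exists'.mp hk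
        simp [word, hb, blockLabel_some_length]
      -- The spelled string is cut at the right place because the left or the right factor has
      -- length three on both sides. Hence the row visits `v` and `w` themselves, and rows follow
      -- edges.
      have hboth : word (v / 6) (R t (v / 6)) = word (v / 6) (v % 6) ∧
          word (w / 6) (R t (w / 6)) = word (w / 6) (w % 6) := by
        rcases hκ (v / 6) with h | h
        · exact List.append_inj ht (by rw [hlen _ h, hlen _ h])
        · rw [← hvw] at h
          exact List.append_inj' ht (by rw [hlen _ h, hlen _ h])
      have e1 := word_inj _ _ _ (hR6 _ _) (Nat.mod_lt _ (by norm_num)) hboth.1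
      have e2 := word_inj _ _ _ (hR6 _ _) (Nat.mod_lt _ (by norm_num)) hboth.2
      rw [← e1, ← e2, hvw]
      exact hR t _

/-! ### The encoding of a block graph as a list of numbers -/

/-- The node entries of a block in the encoding of a block graph. -/
def blockCode (κ : Option Bool) : List ℕ :=
  (List.range 6).flatMap fun q => (blockLabel κ q).length :: blockLabel κ q

/-- This is the form in which `buildGraph` can write the encoding: two numbers, a loop over the
edges and a loop over the blocks. -/
lemma encode_blockGraph : (blockGraph hσ κ K).encode =
    [6 * K, 12 * (K - 1)] ++ (List.range (12 * (K - 1))).flatMap (fun e => [e / 2, edgeTarget κ e])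
      ++ (List.range K).flatMap fun k => blockCode (κ k) := by
  have h1 : (List.ofFn fun v : Fin (6 * K) => (blockLabel (κ ((v : ℕ) / 6)) (v % 6)).length ::
      blockLabel (κ ((v : ℕ) / 6)) (v % 6)).flatten =
      (List.range K).flatMap fun k => blockCode (κ k) := by
    have h2 : (List.finRange (6 * K)).map Fin.val = List.range (6 * K) := by simp
    have h3 : ∀ f : ℕ → List ℕ, List.ofFn (fun v : Fin (6 * K) => f v) =
        (List.range (6 * K)).map f := by
      intro f; rw [List.ofFn_eq_map, ← h2, List.map_map]; rfl
    rw [h3 fun v => (blockLabel (κ (v / 6)) (v % 6)).length :: blockLabel (κ (v / 6)) (v % 6)]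
    clear h3 h2
    induction K with
    | zero => simp
    | succ K ih =>
      rw [List.range_succ, List.flatMap_append, ← ih, Nat.mul_succ, List.range_add]
      rw [List.map_append, List.flatten_append, List.flatMap_singleton, blockCode,
        List.flatMap_def (l := List.range 6), List.map_map]
      congr 2
      apply List.map_congr_left
      intro q hq
      have hq : q < 6 := by simpa using hq
      have e1 : (6 * K + q) / 6 = K := by omega
      have e2 : (6 * K + q) % 6 = q := by omega
      simp only [Function.comp, e1, e2]
  unfold LabeledGraph.encode
  congr 1
  · congr 1
    · simp [blockGraph]
    · simp only [blockGraph, List.map_ofFn, List.flatMap_def]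
      congr 1
      have h2 : (List.finRange (12 * (K - 1))).map Fin.val = List.range (12 * (K - 1)) := by simp
      rw [List.ofFn_eq_map, ← h2, List.map_map]; rfl
  · rw [← h1]
    simp only [blockGraph, List.length_map, map_val_map_letter hσ (blockLabel_lt_four _ _)]

end BlockGraph

/-! ### Occurrences of query words -/

/-- The kinds of the blocks of the graph of the vectors `y 0, y 1, …` of length `d`. -/
def vectorKind (d : ℕ) (y : ℕ → ℕ → Bool) (k : ℕ) : Option Bool :=
  if k % (d + 1) = 0 then none else some (y (k / (d + 1)) (k % (d + 1) - 1))

/-- The letters of a query that distinguish the vectors `x 0, x 1, …` of length `d`. -/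
def queryLetter (d : ℕ) (x : ℕ → ℕ → Bool) (m : ℕ) : ℕ :=
  if m % (d + 1) = d then 3 else (x (m / (d + 1)) (m % (d + 1))).toNat

/-- The end of a query word that starts with the letter `z m`. -/
def queryTail (z : ℕ → ℕ) (m r : ℕ) : List ℕ :=
  (List.range' m r).flatMap (fun m => [2, 2, z m]) ++ [3, 3]

/-- The query word for the first `S` of the vectors `x 0, x 1, …` of length `d`. -/
def queryWord (d : ℕ) (x : ℕ → ℕ → Bool) (S : ℕ) : List ℕ :=
  [3, 3, 3] ++ queryTail (queryLetter d x) 0 (S * (d + 1))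

lemma queryTail_zero (z : ℕ → ℕ) (m : ℕ) : queryTail z m 0 = [3, 3] := rfl

lemma queryTail_succ (z : ℕ → ℕ) (m r : ℕ) :
    queryTail z m (r + 1) = 2 :: 2 :: z m :: queryTail z (m + 1) r := by
  simp [queryTail, List.range'_succ]

lemma mul_succ_add_mod {d a h : ℕ} (hh : h ≤ d) : (a * (d + 1) + h) % (d + 1) = h := by
  rw [mul_comm, Nat.mul_add_mod, Nat.mod_eq_of_lt (by omega)]

lemma vectorKind_separator (d : ℕ) (y : ℕ → ℕ → Bool) (b : ℕ) :
    vectorKind d y (b * (d + 1)) = none := by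
  simp [vectorKind]

lemma vectorKind_bit {d h : ℕ} (hh : h < d) (y : ℕ → ℕ → Bool) (b : ℕ) :
    vectorKind d y (b * (d + 1) + h + 1) = some (y b h) := by
  have e1 : (b * (d + 1) + h + 1) % (d + 1) = h + 1 := by
    rw [add_assoc, mul_succ_add_mod (by omega)]
  have e2 : (b * (d + 1) + h + 1) / (d + 1) = b := by
    rw [add_assoc, mul_comm, Nat.mul_add_div (by omega), Nat.div_eq_of_lt (by omega), add_zero]
  simp [vectorKind, e1, e2]

lemma vectorKind_ne_none {d : ℕ} (hd : 1 ≤ d) (y : ℕ → ℕ → Bool) (k : ℕ) :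
    vectorKind d y k ≠ none ∨ vectorKind d y (k + 1) ≠ none := by
  by_cases h : k % (d + 1) = 0
  · right
    have : (k + 1) % (d + 1) = 1 := by
      rw [Nat.add_mod, h, Nat.zero_add, Nat.mod_mod, Nat.mod_eq_of_lt (by omega)]
    simp [vectorKind, this]
  · left; simp [vectorKind, h]

lemma queryLetter_separator (d : ℕ) (x : ℕ → ℕ → Bool) (a : ℕ) :
    queryLetter d x (a * (d + 1) + d) = 3 := by
  simp [queryLetter, mul_succ_add_mod le_rfl]

lemma queryLetter_bit {d h : ℕ} (hh : h < d) (x : ℕ → ℕ → Bool) (a : ℕ) :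
    queryLetter d x (a * (d + 1) + h) = (x a h).toNat := by
  have e1 : (a * (d + 1) + h) % (d + 1) = h := mul_succ_add_mod (by omega)
  have e2 : (a * (d + 1) + h) / (d + 1) = a := by
    rw [mul_comm, Nat.mul_add_div (by omega), Nat.div_eq_of_lt (by omega), add_zero]
  simp [queryLetter, e1, e2, hh.ne]

lemma queryWord_lt_four (d : ℕ) (x : ℕ → ℕ → Bool) (S : ℕ) : ∀ a ∈ queryWord d x S, a < 4 := by
  have : ∀ m, queryLetter d x m < 4 := by
    intro m
    have := (x (m / (d + 1)) (m % (d + 1))).toNat_lt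
    unfold queryLetter; split <;> omega
  intro a ha
  simp only [queryWord, queryTail, List.mem_append, List.mem_flatMap, List.mem_cons,
    List.not_mem_nil, or_false] at ha
  rcases ha with ha | ⟨m, -, ha⟩ | ha
  · omega
  · have := this m; omega
  · omega

/-- The numbers of two adjacent nodes. -/
def BlockAdj (κ : ℕ → Option Bool) (v w : ℕ) : Prop :=
  w / 6 = v / 6 + 1 ∧ nextLane (κ (v / 6)) (v % 6) = w % 6 / 2

/-- The string read along a sequence of nodes. -/
def blockString (κ : ℕ → Option Bool) (P : List ℕ) : List ℕ :=
  (P.map fun v => blockLabel (κ (v / 6)) (v % 6)).flatten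

lemma blockString_cons (κ : ℕ → Option Bool) (v : ℕ) (P : List ℕ) :
    blockString κ (v :: P) = blockLabel (κ (v / 6)) (v % 6) ++ blockString κ P := by
  simp [blockString]

lemma infix_append_cases {α : Type*} {Q a b : List α} (h : Q <:+: a ++ b) :
    (∃ i < a.length, Q <+: a.drop i ++ b) ∨ Q <:+: b := by
  obtain ⟨s, t, h⟩ := h
  by_cases hs : s.length < a.length
  · left
    refine ⟨s.length, hs, t, ?_⟩
    have := congrArg (List.drop s.length) h
    rwa [List.append_assoc, List.drop_left, List.drop_append_of_le_length hs.le] at this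
  · right
    push Not at hs
    refine ⟨s.drop a.length, t, ?_⟩
    have := congrArg (List.drop a.length) h
    rwa [List.append_assoc, List.drop_append_of_le_length hs, List.drop_left,
      ← List.append_assoc] at this

/-! ### Soundness: an occurrence yields an orthogonal pair -/

section Soundness

variable {d : ℕ} {x y : ℕ → ℕ → Bool} {S : ℕ}

lemma queryTail_ne_nil (z : ℕ → ℕ) (m r : ℕ) : queryTail z m r ≠ [] := by simp [queryTail]

lemma cons_cons_prefix_queryTail {z : ℕ → ℕ} {m r : ℕ} {l : List ℕ}
    (h : queryTail z m r <+: 2 :: l) : ∃ r', r = r' + 1 := by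
  cases r with
  | zero => simp [queryTail_zero] at h
  | succ r => exact ⟨r, rfl⟩

/-- The number of the lane, `v % 6 / 2`, is the number of letters of the current triple `22z` that
earlier nodes have already read; hence the `drop`. A path in lane 0 cannot finish the query, since
after the last separator letter the query continues with `3` and lane 0 with `2`. It thus enters
lane 1 in front of a whole vector, where the second claim, for `h = 0`, gives orthogonality. Both
claims are proved together by induction along the path. -/
lemma orthogonal_of_lane (hd : 1 ≤ d) (rest : List ℕ) :
    ∀ (v a b h r : ℕ), (v :: rest).IsChain (BlockAdj (vectorKind d y)) → h ≤ d →
      v / 6 = b * (d + 1) + h + 1 → a * (d + 1) + h + (r + 1) = S * (d + 1) →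
      (queryTail (queryLetter d x) (a * (d + 1) + h) (r + 1)).drop (v % 6 / 2) <+:
        blockString (vectorKind d y) (v :: rest) →
      (v % 6 / 2 = 0 → ∃ i j, ∀ h < d, ¬ (x i h = true ∧ y j h = true)) ∧
      (v % 6 / 2 = 1 → ∀ h', h ≤ h' → h' < d → ¬ (x a h' = true ∧ y b h' = true)) := by
  induction rest with
  | nil =>
    intro v a b h r _ hh hv hr hQ
    have hlt := Nat.mod_lt v (show 6 > 0 by norm_num)
    have hlen := hQ.length_le
    rw [queryTail_succ, blockString_cons] at hQ
    -- The last node is too short: at a separator in lane 0, at least five letters remain and the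
    -- label has at most four; inside a vector in lanes 0 and 1, at least four remain and the label
    -- has three.
    rcases hh.eq_or_lt with rfl | hh
    · refine ⟨fun hl => absurd hQ ?_, fun _ h' h1 h2 => by omega⟩
      rw [hv, show b * (h + 1) + h + 1 = (b + 1) * (h + 1) by ring,
        vectorKind_separator, queryLetter_separator]
      have : v % 6 = 0 ∨ v % 6 = 1 := by omega
      rcases this with e | e <;> rcases r with _ | r <;>
        simp [e, blockLabel, blockString, queryTail_zero, queryTail_succ]
    · have hne := queryTail_ne_nil (queryLetter d x) (a * (d + 1) + h + 1) r
      have hlen' : 2 ≤ (queryTail (queryLetter d x) (a * (d + 1) + h + 1) r).length := by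
        simp [queryTail]
      rw [← queryTail_succ, ← blockString_cons, blockString_cons, hv, vectorKind_bit hh] at hQ
      have := hQ.length_le
      simp only [List.length_drop, queryTail_succ, List.length_cons, List.length_append,
        blockLabel_some_length, blockString, List.map_nil, List.flatten_nil,
        List.length_nil] at this
      constructor <;> intro <;> omega
  | cons w rest ih =>
    intro v a b h r hc hh hv hr hQ
    have hlt := Nat.mod_lt v (show 6 > 0 by norm_num)
    obtain ⟨⟨hw1, hw2⟩, hc'⟩ := List.isChain_cons_cons.mp hc
    rw [queryTail_succ, blockString_cons] at hQ
    rcases hh.eq_or_lt with rfl | hh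
    · refine ⟨fun hl => ?_, fun _ h' h1 h2 => by omega⟩
      have hk : v / 6 = (b + 1) * (h + 1) := by rw [hv]; ring
      rw [hk, vectorKind_separator, queryLetter_separator] at hQ
      rw [hk, vectorKind_separator] at hw2
      have hwk : w / 6 = (b + 1) * (h + 1) + 0 + 1 := by omega
      have hm : a * (h + 1) + h + 1 = (a + 1) * (h + 1) + 0 := by ring
      rw [hm] at hQ
      rcases (by omega : v % 6 = 0 ∨ v % 6 = 1) with e | e
      · have hw3 : w % 6 / 2 = 0 := by simpa [e, nextLane] using hw2.symm
        rw [e] at hQ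
        simp only [blockLabel, Nat.zero_div, List.drop_zero, List.cons_append, List.nil_append,
          List.prefix_cons_inj] at hQ
        cases r with
        | zero =>
          exfalso
          rw [queryTail_zero, blockString_cons, hwk, vectorKind_bit hd] at hQ
          rcases (by omega : w % 6 = 0 ∨ w % 6 = 1) with e | e <;> simp [e, blockLabel] at hQ
        | succ r =>
          refine (ih w (a + 1) (b + 1) 0 r hc' (Nat.zero_le _) hwk (by rw [← hm]; omega) ?_).1 hw3
          rw [hw3]; exact hQ
      -- Node 1 has the label `2232`, whose last letter forces the query to go on with a further
      -- triple. The next vectors of query and graph are then compared in lane 1 from their first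
      -- bits on.
      · have hw3 : w % 6 / 2 = 1 := by simpa [e, nextLane] using hw2.symm
        rw [e] at hQ
        simp only [blockLabel, Nat.reduceDiv, List.drop_zero, List.cons_append, List.nil_append,
          List.prefix_cons_inj] at hQ
        obtain ⟨r, rfl⟩ := cons_cons_prefix_queryTail hQ
        refine ⟨a + 1, b + 1, fun h' hh' => (ih w (a + 1) (b + 1) 0 r hc' (Nat.zero_le _) hwk
          (by rw [← hm]; omega) ?_).2 hw3 h' (Nat.zero_le _) hh'⟩
        rw [queryTail_succ] at hQ ⊢
        rw [hw3]
        simpa using hQ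
    · have hr' : ∃ r', r = r' + 1 := by
        rcases r with _ | r
        · exfalso
          have h1 : (a * (d + 1) + h + (0 + 1)) % (d + 1) = 0 := by rw [hr]; simp
          rw [zero_add, add_assoc, mul_succ_add_mod (by omega)] at h1
          omega
        · exact ⟨r, rfl⟩
      obtain ⟨r, rfl⟩ := hr'
      rw [hv, vectorKind_bit hh, queryLetter_bit hh] at hQ
      rw [hv, vectorKind_bit hh] at hw2
      have hw3 : w % 6 / 2 = v % 6 / 2 := by
        have : nextLane (some (y b h)) (v % 6) = v % 6 / 2 := by simp [nextLane]; omega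
        omega
      have key := ih w a b (h + 1) r hc' hh (by omega) (by omega)
      rw [hw3] at key
      constructor
      · intro hl
        refine (key ?_).1 hl
        rw [hl] at hQ ⊢
        rcases (by omega : v % 6 = 0 ∨ v % 6 = 1) with e | e <;>
          · rw [e] at hQ
            simp only [blockLabel, List.drop_zero, List.cons_append, List.nil_append,
              List.cons_prefix_cons, true_and] at hQ
            exact hQ.2
      · intro hl h' h1 h2
        rw [hl] at hQ key
        -- In lane 1 node 2 offers the letter 0, and node 3 offers 1 or, over a bit 1 of the graph,
        -- the letter 3, which is not a bit.
        have hz : ¬ (x a h = true ∧ y b h = true) ∧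
            (queryTail (queryLetter d x) (a * (d + 1) + h + 1) (r + 1)).drop 1 <+:
              blockString (vectorKind d y) (w :: rest) := by
          rw [queryTail_succ] at hQ ⊢
          rcases (by omega : v % 6 = 2 ∨ v % 6 = 3) with e | e <;>
          · rw [e] at hQ
            simp only [blockLabel, List.drop_succ_cons, List.drop_zero, List.cons_append,
              List.nil_append, List.cons_prefix_cons, true_and] at hQ ⊢
            refine ⟨?_, hQ.2⟩
            rintro ⟨h3, h4⟩
            simp [h3, h4] at hQ
        rcases h1.eq_or_lt with rfl | h1
        · exact hz.1
        · exact (key hz.2).2 rfl h' h1 h2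

/-- The word `333` pins down the start of the query. No label of a bit block begins or ends with `3`
or contains `33`, and separators are not adjacent; so `333` is exactly the label of node 5 of a
separator. From there the path continues in lane 0 at the first bit of a vector. -/
lemma exists_orthogonal_of_infix (hd : 1 ≤ d) (hS : 1 ≤ S) (P : List ℕ)
    (hP : P.IsChain (BlockAdj (vectorKind d y)))
    (hQ : queryWord d x S <:+: blockString (vectorKind d y) P) :
    ∃ i j, ∀ h < d, ¬ (x i h = true ∧ y j h = true) := by
  induction P with
  | nil => simp [blockString, queryWord] at hQ
  | cons v rest ih =>
    rw [blockString_cons] at hQ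
    rcases infix_append_cases hQ with ⟨i, hi, hQ⟩ | hQ
    swap
    · exact ih hP.tail hQ
    have hlt := Nat.mod_lt v (show 6 > 0 by norm_num)
    have hi4 := hi.trans_le (blockLabel_length_le _ _)
    rw [queryWord] at hQ
    rcases hκ : vectorKind d y (v / 6) with _ | b
    · rw [hκ] at hQ hi
      have hnot : ∀ l, ¬ 3 :: l <+: blockString (vectorKind d y) rest := by
        intro l
        cases rest with
        | nil => simp [blockString]
        | cons w rest =>
          obtain ⟨⟨hw1, -⟩, -⟩ := List.isChain_cons_cons.mp hP
          have hb : vectorKind d y (w / 6) ≠ none := by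
            rw [hw1]
            exact (vectorKind_ne_none hd y (v / 6)).resolve_left (by simp [hκ])
          obtain ⟨b, hb⟩ := Option.ne_none_iff_exists'.mp hb
          rw [blockString_cons, hb]
          have hlt := Nat.mod_lt w (show 6 > 0 by norm_num)
          generalize w % 6 = q at hlt
          interval_cases q <;> simp [blockLabel]
      have h5 : v % 6 = 5 ∧ i = 0 := by
        generalize v % 6 = q at *
        interval_cases q <;> interval_cases i <;> simp [blockLabel] at hi hQ ⊢ <;>
          exact hnot _ hQ
      obtain ⟨h5, rfl⟩ := h5
      rw [h5] at hQ
      simp only [blockLabel, List.drop_zero, List.cons_append, List.nil_append,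
        List.prefix_cons_inj] at hQ
      cases rest with
      | nil => exact absurd (List.prefix_nil.mp hQ) (queryTail_ne_nil _ _ _)
      | cons w rest =>
        obtain ⟨⟨hw1, hw2⟩, hc⟩ := List.isChain_cons_cons.mp hP
        have hw3 : w % 6 / 2 = 0 := by simpa [hκ, h5, nextLane] using hw2.symm
        have hk : v / 6 = v / 6 / (d + 1) * (d + 1) := by
          have : v / 6 % (d + 1) = 0 := by
            by_contra h; simp [vectorKind, h] at hκ
          exact (Nat.div_mul_cancel (Nat.dvd_of_mod_eq_zero this)).symm
        obtain ⟨r, hr⟩ : ∃ r, S * (d + 1) = r + 1 :=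
          Nat.exists_eq_succ_of_ne_zero (Nat.mul_pos hS (Nat.succ_pos d)).ne'
        refine (orthogonal_of_lane (S := S) hd rest w 0 (v / 6 / (d + 1)) 0 r hc (Nat.zero_le _)
          (by omega) (by omega) ?_).1 hw3
        rw [hw3, ← hr]
        simpa using hQ
    · exfalso
      rw [hκ] at hQ hi
      generalize v % 6 = q at *
      cases b <;> interval_cases q <;> interval_cases i <;> simp [blockLabel] at hi hQ

end Soundness

/-! ### Completeness: an orthogonal pair yields an occurrence -/

section Completeness

variable {d : ℕ} {x y : ℕ → ℕ → Bool} {S i : ℕ}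

/-- The lane in which vector number `i'` of a query is read if vector number `i` is tested. -/
def laneOf (i i' : ℕ) : ℕ := if i' < i then 0 else if i' = i then 1 else 2

/-- The node at which letter number `m` of a query is read if vector number `i` is tested. -/
def nodeChoice (d : ℕ) (x : ℕ → ℕ → Bool) (S i m : ℕ) : ℕ :=
  if m % (d + 1) = d then
    if m / (d + 1) + 1 < i then 0 else if m / (d + 1) + 1 = i then 1
    else if m / (d + 1) = i then 3 else if m / (d + 1) + 1 < S then 4 else 5
  else 2 * laneOf i (m / (d + 1)) + (x (m / (d + 1)) (m % (d + 1))).toNat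

lemma nodeChoice_lt (m : ℕ) : nodeChoice d x S i m < 6 := by
  have := (x (m / (d + 1)) (m % (d + 1))).toNat_lt
  unfold nodeChoice laneOf; split_ifs <;> omega

lemma mul_succ_add_div {d a h : ℕ} (hh : h ≤ d) : (a * (d + 1) + h) / (d + 1) = a := by
  rw [mul_comm, Nat.mul_add_div (by omega), Nat.div_eq_of_lt (by omega), add_zero]

lemma nodeChoice_bit {h : ℕ} (hh : h < d) (a : ℕ) :
    nodeChoice d x S i (a * (d + 1) + h) = 2 * laneOf i a + (x a h).toNat := by
  simp [nodeChoice, mul_succ_add_mod hh.le, mul_succ_add_div hh.le, hh.ne]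

lemma nodeChoice_separator (a : ℕ) : nodeChoice d x S i (a * (d + 1) + d) =
    if a + 1 < i then 0 else if a + 1 = i then 1 else if a = i then 3
    else if a + 1 < S then 4 else 5 := by
  simp [nodeChoice, mul_succ_add_mod le_rfl, mul_succ_add_div le_rfl]

/-- From any letter to the end, the chosen nodes spell the query except for the `laneOf i a` letters
that the preceding node has read. The longer labels at the separators around vector `i` produce
these shifts, and node 5 reads the last separator letter together with the final `33`. Since `i + 1
< S`, that last separator lies in lane 2. Orthogonality is needed only in lane 1. The induction runs
over the number of remaining triples. -/
lemma flatMap_blockLabel (hd : 1 ≤ d) (hi : 1 ≤ i) (hiS : i + 1 < S) {j : ℕ}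
    (hxy : ∀ h < d, ¬ (x i h = true ∧ y (j + i) h = true)) (r : ℕ) :
    ∀ a h, h ≤ d → a * (d + 1) + h + (r + 1) = S * (d + 1) →
      (List.range' (a * (d + 1) + h) (r + 1)).flatMap (fun m =>
        blockLabel (vectorKind d y (j * (d + 1) + m + 1)) (nodeChoice d x S i m)) =
      (queryTail (queryLetter d x) (a * (d + 1) + h) (r + 1)).drop (laneOf i a) := by
  induction r with
  | zero =>
    intro a h hh hr
    have hm : a * (d + 1) + h + 1 = S * (d + 1) := by omega
    have hhd : h = d := by
      have h1 : (a * (d + 1) + (h + 1)) % (d + 1) = 0 := by rw [← add_assoc, hm]; simp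
      by_contra hne
      rw [mul_succ_add_mod (by omega)] at h1
      omega
    subst hhd
    have haS : a + 1 = S := Nat.eq_of_mul_eq_mul_right (show 0 < h + 1 by omega) (by rw [← hm]; ring)
    have hk : vectorKind h y (j * (h + 1) + (a * (h + 1) + h) + 1) = none := by
      rw [show j * (h + 1) + (a * (h + 1) + h) + 1 = (j + a + 1) * (h + 1) by ring]
      exact vectorKind_separator _ _ _
    rw [queryTail_succ, queryTail_zero, queryLetter_separator, List.range'_succ,
      List.flatMap_cons, hk, nodeChoice_separator]
    have h1 : ¬ a + 1 < i := by omega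
    have h2 : ¬ a + 1 = i := by omega
    have h3 : ¬ a = i := by omega
    have h4 : ¬ a + 1 < S := by omega
    have h5 : ¬ a < i := by omega
    simp [laneOf, h1, h2, h3, h4, h5, blockLabel]
  | succ r ih =>
    intro a h hh hr
    rw [List.range'_succ, List.flatMap_cons, queryTail_succ]
    rcases hh.eq_or_lt with rfl | hh
    · have hk : vectorKind h y (j * (h + 1) + (a * (h + 1) + h) + 1) = none := by
        rw [show j * (h + 1) + (a * (h + 1) + h) + 1 = (j + a + 1) * (h + 1) by ring]
        exact vectorKind_separator _ _ _
      have hm : a * (h + 1) + h + 1 = (a + 1) * (h + 1) + 0 := by ring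
      have haS : a + 1 < S := by
        by_contra hcon
        have := Nat.mul_le_mul_right (h + 1) (not_lt.mp hcon)
        have h2 : (a + 1) * (h + 1) = a * (h + 1) + h + 1 := by ring
        omega
      rw [hm, ih (a + 1) 0 (Nat.zero_le _) (by omega), hk, nodeChoice_separator,
        queryLetter_separator, queryTail_succ]
      rcases lt_trichotomy (a + 1) i with h1 | h1 | h1
      · have h2 : a < i := by omega
        simp [laneOf, h1, h2, blockLabel]
      · have h2 : a < i := by omega
        simp [laneOf, h1, h2, blockLabel]
      · have h2 : ¬ a + 1 < i := by omega
        have h3 : ¬ a + 1 = i := by omega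
        have h5 : ¬ a < i := by omega
        by_cases h4 : a = i
        · simp [laneOf, h4, blockLabel]
        · simp [laneOf, h2, h3, h4, h5, haS, blockLabel]
    · have hk : vectorKind d y (j * (d + 1) + (a * (d + 1) + h) + 1) = some (y (j + a) h) := by
        rw [show j * (d + 1) + (a * (d + 1) + h) + 1 = (j + a) * (d + 1) + h + 1 by ring]
        exact vectorKind_bit hh _ _
      rw [show a * (d + 1) + h + 1 = a * (d + 1) + (h + 1) from rfl, ih a (h + 1) hh (by omega),
        hk, nodeChoice_bit hh, queryLetter_bit hh, queryTail_succ]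
      unfold laneOf
      split_ifs with h1 h2
      · cases x a h <;> simp [blockLabel]
      · subst h2
        cases hx : x a h
        · simp [blockLabel]
        · cases hy : y (j + a) h
          · simp [blockLabel]
          · exact absurd ⟨hx, hy⟩ (hxy h hh)
      · cases x a h <;> simp [blockLabel]

lemma nextLane_nodeChoice (hd : 1 ≤ d) (hiS : i + 1 < S) (j m : ℕ)
    (hm : m + 1 < S * (d + 1)) :
    nextLane (vectorKind d y (j * (d + 1) + m + 1)) (nodeChoice d x S i m) =
      nodeChoice d x S i (m + 1) / 2 := by
  obtain ⟨a, h, hh, rfl⟩ : ∃ a h, h ≤ d ∧ m = a * (d + 1) + h :=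
    ⟨m / (d + 1), m % (d + 1), Nat.lt_succ_iff.mp (Nat.mod_lt _ (Nat.succ_pos d)),
      by rw [mul_comm]; exact (Nat.div_add_mod _ _).symm⟩
  rcases hh.eq_or_lt with rfl | hh
  · have hk : vectorKind h y (j * (h + 1) + (a * (h + 1) + h) + 1) = none := by
      rw [show j * (h + 1) + (a * (h + 1) + h) + 1 = (j + a + 1) * (h + 1) by ring]
      exact vectorKind_separator _ _ _
    have haS : a + 1 < S := by
      by_contra hcon
      have := Nat.mul_le_mul_right (h + 1) (not_lt.mp hcon)
      have h2 : (a + 1) * (h + 1) = a * (h + 1) + h + 1 := by ring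
      omega
    have hx := (x (a + 1) 0).toNat_lt
    rw [hk, show a * (h + 1) + h + 1 = (a + 1) * (h + 1) + 0 by ring, nodeChoice_bit hd,
      nodeChoice_separator]
    simp only [nextLane, if_true]
    unfold laneOf
    split_ifs <;> omega
  · have hk : vectorKind d y (j * (d + 1) + (a * (d + 1) + h) + 1) = some (y (j + a) h) := by
      rw [show j * (d + 1) + (a * (d + 1) + h) + 1 = (j + a) * (d + 1) + h + 1 by ring]
      exact vectorKind_bit hh _ _
    have hx := (x a h).toNat_lt
    rw [hk, nodeChoice_bit hh, show a * (d + 1) + h + 1 = a * (d + 1) + (h + 1) from rfl]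
    rcases (Nat.succ_le_iff.mpr hh).eq_or_lt with h1 | h1
    · have h1 : h + 1 = d := h1
      rw [h1, nodeChoice_separator]
      unfold laneOf nextLane
      by_cases haS : a + 1 < S
      · simp only [haS, if_true]
        split_ifs <;> simp_all <;> omega
      · have h2 : ¬ a + 1 < i := by omega
        have h3 : ¬ a + 1 = i := by omega
        have h4 : ¬ a < i := by omega
        have h5 : ¬ a = i := by omega
        simp [haS, h2, h3, h4, h5]
        omega
    · have h1 : h + 1 < d := h1
      have hx' := (x a (h + 1)).toNat_lt
      rw [nodeChoice_bit h1]
      simp only [nextLane, reduceCtorEq, if_false]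
      unfold laneOf
      split_ifs <;> omega

end Completeness

/-- A query word occurs in the graph of the vectors `y 0, …` if one of its inner vectors is
orthogonal to a vector that is sufficiently far from both ends of the graph, and only if one of the
vectors `x 0, …` is orthogonal to one of the vectors `y 0, …`. -/
lemma exists_orthogonal_of_occurs {σ : ℕ} (hσ : 4 ≤ σ) {d S K : ℕ} (hd : 1 ≤ d) (hS : 1 ≤ S)
    {x y : ℕ → ℕ → Bool}
    (h : (blockGraph hσ (vectorKind d y) K).Occurs ((queryWord d x S).map (letter hσ))) :
    ∃ i j, ∀ h < d, ¬ (x i h = true ∧ y j h = true) := by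
  obtain ⟨P, hP, hQ⟩ := h
  refine exists_orthogonal_of_infix hd hS (P.map Fin.val) ?_ ?_
  · rw [List.isChain_map]
    exact hP.imp fun v w hvw => (mem_edges_blockGraph hσ _ K v w).mp hvw
  · have := hQ.map Fin.val
    rw [map_val_map_letter hσ (queryWord_lt_four _ _ _), List.map_flatten, List.map_map] at this
    convert this using 1
    rw [blockString, List.map_map]
    congr 1
    exact List.map_congr_left fun v _ => (map_val_map_letter hσ (blockLabel_lt_four _ _)).symm

lemma occurs_of_orthogonal {σ : ℕ} (hσ : 4 ≤ σ) {d S T i j : ℕ} (hd : 1 ≤ d)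
    {x y : ℕ → ℕ → Bool} (hi : 1 ≤ i) (hiS : i + 1 < S) (hij : i ≤ j) (hj : j + S < T + i)
    (hxy : ∀ h < d, ¬ (x i h = true ∧ y j h = true)) :
    (blockGraph hσ (vectorKind d y) (T * (d + 1))).Occurs
      ((queryWord d x S).map (letter hσ)) := by
  -- From here on, vector `0` of the query lies over vector `j` of the graph, and the tested vector
  -- of the graph is number `j + i`.
  obtain ⟨j, rfl⟩ := Nat.exists_eq_add_of_le' hij
  set κ := vectorKind d y
  have hsize : (j + S) * (d + 1) + (d + 1) ≤ T * (d + 1) := by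
    rw [← Nat.succ_mul]; exact Nat.mul_le_mul_right _ (by omega)
  rw [add_mul] at hsize
  -- The path starts at the separator in front of vector `j`, where node 5 reads `333`; this shifts
  -- the letters by one.
  let q : ℕ → ℕ := fun t => if t = 0 then 5 else nodeChoice d x S i (t - 1)
  have hq : ∀ t, q t < 6 := by
    intro t; dsimp only [q]; split
    · norm_num
    · exact nodeChoice_lt _
  let P : List (Fin (blockGraph hσ κ (T * (d + 1))).numNodes) :=
    List.ofFn fun t : Fin (S * (d + 1) + 1) => ⟨6 * (j * (d + 1) + t) + q t, by
      have := hq t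
      change _ < 6 * (T * (d + 1))
      omega⟩
  have e1 : ∀ t, (6 * (j * (d + 1) + t) + q t) / 6 = j * (d + 1) + t := by
    intro t; have := hq t; omega
  have e2 : ∀ t, (6 * (j * (d + 1) + t) + q t) % 6 = q t := by
    intro t; have := hq t; omega
  refine ⟨P, ?_, ?_⟩
  · rw [List.isChain_ofFn]
    intro t ht
    refine (mem_edges_blockGraph hσ κ _ _ _).mpr ?_
    dsimp only
    rw [e1, e2, e1, e2]
    refine ⟨by omega, ?_⟩
    rcases t with _ | t
    · have h0 : nodeChoice d x S i 0 = 2 * laneOf i 0 + (x 0 0).toNat := by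
        simpa using nodeChoice_bit (S := S) (x := x) (i := i) (h := 0) hd 0
      have hx := (x 0 0).toNat_lt
      have hl : laneOf i 0 = 0 := by simp [laneOf]; omega
      simp only [q, add_zero, if_true, κ, vectorKind_separator, h0, hl]
      simp [nextLane]
      omega
    · have := nextLane_nodeChoice (x := x) (y := y) hd hiS j t (by omega)
      simpa [q, κ, add_assoc] using this
  · have hflat : (P.map (blockGraph hσ κ (T * (d + 1))).label).flatten =
        ((List.range (S * (d + 1) + 1)).flatMap fun t =>
          blockLabel (κ (j * (d + 1) + t)) (q t)).map (letter hσ) := by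
      have h2 : (List.finRange (S * (d + 1) + 1)).map Fin.val = List.range (S * (d + 1) + 1) := by
        simp
      rw [List.flatMap_def, List.map_flatten, List.map_map, ← h2, List.map_map, List.map_ofFn,
        List.ofFn_eq_map]
      congr 1
      refine List.map_congr_left fun t _ => ?_
      simp only [Function.comp, blockGraph, e1, e2]
    rw [hflat]
    refine List.IsInfix.map _ ?_
    obtain ⟨r, hr⟩ : ∃ r, S * (d + 1) = r + 1 :=
      Nat.exists_eq_succ_of_ne_zero (Nat.mul_pos (by omega) (Nat.succ_pos d)).ne'
    have key := flatMap_blockLabel (x := x) (y := y) (j := j) hd hi hiS hxy r 0 0 (Nat.zero_le _)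
      (by omega)
    have hl : laneOf i 0 = 0 := by simp [laneOf]; omega
    rw [hl, List.drop_zero] at key
    have hflat' : ((List.range (S * (d + 1) + 1)).flatMap fun t =>
        blockLabel (κ (j * (d + 1) + t)) (q t)) = queryWord d x S := by
      rw [List.range_succ_eq_map, List.flatMap_cons, List.flatMap_map, queryWord]
      congr 1
      · simp only [add_zero, κ, vectorKind_separator]; rfl
      · rw [hr, List.range_eq_range']
        simpa [q, κ, add_assoc] using key
    rw [hflat']

/-! ### A small programming language on top of the machine

Variable `x` is kept in register `2 * x`; the registers with odd numbers hold intermediate values.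
-/

/-- Expressions over variables and arrays. -/
inductive RamExpr where
  | num (n : ℕ) : RamExpr
  | var (x : ℕ) : RamExpr
  | op (o : WordOp) (e f : RamExpr) : RamExpr
  | get (a : ℕ) (e : RamExpr) : RamExpr

namespace RamExpr

/-- The value of an expression. -/
def eval (s : RamState) : RamExpr → ℕ
  | num n => n
  | var x => s.reg x
  | op o e f => o.eval (e.eval s) (f.eval s)
  | get a e => s.arr a (e.eval s)

/-- All values that occur during the evaluation are at most `W`. -/
def Bounded (W : ℕ) (s : RamState) : RamExpr → Prop
  | num n => n ≤ W
  | var x => s.reg x ≤ W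
  | op o e f => e.Bounded W s ∧ f.Bounded W s ∧ o.eval (e.eval s) (f.eval s) ≤ W
  | get a e => e.Bounded W s ∧ s.arr a (e.eval s) ≤ W

/-- The time needed for the evaluation. -/
def cost : RamExpr → ℕ
  | num _ => 1
  | var _ => 1
  | op _ e f => e.cost + f.cost + 1
  | get _ e => e.cost + 1

/-- A program that evaluates an expression into the intermediate register number `r`. -/
def code : RamExpr → ℕ → RamProgram
  | num n, r => .const (2 * r + 1) n
  | var x, r => .op .or (2 * r + 1) (2 * x) (2 * x)
  | op o e f, r => .seq (e.code r) (.seq (f.code (r + 1))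
      (.op o (2 * r + 1) (2 * r + 1) (2 * (r + 1) + 1)))
  | get a e, r => .seq (e.code r) (.load (2 * r + 1) a (2 * r + 1))

lemma eval_le {W : ℕ} {s : RamState} {e : RamExpr} (h : e.Bounded W s) : e.eval s ≤ W := by
  cases e with
  | num => exact h
  | var => exact h
  | op => exact h.2.2
  | get => exact h.2

end RamExpr

/-- The machine state `m` represents the state `s` of the variables. -/
def Represents (m s : RamState) : Prop := (∀ x, m.reg (2 * x) = s.reg x) ∧ m.arr = s.arr

/-- Evaluation into intermediate register `r` changes only odd registers from `2 * r + 1` on. Thus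
variables survive, and so does the first operand while the second one is computed. -/
lemma RamExpr.exec_code {W : ℕ} {s : RamState} (e : RamExpr) : ∀ (r : ℕ) (m : RamState),
    Represents m s → e.Bounded W s → ∃ m', RamExec W (e.code r) m e.cost m' ∧
      m'.reg (2 * r + 1) = e.eval s ∧ (∀ x, x < 2 * r + 1 ∨ x % 2 = 0 → m'.reg x = m.reg x) ∧
      m'.arr = m.arr := by
  induction e with
  | num n =>
    intro r m _ hb
    refine ⟨_, .const m _ n hb, by simp [RamState.setReg, eval], fun x hx => ?_, rfl⟩
    exact Function.update_of_ne (by omega) _ _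
  | var x =>
    intro r m hm hb
    -- The bitwise `or` of a number with itself serves as the copy instruction; it never exceeds the
    -- word bound.
    have hv : WordOp.or.eval (m.reg (2 * x)) (m.reg (2 * x)) = s.reg x := by
      simp [WordOp.eval, hm.1]
    refine ⟨_, .op m .or _ _ _ (hv.trans_le hb), ?_, fun x hx => ?_, rfl⟩
    · simpa [RamState.setReg, eval] using hv
    · exact Function.update_of_ne (by omega) _ _
  | op o e f ihe ihf =>
    intro r m hm hb
    obtain ⟨m1, h1, v1, f1, a1⟩ := ihe r m hm hb.1
    obtain ⟨m2, h2, v2, f2, a2⟩ := ihf (r + 1) m1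
      ⟨fun x => by rw [f1 _ (by omega), hm.1], a1.trans hm.2⟩ hb.2.1
    have hv : o.eval (m2.reg (2 * r + 1)) (m2.reg (2 * (r + 1) + 1)) =
        o.eval (e.eval s) (f.eval s) := by
      rw [f2 _ (by omega), v1, v2]
    have key := RamExec.seq _ _ _ _ _ _ _ h1
      (.seq _ _ _ _ _ _ _ h2 (.op m2 o (2 * r + 1) _ _ (hv.trans_le hb.2.2)))
    rw [← add_assoc] at key
    refine ⟨_, key, ?_, fun x hx => ?_, ?_⟩
    · simpa [RamState.setReg, eval] using hv
    · refine (Function.update_of_ne (by omega) _ _).trans ?_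
      rw [f2 _ (by omega), f1 _ hx]
    · exact a2.trans a1
  | get a e ih =>
    intro r m hm hb
    obtain ⟨m1, h1, v1, f1, a1⟩ := ih r m hm hb.1
    have hv : m1.arr a (m1.reg (2 * r + 1)) = s.arr a (e.eval s) := by rw [a1, hm.2, v1]
    refine ⟨_, .seq _ _ _ _ _ _ _ h1 (.load m1 _ a _ (hv.trans_le hb.2)), ?_, fun x hx => ?_, a1⟩
    · simpa [RamState.setReg, eval] using hv
    · refine (Function.update_of_ne (by omega) _ _).trans ?_
      rw [f1 _ hx]

/-- Started in any machine state that represents `s`, the program `p` halts within `B` steps in a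
machine state that represents a state with the property `Q`. -/
def Achieves (W : ℕ) (p : RamProgram) (B : ℕ) (s : RamState) (Q : RamState → Prop) : Prop :=
  ∀ m, Represents m s → ∃ t m' s', RamExec W p m t m' ∧ t ≤ B ∧ Represents m' s' ∧ Q s'

/-- The assignment `x := e`. -/
def assign (x : ℕ) (e : RamExpr) : RamProgram := .seq (e.code 0) (.op .or (2 * x) 1 1)

/-- The assignment `A_a[e] := f`. -/
def write (a : ℕ) (e f : RamExpr) : RamProgram :=
  .seq (e.code 0) (.seq (f.code 1) (.store a 1 3))

/-- Run `p` if `e` is nonzero and `q` otherwise. -/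
def ifNonzero (e : RamExpr) (p q : RamProgram) : RamProgram := .seq (e.code 0) (.ite 1 p q)

/-- Run `p` as long as `e` is nonzero. -/
def whileNonzero (e : RamExpr) (p : RamProgram) : RamProgram :=
  .seq (e.code 0) (.loop 1 (.seq p (e.code 0)))

section Achieves

variable {W B B' : ℕ} {p q : RamProgram} {s : RamState} {e f : RamExpr} {Q Q' : RamState → Prop}

lemma Achieves.mono (h : Achieves W p B s Q) (hB : B ≤ B') (hQ : ∀ s', Q s' → Q' s') :
    Achieves W p B' s Q' := by
  intro m hm
  obtain ⟨t, m', s', h1, h2, h3, h4⟩ := h m hm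
  exact ⟨t, m', s', h1, h2.trans hB, h3, hQ _ h4⟩

lemma achieves_seq (h : Achieves W p B s fun s' => Achieves W q B' s' Q) :
    Achieves W (.seq p q) (B + B') s Q := by
  intro m hm
  obtain ⟨t, m', s', h1, h2, h3, h4⟩ := h m hm
  obtain ⟨t', m'', s'', h1', h2', h3', h4'⟩ := h4 m' h3
  exact ⟨_, m'', s'', .seq _ _ _ _ _ _ _ h1 h1', add_le_add h2 h2', h3', h4'⟩

lemma achieves_skip (h : Q s) : Achieves W .skip 1 s Q :=
  fun m hm => ⟨1, m, s, .skip m, le_rfl, hm, h⟩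

lemma achieves_assign {x : ℕ} (hb : e.Bounded W s) (h : Q (s.setReg x (e.eval s))) :
    Achieves W (assign x e) (e.cost + 1) s Q := by
  intro m hm
  obtain ⟨m1, h1, v1, f1, a1⟩ := e.exec_code 0 m hm hb
  have hv : WordOp.or.eval (m1.reg 1) (m1.reg 1) = e.eval s := by
    simpa [WordOp.eval] using v1
  refine ⟨_, _, s.setReg x (e.eval s), .seq _ _ _ _ _ _ _ h1 (.op m1 .or _ _ _ (hv.trans_le (e.eval_le hb))), le_rfl,
    ⟨fun y => ?_, a1.trans hm.2⟩, h⟩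
  simp only [RamState.setReg, Function.update_apply, hv]
  by_cases hy : y = x
  · simp [hy]
  · rw [if_neg (by omega), if_neg hy, f1 _ (by omega), hm.1]

lemma achieves_write {a : ℕ} (he : e.Bounded W s) (hf : f.Bounded W s)
    (h : Q (s.setArr a (e.eval s) (f.eval s))) :
    Achieves W (write a e f) (e.cost + f.cost + 1) s Q := by
  intro m hm
  obtain ⟨m1, h1, v1, f1, a1⟩ := e.exec_code 0 m hm he
  have hm1 : Represents m1 s := ⟨fun x => by rw [f1 _ (by omega), hm.1], a1.trans hm.2⟩
  obtain ⟨m2, h2, v2, f2, a2⟩ := f.exec_code 1 m1 hm1 hf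
  have hv1 : m2.reg 1 = e.eval s := by rw [f2 _ (by omega)]; exact v1
  have hv2 : m2.reg 3 = f.eval s := v2
  refine ⟨_, _, s.setArr a (e.eval s) (f.eval s), .seq _ _ _ _ _ _ _ h1 (.seq _ _ _ _ _ _ _ h2
    (.store m2 a 1 3 (hv2.trans_le (f.eval_le hf)))), le_of_eq (add_assoc _ _ _).symm,
    ⟨fun x => ?_, ?_⟩, h⟩
  · change m2.reg _ = s.reg x
    rw [f2 _ (by omega), hm1.1]
  · simp only [RamState.setArr, hv1, hv2, a2, hm1.2]

lemma achieves_ifNonzero (hb : e.Bounded W s) (h1 : e.eval s ≠ 0 → Achieves W p B s Q)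
    (h2 : e.eval s = 0 → Achieves W q B s Q) :
    Achieves W (ifNonzero e p q) (e.cost + 1 + B) s Q := by
  intro m hm
  obtain ⟨m1, k1, v1, f1, a1⟩ := e.exec_code 0 m hm hb
  have hm1 : Represents m1 s := ⟨fun x => by rw [f1 _ (by omega), hm.1], a1.trans hm.2⟩
  by_cases h0 : e.eval s = 0
  · obtain ⟨t, m', s', g1, g2, g3, g4⟩ := h2 h0 m1 hm1
    exact ⟨_, m', s', .seq _ _ _ _ _ _ _ k1 (.iteFalse 1 p q _ _ _ (v1.trans h0) g1), by omega,
      g3, g4⟩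
  · obtain ⟨t, m', s', g1, g2, g3, g4⟩ := h1 h0 m1 hm1
    exact ⟨_, m', s', .seq _ _ _ _ _ _ _ k1
      (.iteTrue 1 p q _ _ _ (fun h => h0 (v1.symm.trans h)) g1), by omega, g3, g4⟩

lemma achieves_whileNonzero_done (hb : e.Bounded W s) (h0 : e.eval s = 0) (h : Q s) :
    Achieves W (whileNonzero e p) (e.cost + 1) s Q := by
  intro m hm
  obtain ⟨m1, k1, v1, f1, a1⟩ := e.exec_code 0 m hm hb
  exact ⟨_, m1, s, .seq _ _ _ _ _ _ _ k1 (.loopDone 1 _ _ (v1.trans h0)), le_rfl,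
    ⟨fun x => by rw [f1 _ (by omega), hm.1], a1.trans hm.2⟩, h⟩

/-- The condition is evaluated before the loop and again at the end of each round, so unrolling a
round requires regrouping the execution of the rest. -/
lemma achieves_whileNonzero_step (hb : e.Bounded W s) (h0 : e.eval s ≠ 0)
    (h : Achieves W p B s fun s' => Achieves W (whileNonzero e p) B' s' Q) :
    Achieves W (whileNonzero e p) (e.cost + 1 + B + B') s Q := by
  intro m hm
  obtain ⟨m1, k1, v1, f1, a1⟩ := e.exec_code 0 m hm hb
  have hm1 : Represents m1 s := ⟨fun x => by rw [f1 _ (by omega), hm.1], a1.trans hm.2⟩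
  obtain ⟨t, m2, s2, g1, g2, g3, g4⟩ := h m1 hm1
  obtain ⟨t', m3, s3, l1, l2, l3, l4⟩ := g4 m2 g3
  -- The remaining execution begins with evaluating the condition; this part `c1` becomes the end of
  -- the first round, and `c2` is the remaining loop.
  cases l1 with
  | seq _ _ _ m4 _ t1 t2 c1 c2 =>
    exact ⟨_, m3, s3, .seq _ _ _ _ _ _ _ k1 (.loopStep 1 _ _ _ _ _ _
      (fun h => h0 (v1.symm.trans h)) (.seq _ _ _ _ _ _ _ g1 c1) c2), by omega, l3, l4⟩

/-- The rule for a loop that runs `n` times. -/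
lemma achieves_whileNonzero (n : ℕ) (I : ℕ → RamState → Prop)
    (hstep : ∀ i < n, ∀ s, I i s → e.Bounded W s ∧ e.eval s ≠ 0 ∧ Achieves W p B s (I (i + 1)))
    (hdone : ∀ s, I n s → e.Bounded W s ∧ e.eval s = 0) (hs : I 0 s) :
    Achieves W (whileNonzero e p) (n * (e.cost + 1 + B) + (e.cost + 1)) s (I n) := by
  have : ∀ k i s, i + k = n → I i s →
      Achieves W (whileNonzero e p) (k * (e.cost + 1 + B) + (e.cost + 1)) s (I n) := by
    intro k
    induction k with
    | zero =>
      rintro i s rfl hi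
      rw [zero_mul, zero_add]
      exact achieves_whileNonzero_done (hdone s hi).1 (hdone s hi).2 hi
    | succ k ih =>
      intro i s hik hi
      obtain ⟨h1, h2, h3⟩ := hstep i (by omega) s hi
      refine (achieves_whileNonzero_step h1 h2 (h3.mono le_rfl fun s' hs' =>
        ih (i + 1) s' (by omega) hs')).mono ?_ fun _ h => h
      rw [Nat.succ_mul]; omega
  exact this n 0 s (zero_add n) hs

end Achieves

/-! ### Simulation of a program in an array that is equipped with an undo log

The simulated memory is array `2`; variable `1` is the length of the log, array `3` holds the
addresses of the overwritten cells and array `4` their former contents. -/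

/-- Undo the log entries `lo, …, lo + w - 1`, the last one first. -/
def undoLog (addr old : ℕ → ℕ) (lo : ℕ) : ℕ → (ℕ → ℕ) → ℕ → ℕ
  | 0, M => M
  | w + 1, M => undoLog addr old lo w (Function.update M (addr (lo + w)) (old (lo + w)))

lemma undoLog_add (addr old : ℕ → ℕ) (lo w w' : ℕ) (M : ℕ → ℕ) :
    undoLog addr old lo (w + w') M = undoLog addr old lo w (undoLog addr old (lo + w) w' M) := by
  induction w' generalizing M with
  | zero => rfl
  | succ w' ih => rw [← add_assoc, undoLog, ih, undoLog, add_assoc]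

lemma undoLog_congr {addr old addr' old' : ℕ → ℕ} {lo w : ℕ}
    (h : ∀ i < lo + w, addr i = addr' i ∧ old i = old' i) (M : ℕ → ℕ) :
    undoLog addr old lo w M = undoLog addr' old' lo w M := by
  induction w generalizing M with
  | zero => rfl
  | succ w ih =>
    rw [undoLog, undoLog, (h (lo + w) (by omega)).1, (h (lo + w) (by omega)).2]
    exact ih (fun i hi => h i (by omega)) _

/-- The log of `s'` has `w` more entries than that of `s`, and undoing them restores the memory. -/
structure LogExtends (W : ℕ) (s s' : RamState) (w : ℕ) : Prop where
  top : s'.reg 1 = s.reg 1 + w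
  keep : ∀ i < s.reg 1, s'.arr 3 i = s.arr 3 i ∧ s'.arr 4 i = s.arr 4 i
  entries : ∀ i, s.reg 1 ≤ i → i < s.reg 1 + w → s'.arr 3 i ≤ W ∧ s'.arr 4 i ≤ W
  undo : undoLog (s'.arr 3) (s'.arr 4) (s.reg 1) w (s'.arr 2) = s.arr 2

/-- The state `s'` arises from `s` by `w` logged writes. -/
structure Logged (W : ℕ) (s s' : RamState) (w : ℕ) : Prop extends LogExtends W s s' w where
  reg : ∀ x, x = 0 ∨ 5 ≤ x → s'.reg x = s.reg x
  arr : ∀ a, a < 2 ∨ 4 < a → s'.arr a = s.arr a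

lemma Logged.refl (W : ℕ) (s : RamState) : Logged W s s 0 :=
  ⟨⟨rfl, fun _ _ => ⟨rfl, rfl⟩, fun _ _ _ => by omega, rfl⟩, fun _ _ => rfl, fun _ _ => rfl⟩

/-- The newer entries are undone first and lead back to the middle state; the older entries are
still intact by `keep`. -/
lemma LogExtends.trans {W w w' : ℕ} {s s' s'' : RamState} (h : LogExtends W s s' w)
    (h' : LogExtends W s' s'' w') : LogExtends W s s'' (w + w') where
  top := by rw [h'.top, h.top, add_assoc]
  keep i hi := by
    have := h'.keep i (by rw [h.top]; omega)
    rw [this.1, this.2]; exact h.keep i hi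
  entries i h1 h2 := by
    have ht := h.top
    by_cases hi : i < s'.reg 1
    · rw [(h'.keep i hi).1, (h'.keep i hi).2]; exact h.entries i h1 (by omega)
    · exact h'.entries i (by omega) (by omega)
  undo := by
    rw [undoLog_add, ← h.top, h'.undo, ← h.undo]
    exact undoLog_congr (fun i hi => h'.keep i (by rw [h.top]; exact hi)) _

lemma Logged.trans {W w w' : ℕ} {s s' s'' : RamState} (h : Logged W s s' w)
    (h' : Logged W s' s'' w') : Logged W s s'' (w + w') where
  toLogExtends := h.toLogExtends.trans h'.toLogExtends
  reg x hx := (h'.reg x hx).trans (h.reg x hx)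
  arr a ha := (h'.arr a ha).trans (h.arr a ha)

/-- The effect of a logged write of `v` into cell `addr`. -/
def loggedState (s : RamState) (addr v : ℕ) : RamState where
  reg := Function.update (Function.update (Function.update s.reg 2 addr) 3 v) 1 (s.reg 1 + 1)
  arr := Function.update (Function.update (Function.update s.arr 3
    (Function.update (s.arr 3) (s.reg 1) addr)) 4
    (Function.update (s.arr 4) (s.reg 1) (s.arr 2 addr))) 2 (Function.update (s.arr 2) addr v)

lemma logged_loggedState {W : ℕ} {s : RamState} {addr v : ℕ} (h1 : addr ≤ W)
    (h2 : s.arr 2 addr ≤ W) : Logged W s (loggedState s addr v) 1 where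
  top := by simp [loggedState]
  keep i hi := by simp [loggedState, hi.ne]
  entries i h3 h4 := by
    obtain rfl : i = s.reg 1 := by omega
    simp [loggedState, h1, h2]
  undo := by simp [loggedState, undoLog]
  reg x hx := by
    have e1 : x ≠ 1 := by omega
    have e2 : x ≠ 2 := by omega
    have e3 : x ≠ 3 := by omega
    simp [loggedState, e1, e2, e3]
  arr a ha := by
    have e1 : a ≠ 2 := by omega
    have e2 : a ≠ 3 := by omega
    have e3 : a ≠ 4 := by omega
    simp [loggedState, e1, e2, e3]

/-- A logged write. -/
def logWrite (e f : RamExpr) : RamProgram :=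
  .seq (assign 2 e) (.seq (assign 3 f) (.seq (write 3 (.var 1) (.var 2))
    (.seq (write 4 (.var 1) (.get 2 (.var 2))) (.seq (write 2 (.var 2) (.var 3))
      (assign 1 (.op .add (.var 1) (.num 1)))))))

lemma achieves_logWrite {W : ℕ} {s : RamState} {e f : RamExpr} {addr v : ℕ} {Q : RamState → Prop}
    (he : e.Bounded W s) (hev : e.eval s = addr) (hf : f.Bounded W (s.setReg 2 addr))
    (hfv : f.eval (s.setReg 2 addr) = v) (htop : s.reg 1 + 1 ≤ W) (hold : s.arr 2 addr ≤ W)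
    (hQ : Q (loggedState s addr v)) :
    Achieves W (logWrite e f) (e.cost + f.cost + 16) s Q := by
  subst hev hfv
  have b1 := e.eval_le he
  have b2 := f.eval_le hf
  refine (achieves_seq (achieves_assign he (achieves_seq (achieves_assign hf (achieves_seq
    (achieves_write ?_ ?_ (achieves_seq (achieves_write ?_ ?_ (achieves_seq (achieves_write ?_ ?_
      (achieves_assign ?_ ?_))))))))))).mono ?_ fun _ h => h
  · simp [RamExpr.Bounded, RamState.setReg]; omega
  · simpa [RamExpr.Bounded, RamState.setReg] using b1
  · simp [RamExpr.Bounded, RamState.setReg, RamState.setArr]; omega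
  · simpa [RamExpr.Bounded, RamExpr.eval, RamState.setReg, RamState.setArr] using ⟨b1, hold⟩
  · simpa [RamExpr.Bounded, RamState.setReg, RamState.setArr] using b1
  · simpa [RamExpr.Bounded, RamState.setReg, RamState.setArr] using b2
  · simp [RamExpr.Bounded, RamExpr.eval, RamState.setReg, RamState.setArr, WordOp.eval]
    omega
  · convert hQ using 1
    simp [RamExpr.eval, RamState.setReg, RamState.setArr, WordOp.eval, loggedState]
  · simp only [RamExpr.cost]; omega

/-- The simulation of a program: register `x` is kept in cell `x * A` and cell `i` of array `a` in
cell `i * A + (a + 1)`. -/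
def compile (A : ℕ) : RamProgram → RamProgram
  | .skip => .skip
  | .const x n => logWrite (.num (x * A)) (.num n)
  | .op o x y z => logWrite (.num (x * A))
      (.op o (.get 2 (.num (y * A))) (.get 2 (.num (z * A))))
  | .load x a y => logWrite (.num (x * A)) (.get 2
      (.op .add (.op .mul (.get 2 (.num (y * A))) (.num A)) (.num (a + 1))))
  | .store a y z => logWrite
      (.op .add (.op .mul (.get 2 (.num (y * A))) (.num A)) (.num (a + 1)))
      (.get 2 (.num (z * A)))
  | .seq p q => .seq (compile A p) (compile A q)
  | .ite x p q => ifNonzero (.get 2 (.num (x * A))) (compile A p) (compile A q)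
  | .loop x p => whileNonzero (.get 2 (.num (x * A))) (compile A p)

/-- A bound on the registers and arrays that a program mentions. -/
def RamProgram.names : RamProgram → ℕ
  | .skip => 0
  | .const x _ => x
  | .op _ x y z => x + y + z
  | .load x a y => x + a + y
  | .store a y z => a + y + z
  | .seq p q => p.names + q.names
  | .ite x p q => x + p.names + q.names
  | .loop x p => x + p.names

/-- Array `2` of `s` holds the memory contents `u`; all cells are at most `W` and all registers of
`u` are at most `V`. -/
structure Simulates (A V W : ℕ) (s u : RamState) : Prop where
  reg : ∀ x, s.arr 2 (x * A) = u.reg x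
  arr : ∀ a i, a + 1 < A → s.arr 2 (i * A + (a + 1)) = u.arr a i
  reg_le : ∀ x, u.reg x ≤ V
  cell_le : ∀ i, s.arr 2 i ≤ W

/-- The remainder modulo `A` tells registers (remainder 0) and the different arrays apart, so
simulated cells do not collide. -/
lemma cell_inj {A i i' r r' : ℕ} (hr : r < A) (hr' : r' < A) :
    i * A + r = i' * A + r' ↔ i = i' ∧ r = r' := by
  constructor
  · intro h
    have h1 := congrArg (· / A) h
    have h2 := congrArg (· % A) h
    simp only [mul_comm _ A, Nat.mul_add_div (by omega : A > 0), Nat.div_eq_of_lt hr,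
      Nat.div_eq_of_lt hr', Nat.mul_add_mod, Nat.mod_eq_of_lt hr, Nat.mod_eq_of_lt hr',
      add_zero] at h1 h2
    exact ⟨h1, h2⟩
  · rintro ⟨rfl, rfl⟩; rfl

section Simulates

variable {A V W : ℕ} {s u : RamState}

lemma Simulates.setReg (h : Simulates A V W s u) (hA : 2 ≤ A) {x v : ℕ} (hV : v ≤ V)
    (hW : v ≤ W) : Simulates A V W (loggedState s (x * A) v) (u.setReg x v) where
  reg y := by
    have : y * A = x * A ↔ y = x := Nat.mul_left_inj (by omega)
    simp only [loggedState, RamState.setReg, Function.update_self, Function.update_apply, this,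
      h.reg]
  arr a i ha := by
    have : i * A + (a + 1) ≠ x * A := by
      have := cell_inj (i := i) (i' := x) (r := a + 1) (r' := 0) ha (by omega)
      simp at this; exact this
    simp only [loggedState, RamState.setReg, Function.update_self, Function.update_apply, this,
      if_false, h.arr a i ha]
  reg_le y := by
    simp only [RamState.setReg, Function.update_apply]; split
    · exact hV
    · exact h.reg_le y
  cell_le i := by
    simp only [loggedState, Function.update_self, Function.update_apply]; split
    · exact hW
    · exact h.cell_le i

lemma Simulates.setArr (h : Simulates A V W s u) {a i v : ℕ} (ha : a + 1 < A) (hW : v ≤ W) :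
    Simulates A V W (loggedState s (i * A + (a + 1)) v) (u.setArr a i v) where
  reg y := by
    have : y * A ≠ i * A + (a + 1) := by
      have := cell_inj (i := y) (i' := i) (r := 0) (r' := a + 1) (by omega) ha
      simp at this; exact this
    simp only [loggedState, RamState.setArr, Function.update_self, Function.update_apply, this,
      if_false, h.reg]
  arr b j hb := by
    have : j * A + (b + 1) = i * A + (a + 1) ↔ j = i ∧ b = a := by
      simpa using cell_inj (i := j) (i' := i) hb ha
    simp only [loggedState, RamState.setArr, Function.update_self, Function.update_apply, this,
      h.arr b j hb]
    by_cases h1 : b = a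
    · subst h1; simp [Function.update_apply]
    · simp [h1]
  reg_le y := h.reg_le y
  cell_le j := by
    simp only [loggedState, Function.update_self, Function.update_apply]; split
    · exact hW
    · exact h.cell_le j

lemma Simulates.mono {V' : ℕ} (h : Simulates A V W s u) (hV : V ≤ V') : Simulates A V' W s u :=
  ⟨h.reg, h.arr, fun x => (h.reg_le x).trans hV, h.cell_le⟩

end Simulates

/-- By induction on the execution: each basic instruction other than `skip` becomes one logged
write, and control flow is copied. The factor 24 is the cost of `load` and `store`, namely 8 for the
two expressions and 16 for the logged write. The bound `A * A` covers the cells of the registers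
that are mentioned, `(V + 1) * A` the array cells, whose indices are register contents and hence at
most `V`. -/
theorem achieves_compile {A V W : ℕ} (hA : A * A ≤ W) (hV : (V + 1) * A ≤ W) {p : RamProgram}
    {u u' : RamState} {t : ℕ} (hex : RamExec V p u t u') : p.names + 2 ≤ A → ∀ s,
    Simulates A V W s u → s.reg 1 + t ≤ W → Achieves W (compile A p) (24 * t) s fun s' =>
      Simulates A V W s' u' ∧ ∃ w ≤ t, Logged W s s' w := by
  have hAW : 0 < A → A ≤ W := fun h => (Nat.le_mul_of_pos_left A h).trans hA
  have hVW : 0 < A → V ≤ W := fun h =>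
    (Nat.le_succ V).trans ((Nat.le_mul_of_pos_right _ h).trans hV)
  have hx : ∀ x, x ≤ A → x * A ≤ W := fun x hx => (Nat.mul_le_mul_right A hx).trans hA
  have haddr : ∀ i a, i ≤ V → a + 1 < A → i * A ≤ W ∧ i * A + (a + 1) ≤ W := by
    intro i a hi ha
    have := Nat.mul_le_mul_right A hi
    have h2 : (V + 1) * A = V * A + A := by ring
    omega
  induction hex with
  | skip u =>
    intro _ s hs _
    exact (achieves_skip ⟨hs, 0, Nat.zero_le _, Logged.refl W s⟩).mono (by omega) fun _ h => h
  | const u x n hn =>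
    intro hp s hs ht
    simp only [RamProgram.names] at hp
    refine (achieves_logWrite (e := .num (x * A)) (f := .num n) (addr := x * A) (v := n) (hx x (by omega)) rfl
      (hn.trans (hVW (by omega))) rfl ht (hs.cell_le _)
      ⟨hs.setReg (by omega) hn (hn.trans (hVW (by omega))), 1, le_rfl,
        logged_loggedState (hx x (by omega)) (hs.cell_le _)⟩).mono (by simp [RamExpr.cost])
      fun _ h => h
  | op u o x y z hn =>
    intro hp s hs ht
    simp only [RamProgram.names] at hp
    refine (achieves_logWrite (e := .num (x * A)) (addr := x * A) (v := o.eval (u.reg y) (u.reg z)) (hx x (by omega))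
      rfl ?_ ?_ ht (hs.cell_le _)
      ⟨hs.setReg (by omega) hn (hn.trans (hVW (by omega))), 1, le_rfl,
        logged_loggedState (hx x (by omega)) (hs.cell_le _)⟩).mono (by simp [RamExpr.cost])
      fun _ h => h
    · simp only [RamExpr.Bounded, RamExpr.eval, RamState.setReg, hs.reg]
      have := hVW (by omega)
      exact ⟨⟨hx y (by omega), (hs.reg_le y).trans this⟩, ⟨hx z (by omega),
        (hs.reg_le z).trans this⟩, hn.trans this⟩
    · simp [RamExpr.eval, RamState.setReg, hs.reg]
  | load u x a y hn =>
    intro hp s hs ht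
    simp only [RamProgram.names] at hp
    have ha : a + 1 < A := by omega
    have hb := haddr (u.reg y) a (hs.reg_le y) ha
    refine (achieves_logWrite (e := .num (x * A)) (addr := x * A) (v := u.arr a (u.reg y)) (hx x (by omega))
      rfl ?_ ?_ ht (hs.cell_le _)
      ⟨hs.setReg (by omega) hn (hn.trans (hVW (by omega))), 1, le_rfl,
        logged_loggedState (hx x (by omega)) (hs.cell_le _)⟩).mono (by simp [RamExpr.cost])
      fun _ h => h
    · simp only [RamExpr.Bounded, RamExpr.eval, RamState.setReg, hs.reg, WordOp.eval,
        hs.arr _ _ ha]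
      have := hVW (by omega)
      have := hAW (by omega)
      have := hx y (by omega)
      have := hs.reg_le y
      omega
    · simp [RamExpr.eval, RamState.setReg, hs.reg, WordOp.eval, hs.arr _ _ ha]
  | store u a y z hn =>
    intro hp s hs ht
    simp only [RamProgram.names] at hp
    have ha : a + 1 < A := by omega
    have hb := haddr (u.reg y) a (hs.reg_le y) ha
    have h1 := hVW (by omega)
    have h2 := hAW (by omega)
    have h3 := hx y (by omega)
    have h4 := hs.reg_le y
    refine (achieves_logWrite (addr := u.reg y * A + (a + 1)) (v := u.reg z) ?_ ?_ ?_ ?_ ht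
      (hs.cell_le _) ⟨hs.setArr ha (hn.trans h1), 1, le_rfl,
        logged_loggedState hb.2 (hs.cell_le _)⟩).mono (by simp [RamExpr.cost]) fun _ h => h
    · simp only [RamExpr.Bounded, RamExpr.eval, hs.reg, WordOp.eval]
      omega
    · simp [RamExpr.eval, hs.reg, WordOp.eval]
    · simp only [RamExpr.Bounded, RamExpr.eval, RamState.setReg, hs.reg]
      exact ⟨hx z (by omega), hn.trans h1⟩
    · simp [RamExpr.eval, RamState.setReg, hs.reg]
  | seq p q u u' u'' t t' _ _ ihp ihq =>
    intro hp s hs ht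
    simp only [RamProgram.names] at hp
    refine (achieves_seq ((ihp (by omega) s hs (by omega)).mono le_rfl ?_)).mono
      (by rw [mul_add]) fun _ h => h
    rintro s' ⟨hs', w, hw, hl⟩
    refine (ihq (by omega) s' hs' (by rw [hl.top]; omega)).mono le_rfl ?_
    rintro s'' ⟨hs'', w', hw', hl'⟩
    exact ⟨hs'', w + w', by omega, hl.trans hl'⟩
  | iteTrue x p q u u' t h0 _ ih =>
    intro hp s hs ht
    simp only [RamProgram.names] at hp
    have hv : RamExpr.eval s (.get 2 (.num (x * A))) = u.reg x := by simp [RamExpr.eval, hs.reg]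
    have hb : RamExpr.Bounded W s (.get 2 (.num (x * A))) := ⟨hx x (by omega), hs.cell_le _⟩
    refine (achieves_ifNonzero hb (fun _ =>
      (ih (by omega) s hs (by omega)).mono le_rfl ?_) fun h => absurd (hv.symm.trans h) h0).mono
      (by simp [RamExpr.cost]; omega) fun _ h => h
    rintro s' ⟨hs', w, hw, hl⟩
    exact ⟨hs', w, by omega, hl⟩
  | iteFalse x p q u u' t h0 _ ih =>
    intro hp s hs ht
    simp only [RamProgram.names] at hp
    have hv : RamExpr.eval s (.get 2 (.num (x * A))) = u.reg x := by simp [RamExpr.eval, hs.reg]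
    have hb : RamExpr.Bounded W s (.get 2 (.num (x * A))) := ⟨hx x (by omega), hs.cell_le _⟩
    refine (achieves_ifNonzero hb (fun h => absurd (hv.trans h0) h)
      fun _ => (ih (by omega) s hs (by omega)).mono le_rfl ?_).mono
      (by simp [RamExpr.cost]; omega) fun _ h => h
    rintro s' ⟨hs', w, hw, hl⟩
    exact ⟨hs', w, by omega, hl⟩
  | loopDone x p u h0 =>
    intro hp s hs _
    simp only [RamProgram.names] at hp
    have hv : RamExpr.eval s (.get 2 (.num (x * A))) = u.reg x := by simp [RamExpr.eval, hs.reg]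
    have hb : RamExpr.Bounded W s (.get 2 (.num (x * A))) := ⟨hx x (by omega), hs.cell_le _⟩
    exact (achieves_whileNonzero_done hb (hv.trans h0)
      ⟨hs, 0, Nat.zero_le _, Logged.refl W s⟩).mono (by simp [RamExpr.cost]) fun _ h => h
  | loopStep x p u u' u'' t t' h0 _ _ ihp ihl =>
    intro hp s hs ht
    have hp' := hp
    simp only [RamProgram.names] at hp
    have hv : RamExpr.eval s (.get 2 (.num (x * A))) = u.reg x := by simp [RamExpr.eval, hs.reg]
    have hb : RamExpr.Bounded W s (.get 2 (.num (x * A))) := ⟨hx x (by omega), hs.cell_le _⟩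
    refine (achieves_whileNonzero_step hb (by rwa [hv])
      ((ihp (by omega) s hs (by omega)).mono le_rfl ?_)).mono
      (B := 3 + 24 * t + 24 * t') (by omega) fun _ h => h
    rintro s' ⟨hs', w, hw, hl⟩
    refine (ihl hp' s' hs' (by rw [hl.top]; omega)).mono le_rfl ?_
    rintro s'' ⟨hs'', w', hw', hl'⟩
    exact ⟨hs'', w + w', by omega, hl.trans hl'⟩

/-! ### Rolling the simulated memory back -/

/-- Undo all log entries from the one whose number is in variable `9`. -/
def undoAll : RamProgram :=
  whileNonzero (.op .lt (.var 9) (.var 1))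
    (.seq (assign 1 (.op .sub (.var 1) (.num 1)))
      (write 2 (.get 3 (.var 1)) (.get 4 (.var 1))))

/-- After `i` rounds the log holds `w - i` of the new entries, and undoing those would restore the
memory. One round costs 13: 4 for the test, 9 for shortening the log and restoring a cell. -/
lemma achieves_undoAll {W w : ℕ} {s s' : RamState} (h : LogExtends W s s' w)
    (hW : s.reg 1 + w ≤ W) (hW1 : 1 ≤ W) (h9 : s'.reg 9 = s.reg 1) :
    Achieves W undoAll (w * 13 + 4) s' fun s'' => LogExtends W s s'' 0 ∧
      (∀ x, x = 0 ∨ 5 ≤ x → s''.reg x = s'.reg x) ∧ ∀ a, a ≠ 2 → s''.arr a = s'.arr a := by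
  refine (achieves_whileNonzero (B := 9) w (fun i s'' => s''.reg 1 = s.reg 1 + (w - i) ∧
    undoLog (s'.arr 3) (s'.arr 4) (s.reg 1) (w - i) (s''.arr 2) = s.arr 2 ∧
    (∀ x, x = 0 ∨ 5 ≤ x → s''.reg x = s'.reg x) ∧ ∀ a, a ≠ 2 → s''.arr a = s'.arr a)
    ?_ ?_ ?_).mono ?_ ?_
  · rintro i hi r ⟨h1, h2, h3, h4⟩
    obtain ⟨k, hk⟩ : ∃ k, w - i = k + 1 := ⟨w - i - 1, by omega⟩
    have r9 : r.reg 9 = s.reg 1 := (h3 9 (by norm_num)).trans h9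
    have a3 := h4 3 (by norm_num)
    have a4 := h4 4 (by norm_num)
    have hent := h.entries (s.reg 1 + k) (by omega) (by omega)
    have hlt : s.reg 1 < s.reg 1 + (k + 1) := by omega
    rw [hk] at h1 h2
    have hsub : r.reg 1 - 1 = s.reg 1 + k := by omega
    refine ⟨?_, ?_, (achieves_seq (achieves_assign ?_ (achieves_write ?_ ?_ ?_))).mono ?_
      fun _ h => h⟩
    · simp [RamExpr.Bounded, RamExpr.eval, WordOp.eval, r9, h1, hW1]; omega
    · simp [RamExpr.eval, WordOp.eval, r9, h1]
    · simp [RamExpr.Bounded, RamExpr.eval, WordOp.eval, h1]; omega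
    · simp only [RamExpr.Bounded, RamExpr.eval, WordOp.eval, RamState.setReg, hsub,
        Function.update_self, a3]
      exact ⟨by omega, hent.1⟩
    · simp only [RamExpr.Bounded, RamExpr.eval, WordOp.eval, RamState.setReg, hsub,
        Function.update_self, a4]
      exact ⟨by omega, hent.2⟩
    · have hk' : w - (i + 1) = k := by omega
      simp only [RamExpr.eval, WordOp.eval, RamState.setReg, RamState.setArr, hsub,
        Function.update_self, a3, a4, hk']
      refine ⟨trivial, h2, fun x hx => ?_, fun a ha => ?_⟩
      · rw [Function.update_of_ne (by omega)]; exact h3 x hx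
      · rw [Function.update_of_ne ha]; exact h4 a ha
    · simp [RamExpr.cost]
  · rintro r ⟨h1, -, h3, -⟩
    have r9 : r.reg 9 = s.reg 1 := (h3 9 (by norm_num)).trans h9
    rw [Nat.sub_self, add_zero] at h1
    simp [RamExpr.Bounded, RamExpr.eval, WordOp.eval, r9, h1]; omega
  · exact ⟨h.top, h.undo, fun _ _ => rfl, fun _ _ => rfl⟩
  · simp [RamExpr.cost]
  · rintro r ⟨h1, h2, h3, h4⟩
    rw [Nat.sub_self] at h1 h2
    refine ⟨⟨h1, fun i hi => ?_, fun i _ _ => by omega, h2⟩, h3, h4⟩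
    rw [h4 3 (by norm_num), h4 4 (by norm_num)]
    exact h.keep i hi

/-! ### Passing an input list to the simulated program -/

/-- Variable `14` and array `5` hold the list `l`. -/
def HoldsList (s : RamState) (l : List ℕ) : Prop :=
  s.reg 14 = l.length ∧ ∀ i (hi : i < l.length), s.arr 5 i = l[i]

/-- Write `l` over the first cells of array `a`. -/
def RamState.overwrite (u : RamState) (a : ℕ) (l : List ℕ) : RamState :=
  { u with arr := Function.update u.arr a fun i => l.getD i (u.arr a i) }

/-- Copy the list in array `5` into the simulated array `a`. -/
def copyList (A a : ℕ) : RamProgram :=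
  .seq (assign 4 (.num 0)) (whileNonzero (.op .lt (.var 4) (.var 14))
    (.seq (logWrite (.op .add (.op .mul (.var 4) (.num A)) (.num (a + 1))) (.get 5 (.var 4)))
      (assign 4 (.op .add (.var 4) (.num 1)))))

lemma RamState.overwrite_take_succ (u : RamState) (a : ℕ) (l : List ℕ) {i : ℕ}
    (hi : i < l.length) :
    u.overwrite a (l.take (i + 1)) = (u.overwrite a (l.take i)).setArr a i l[i] := by
  simp only [overwrite, setArr, Function.update_self, Function.update_idem]
  congr 2
  funext j
  simp only [Function.update_apply, List.getD_eq_getElem?_getD, List.getElem?_take]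
  rcases lt_trichotomy j i with h | rfl | h
  · simp [h.ne, h, h.trans (Nat.lt_succ_self i)]
  · simp [hi]
  · have h1 : ¬ j < i + 1 := by omega
    have h2 : ¬ j < i := by omega
    simp [h.ne', h1, h2]

/-- The list is copied by logged writes, so that a later rollback removes the input as well. Cells
behind the list keep their contents, as `RamState.withQuery` demands. -/
lemma achieves_copyList {A V W a : ℕ} {s u : RamState} {l : List ℕ} (ha : a + 1 < A)
    (hs : Simulates A V W s u) (hl : HoldsList s l) (hlW : ∀ v ∈ l, v ≤ W)
    (hW : (l.length + 1) * A ≤ W) (htop : s.reg 1 + l.length ≤ W) :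
    Achieves W (copyList A a) (l.length * 31 + 6) s fun s' =>
      Simulates A V W s' (u.overwrite a l) ∧ Logged W s s' l.length := by
  have hAW : A ≤ W := (Nat.le_mul_of_pos_left A (Nat.succ_pos _)).trans hW
  have hlenW : l.length + 1 ≤ W := (Nat.le_mul_of_pos_right _ (by omega)).trans hW
  refine (achieves_seq (achieves_assign (Nat.zero_le _) ((achieves_whileNonzero (B := 27) l.length
    (fun i s' => s'.reg 4 = i ∧ Simulates A V W s' (u.overwrite a (l.take i)) ∧
      Logged W s s' i) ?_ ?_ ?_).mono le_rfl ?_))).mono ?_ fun _ h => h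
  · rintro i hi r ⟨h4, hr, hlog⟩
    have h14 : r.reg 14 = l.length := (hlog.reg 14 (by norm_num)).trans hl.1
    have h5 : r.arr 5 i = l[i] := by rw [hlog.arr 5 (by norm_num)]; exact hl.2 i hi
    have hli : l[i] ≤ W := hlW _ (List.getElem_mem hi)
    have hiA : (i + 1) * A ≤ W := (Nat.mul_le_mul_right A (by omega)).trans hW
    have hiA' : (i + 1) * A = i * A + A := by ring
    refine ⟨?_, ?_, (achieves_seq (achieves_logWrite (addr := i * A + (a + 1)) (v := l[i]) ?_ ?_ ?_
      ?_ ?_ (hr.cell_le _) (achieves_assign ?_ ?_))).mono ?_ fun _ h => h⟩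
    · simp [RamExpr.Bounded, RamExpr.eval, WordOp.eval, h4, h14, hi]; omega
    · simp [RamExpr.eval, WordOp.eval, h4, h14, hi]
    · simp only [RamExpr.Bounded, RamExpr.eval, WordOp.eval, h4]; omega
    · simp [RamExpr.eval, WordOp.eval, h4]
    · simp [RamExpr.Bounded, RamExpr.eval, RamState.setReg, h4, h5]; omega
    · simp [RamExpr.eval, RamState.setReg, h4, h5]
    · rw [hlog.top]; omega
    · simp [RamExpr.Bounded, RamExpr.eval, WordOp.eval, loggedState, h4]; omega
    · have e1 : RamExpr.eval (loggedState r (i * A + (a + 1)) l[i])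
          (.op .add (.var 4) (.num 1)) = i + 1 := by
        simp [RamExpr.eval, WordOp.eval, loggedState, h4]
      rw [e1]
      have hsim := hr.setArr (i := i) (v := l[i]) ha hli
      rw [← RamState.overwrite_take_succ] at hsim
      have hlog' := hlog.trans (logged_loggedState (v := l[i]) (show i * A + (a + 1) ≤ W by omega)
        (hr.cell_le _))
      refine ⟨by simp [RamState.setReg], ⟨hsim.reg, hsim.arr, hsim.reg_le, hsim.cell_le⟩, ?_⟩
      refine ⟨⟨?_, hlog'.keep, hlog'.entries, hlog'.undo⟩, fun x hx => ?_, hlog'.arr⟩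
      · rw [← hlog'.top]; simp [RamState.setReg]
      · rw [← hlog'.reg x hx]
        exact Function.update_of_ne (by omega) _ _
    · simp [RamExpr.cost]
  · rintro r ⟨h4, -, hlog⟩
    have h14 : r.reg 14 = l.length := (hlog.reg 14 (by norm_num)).trans hl.1
    simp [RamExpr.Bounded, RamExpr.eval, WordOp.eval, h4, h14]; omega
  · refine ⟨by simp [RamState.setReg, RamExpr.eval], ?_, ?_⟩
    · have e : u.overwrite a (l.take 0) = u := by
        simp [RamState.overwrite]
      rw [e]
      exact ⟨hs.reg, hs.arr, hs.reg_le, hs.cell_le⟩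
    · refine ⟨⟨by simp [RamState.setReg], fun _ _ => ⟨rfl, rfl⟩, fun _ _ _ => by omega, rfl⟩,
        fun x hx => ?_, fun _ _ => rfl⟩
      exact Function.update_of_ne (by omega) _ _
  · rintro r ⟨-, h1, h2⟩
    rw [List.take_length] at h1
    exact ⟨h1, h2⟩
  · simp [RamExpr.cost]; omega

/-! ### Programs that write the graphs and the queries into array `5`

Variables `5`, `6`, `7` hold the number of vectors, their length and the size of a group, variables
`8`, `12` and `16` the number of letters per vector, the number of blocks of a graph and the number
of letters of a query, variables `10` and `11` the numbers of the groups. -/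

/-- Append the value of `e` to the list in array `5`. -/
def emit (e : RamExpr) : RamProgram :=
  .seq (write 5 (.var 14) e) (assign 14 (.op .add (.var 14) (.num 1)))

/-- Append the values of the expressions to the list in array `5`. -/
def emitAll : List RamExpr → RamProgram
  | [] => .skip
  | e :: es => .seq (emit e) (emitAll es)

/-- The states agree except for the list in array `5`. -/
def EmitFrame (s s' : RamState) : Prop :=
  (∀ x, x ≠ 14 → s'.reg x = s.reg x) ∧ ∀ a, a ≠ 5 → s'.arr a = s.arr a

/-- The states agree except for the list in array `5` and the variable `13`. -/
def LoopFrame (s s' : RamState) : Prop :=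
  (∀ x, x ≠ 13 → x ≠ 14 → s'.reg x = s.reg x) ∧ ∀ a, a ≠ 5 → s'.arr a = s.arr a

lemma EmitFrame.trans {s s' s'' : RamState} (h : EmitFrame s s') (h' : EmitFrame s' s'') :
    EmitFrame s s'' :=
  ⟨fun x hx => (h'.1 x hx).trans (h.1 x hx), fun a ha => (h'.2 a ha).trans (h.2 a ha)⟩

lemma LoopFrame.trans {s s' s'' : RamState} (h : LoopFrame s s') (h' : LoopFrame s' s'') :
    LoopFrame s s'' :=
  ⟨fun x hx hx' => (h'.1 x hx hx').trans (h.1 x hx hx'), fun a ha => (h'.2 a ha).trans (h.2 a ha)⟩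

lemma EmitFrame.loopFrame {s s' : RamState} (h : EmitFrame s s') : LoopFrame s s' :=
  ⟨fun x _ hx => h.1 x hx, h.2⟩

section Emit

variable {W : ℕ} {s : RamState} {l : List ℕ}

/-- Earlier outputs change variable 14 and array 5, so the values of the expressions are required in
all states that differ from `s` only there. -/
lemma achieves_emitAll {c : ℕ} {es : List RamExpr} {vs : List ℕ} (hl : HoldsList s l)
    (hW : (l ++ vs).length ≤ W) (hc : ∀ e ∈ es, e.cost ≤ c)
    (h : List.Forall₂ (fun e v => ∀ s', EmitFrame s s' → e.Bounded W s' ∧ e.eval s' = v) es vs) :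
    Achieves W (emitAll es) (es.length * (c + 6) + 1) s fun s' =>
      HoldsList s' (l ++ vs) ∧ EmitFrame s s' := by
  induction es generalizing s l vs with
  | nil =>
    cases h
    refine (achieves_skip ?_).mono (by simp) fun _ h => h
    rw [List.append_nil]
    exact ⟨hl, fun _ _ => rfl, fun _ _ => rfl⟩
  | cons e es ih =>
    obtain _ | ⟨h1, h2⟩ := h
    rename_i v vs
    obtain ⟨hb, hv⟩ := h1 s ⟨fun _ _ => rfl, fun _ _ => rfl⟩
    have hec := hc e (by simp)
    simp only [List.length_append, List.length_cons] at hW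
    refine (achieves_seq (achieves_seq (achieves_write ?_ hb (achieves_assign ?_ ?_)))).mono
      (B := 1 + e.cost + 1 + (3 + 1) + (es.length * (c + 6) + 1)) ?_ fun _ h => h
    · simp only [RamExpr.Bounded, hl.1]; omega
    · simp only [RamExpr.Bounded, RamExpr.eval, WordOp.eval, RamState.setArr, hl.1]; omega
    · set s1 := (s.setArr 5 (RamExpr.eval s (.var 14)) (e.eval s)).setReg 14 (RamExpr.eval
        (s.setArr 5 (RamExpr.eval s (.var 14)) (e.eval s)) (.op .add (.var 14) (.num 1)))
      have hf : EmitFrame s s1 := by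
        constructor
        · intro x hx; simp [s1, RamState.setReg, RamState.setArr, hx]
        · intro a ha; simp [s1, RamState.setReg, RamState.setArr, ha]
      have hl1 : HoldsList s1 (l ++ [v]) := by
        constructor
        · simp [s1, RamState.setReg, RamState.setArr, RamExpr.eval, WordOp.eval, hl.1]
        · intro i hi
          simp only [List.length_append, List.length_cons, List.length_nil] at hi
          simp only [s1, RamState.setReg, RamState.setArr, RamExpr.eval, hl.1,
            Function.update_self, Function.update_apply, hv]
          split_ifs with h
          · simp [h]
          · rw [List.getElem_append_left (by omega)]
            exact hl.2 i (by omega)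
      have key := ih hl1 (by simp; omega) (fun e he => hc e (by simp [he])) (h2.imp fun e v h s' hs' =>
        h s' (hf.trans hs'))
      refine key.mono le_rfl ?_
      rintro s' ⟨k1, k2⟩
      rw [List.append_assoc] at k1
      exact ⟨k1, hf.trans k2⟩
    · rw [List.length_cons, Nat.succ_mul]; omega

/-- Append a constant list to the list in array `5`. -/
lemma achieves_emitAll_num {vs : List ℕ} (hl : HoldsList s l) (hW : (l ++ vs).length ≤ W)
    (hv : ∀ v ∈ vs, v ≤ W) : Achieves W (emitAll (vs.map .num)) (vs.length * 7 + 1) s fun s' =>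
      HoldsList s' (l ++ vs) ∧ EmitFrame s s' := by
  refine (achieves_emitAll (c := 1) hl hW ?_ ?_).mono (by simp) fun _ h => h
  · simp [RamExpr.cost]
  · rw [List.forall₂_map_left_iff, List.forall₂_same]
    exact fun v hv' s' _ => ⟨hv v hv', rfl⟩

/-- Run `p` for all values of variable `13` that are smaller than `e`. -/
def emitLoop (e : RamExpr) (p : RamProgram) : RamProgram :=
  .seq (assign 13 (.num 0)) (whileNonzero (.op .lt (.var 13) e)
    (.seq p (assign 13 (.op .add (.var 13) (.num 1)))))

/-- The loop body leaves the counter in variable 13 alone by `EmitFrame`. The list written so far is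
a prefix of the final one, hence the bound on the final length suffices for every round. -/
lemma achieves_emitLoop {B n : ℕ} {e : RamExpr} {p : RamProgram} {f : ℕ → List ℕ}
    (hl : HoldsList s l) (hW : (l ++ (List.range n).flatMap f).length ≤ W) (hn : n + 1 ≤ W)
    (he : ∀ s', LoopFrame s s' → e.Bounded W s' ∧ e.eval s' = n)
    (hp : ∀ i < n, ∀ s' l', LoopFrame s s' → s'.reg 13 = i → HoldsList s' l' →
      (l' ++ f i).length ≤ W → Achieves W p B s' fun s'' =>
        HoldsList s'' (l' ++ f i) ∧ EmitFrame s' s'') :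
    Achieves W (emitLoop e p) (n * (e.cost + B + 7) + e.cost + 5) s fun s' =>
      HoldsList s' (l ++ (List.range n).flatMap f) ∧ LoopFrame s s' := by
  refine (achieves_seq (achieves_assign (Nat.zero_le _) ((achieves_whileNonzero (B := B + 4) n
    (fun i s' => s'.reg 13 = i ∧ HoldsList s' (l ++ (List.range i).flatMap f) ∧ LoopFrame s s')
    ?_ ?_ ?_).mono le_rfl ?_))).mono ?_ fun _ h => h
  · rintro i hi r ⟨h1, h2, h3⟩
    obtain ⟨hb, hv⟩ := he r h3
    refine ⟨?_, ?_, (achieves_seq ((hp i hi r _ h3 h1 h2 ?_).mono le_rfl ?_)).mono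
      (B := B + 4) le_rfl fun _ h => h⟩
    · refine ⟨?_, hb, ?_⟩
      · simp only [RamExpr.Bounded, h1]; omega
      · simp only [WordOp.eval]; split <;> omega
    · simp [RamExpr.eval, WordOp.eval, h1, hv, hi]
    · refine le_trans ?_ hW
      rw [List.append_assoc, show (List.range i).flatMap f ++ f i = (List.range (i + 1)).flatMap f by
        simp [List.range_succ]]
      obtain ⟨k, rfl⟩ := Nat.exists_eq_add_of_le (Nat.succ_le_iff.mpr hi)
      rw [show i.succ + k = (i + 1) + k from rfl, List.range_add (n := i + 1) (m := k),
        List.flatMap_append, ← List.append_assoc]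
      exact (List.prefix_append _ _).length_le
    · rintro r' ⟨k1, k2⟩
      have r13 : r'.reg 13 = i := (k2.1 13 (by norm_num)).trans h1
      refine achieves_assign ?_ ⟨?_, ?_, ?_⟩
      · simp only [RamExpr.Bounded, RamExpr.eval, WordOp.eval, r13]; omega
      · simp [RamState.setReg, RamExpr.eval, WordOp.eval, r13]
      · rw [List.range_succ, List.flatMap_append, List.flatMap_singleton, ← List.append_assoc]
        refine ⟨?_, k1.2⟩
        rw [← k1.1]
        simp [RamState.setReg]
      · refine h3.trans (k2.loopFrame.trans ⟨fun x hx _ => ?_, fun _ _ => rfl⟩)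
        simp [RamState.setReg, hx]
  · rintro r ⟨h1, -, h3⟩
    obtain ⟨hb, hv⟩ := he r h3
    refine ⟨⟨?_, hb, ?_⟩, ?_⟩
    · simp only [RamExpr.Bounded, h1]; omega
    · simp only [WordOp.eval]; split <;> omega
    · simp [RamExpr.eval, WordOp.eval, h1, hv]
  · refine ⟨by simp [RamState.setReg, RamExpr.eval], ?_, fun x hx _ => by simp [RamState.setReg, hx],
      fun _ _ => rfl⟩
    simp only [List.range_zero, List.flatMap_nil, List.append_nil]
    refine ⟨?_, hl.2⟩
    rw [← hl.1]; simp [RamState.setReg]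
  · rintro r ⟨-, h⟩; exact h
  · simp only [RamExpr.cost]
    rw [show 1 + e.cost + 1 + 1 + (B + 4) = e.cost + B + 7 by ring]
    omega

end Emit

/-- Write the encoding of the graph of group number `r[10]`. -/
def buildGraph : RamProgram :=
  .seq (assign 14 (.num 0)) <|
  .seq (emitAll [.op .mul (.num 6) (.var 12),
    .op .mul (.num 12) (.op .sub (.var 12) (.num 1))]) <|
  .seq (emitLoop (.op .mul (.num 12) (.op .sub (.var 12) (.num 1)))
    (emitAll [.op .div (.var 13) (.num 2),
      .op .add (.op .add
        (.op .mul (.num 6) (.op .add (.op .div (.var 13) (.num 12)) (.num 1)))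
        (.op .mul (.num 2) (.op .mod (.op .div (.op .add
          (.op .mod (.op .div (.var 13) (.num 2)) (.num 6))
          (.op .eq (.op .mod (.op .div (.var 13) (.num 12)) (.var 8)) (.num 0)))
          (.num 2)) (.num 3))))
        (.op .mod (.var 13) (.num 2))])) <|
  emitLoop (.var 12) (ifNonzero (.op .mod (.var 13) (.var 8))
    (ifNonzero (.get 0 (.op .add (.op .add
        (.op .add (.num 2) (.op .mul (.var 5) (.var 6)))
        (.op .mul (.op .mod (.op .add (.op .mul (.var 10) (.var 7))
          (.op .div (.var 13) (.var 8))) (.var 5)) (.var 6)))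
        (.op .sub (.op .mod (.var 13) (.var 8)) (.num 1))))
      (emitAll ((blockCode (some true)).map .num))
      (emitAll ((blockCode (some false)).map .num)))
    (emitAll ((blockCode none).map .num)))

/-- Write the query of group number `r[11]`. -/
def buildQuery : RamProgram :=
  .seq (assign 14 (.num 0)) <|
  .seq (emitAll ([3, 3, 3].map .num)) <|
  .seq (emitLoop (.var 16) (ifNonzero (.op .eq (.op .mod (.var 13) (.var 8)) (.var 6))
    (emitAll ([2, 2, 3].map .num))
    (emitAll [.num 2, .num 2, .get 0 (.op .add (.op .add (.num 2)
        (.op .mul (.op .mod (.op .add (.op .mul (.var 11) (.var 7))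
          (.op .div (.var 13) (.var 8))) (.var 5)) (.var 6)))
        (.op .mod (.var 13) (.var 8)))]))) <|
  emitAll ([3, 3].map .num)

/-- The vectors of group number `I`, continued periodically. -/
def groupVectors (n g : ℕ) (x : ℕ → ℕ → Bool) (I i h : ℕ) : Bool := x ((I * g + i) % n) h

/-- The numbers of vectors, their length, the group size and the vectors are available. -/
structure HoldsInstance (s : RamState) (n d g : ℕ) (x y : ℕ → ℕ → Bool) : Prop where
  num : s.reg 5 = n
  dim : s.reg 6 = d
  size : s.reg 7 = g
  dim_succ : s.reg 8 = d + 1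
  blocks : s.reg 12 = (3 * g + 2) * (d + 1)
  letters : s.reg 16 = (g + 2) * (d + 1)
  vec_x : ∀ i < n, ∀ h < d, s.arr 0 (2 + i * d + h) = (x i h).toNat
  vec_y : ∀ j < n, ∀ h < d, s.arr 0 (2 + n * d + j * d + h) = (y j h).toNat

section Build

variable {W n d g : ℕ} {x y : ℕ → ℕ → Bool} {s : RamState}

lemma HoldsInstance.of_loopFrame {s' : RamState} (h : HoldsInstance s n d g x y)
    (hf : LoopFrame s s') : HoldsInstance s' n d g x y where
  num := (hf.1 5 (by norm_num) (by norm_num)).trans h.num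
  dim := (hf.1 6 (by norm_num) (by norm_num)).trans h.dim
  size := (hf.1 7 (by norm_num) (by norm_num)).trans h.size
  dim_succ := (hf.1 8 (by norm_num) (by norm_num)).trans h.dim_succ
  blocks := (hf.1 12 (by norm_num) (by norm_num)).trans h.blocks
  letters := (hf.1 16 (by norm_num) (by norm_num)).trans h.letters
  vec_x := by rw [hf.2 0 (by norm_num)]; exact h.vec_x
  vec_y := by rw [hf.2 0 (by norm_num)]; exact h.vec_y

lemma blockCode_length_le (κ : Option Bool) : (blockCode κ).length ≤ 26 := by
  rcases κ with _ | _ | _ <;> decide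

lemma le_four_of_mem_blockCode (κ : Option Bool) : ∀ v ∈ blockCode κ, v ≤ 4 := by
  rcases κ with _ | _ | _ <;> decide

lemma holdsList_nil (s : RamState) : HoldsList (s.setReg 14 0) [] :=
  ⟨by simp [RamState.setReg], fun i hi => by simp at hi⟩

lemma length_flatMap_range_le {f : ℕ → List ℕ} {c : ℕ} (hf : ∀ i, (f i).length ≤ c) (n : ℕ) :
    ((List.range n).flatMap f).length ≤ n * c := by
  induction n with
  | zero => simp
  | succ n ih =>
    rw [List.range_succ, List.flatMap_append, List.length_append, List.flatMap_singleton,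
      Nat.succ_mul]
    exact add_le_add ih (hf n)

lemma length_encode_blockGraph_le {σ : ℕ} (hσ : 4 ≤ σ) (κ : ℕ → Option Bool) (K : ℕ) :
    (blockGraph hσ κ K).encode.length ≤ 50 * K + 2 := by
  rw [encode_blockGraph, List.length_append, List.length_append]
  have h1 := length_flatMap_range_le (f := fun e => [e / 2, edgeTarget κ e]) (c := 2) (by simp)
    (12 * (K - 1))
  have h2 := length_flatMap_range_le (f := fun k => blockCode (κ k)) (c := 26)
    (fun k => blockCode_length_le _) K
  simp only [List.length_cons, List.length_nil]
  omega

/-- The emitted expressions are the arithmetic definitions of `edgeTarget` and `nextLane`. A block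
has one of only three codes, which two tests select: whether the block is a separator, and the bit
read from the input. -/
lemma achieves_buildGraph {σ : ℕ} (hσ : 4 ≤ σ) {J : ℕ} (hs : HoldsInstance s n d g x y)
    (hJ : s.reg 10 = J) (hg : 1 ≤ g) (hJn : J * g < n)
    (hW : 60 * ((3 * g + 2) * (d + 1)) + n * d * 2 + n + 60 ≤ W) :
    Achieves W buildGraph (12 * ((3 * g + 2) * (d + 1)) * 100 +
      (3 * g + 2) * (d + 1) * 300 + 300) s fun s' =>
      HoldsList s' (blockGraph hσ (vectorKind d (groupVectors n g y J))
        ((3 * g + 2) * (d + 1))).encode ∧ LoopFrame s s' := by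
  set K := (3 * g + 2) * (d + 1) with hK
  set κ := vectorKind d (groupVectors n g y J) with hκ
  have hK1 : 1 ≤ K := Nat.mul_pos (by omega) (by omega)
  have hdK : d + 1 ≤ K := Nat.le_mul_of_pos_left _ (by omega)
  have hJg : J ≤ J * g := Nat.le_mul_of_pos_right _ hg
  have hgK : 3 * g + 2 ≤ K := Nat.le_mul_of_pos_right _ (by omega)
  have hlen := length_encode_blockGraph_le hσ κ K
  rw [encode_blockGraph] at hlen ⊢
  have hlen1 := hlen
  rw [List.length_append] at hlen1
  have hlen2 := hlen1
  rw [List.length_append] at hlen2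
  have hs0 : LoopFrame s (s.setReg 14 0) :=
    ⟨fun x _ hx => by simp [RamState.setReg, hx], fun _ _ => rfl⟩
  refine (achieves_seq (achieves_assign (Nat.zero_le _) (achieves_seq
    ((achieves_emitAll (c := 5) (vs := [6 * K, 12 * (K - 1)]) (holdsList_nil s) (by simp; omega)
      (by simp [RamExpr.cost]) ?_).mono le_rfl ?_)))).mono (B := 2 + (23 +
        ((12 * (K - 1) * (5 + 75 + 7) + 5 + 5) + (K * (1 + 231 + 7) + 1 + 5))))
      (by omega) fun _ h => h
  · simp only [List.forall₂_cons, List.Forall₂.nil, and_true]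
    constructor
    · intro s' hs'
      have h12 := ((hs.of_loopFrame hs0).of_loopFrame hs'.loopFrame).blocks
      simp only [RamExpr.Bounded, RamExpr.eval, WordOp.eval, h12]
      omega
    · intro s' hs'
      have h12 := ((hs.of_loopFrame hs0).of_loopFrame hs'.loopFrame).blocks
      simp only [RamExpr.Bounded, RamExpr.eval, WordOp.eval, h12]
      omega
  rintro s1 ⟨hl1, hf1⟩
  have hs1 := hs0.trans hf1.loopFrame
  refine achieves_seq ((achieves_emitLoop (n := 12 * (K - 1)) (B := 75)
    (f := fun e => [e / 2, edgeTarget κ e]) hl1 ?_ (by omega) ?_ ?_).mono ?_ ?_)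
  · rw [List.nil_append, List.length_append]; omega
  · intro s' hs'
    have h12 := (hs.of_loopFrame (hs1.trans hs')).blocks
    simp only [RamExpr.Bounded, RamExpr.eval, WordOp.eval, h12]
    omega
  · intro i hi s2 l2 hs2 h13 hl2 hlW
    refine (achieves_emitAll (c := 31) hl2 hlW (by simp [RamExpr.cost]) ?_).mono (by simp)
      fun _ h => h
    simp only [List.forall₂_cons, List.Forall₂.nil, and_true]
    constructor
    · intro s' hs'
      have h13' : s'.reg 13 = i := (hs'.1 13 (by norm_num)).trans h13
      simp only [RamExpr.Bounded, RamExpr.eval, WordOp.eval, h13', and_true]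
      omega
    · intro s' hs'
      have h13' : s'.reg 13 = i := (hs'.1 13 (by norm_num)).trans h13
      have h8 := (hs.of_loopFrame (hs1.trans (hs2.trans hs'.loopFrame))).dim_succ
      -- For `nextLane` only the question whether the block is a separator matters, and that is a
      -- divisibility test.
      have hκi : (if κ (i / 12) = none then 1 else 0) =
          if i / 12 % (d + 1) = 0 then 1 else 0 := by
        by_cases h : i / 12 % (d + 1) = 0 <;> simp [hκ, vectorKind, h]
      have hmod := Nat.mod_le (i / 12) (d + 1)
      simp only [RamExpr.Bounded, RamExpr.eval, WordOp.eval, h13', h8, edgeTarget, nextLane, hκi,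
        and_true]
      split_ifs <;> omega
  · simp [RamExpr.cost]
  rintro s2 ⟨hl2, hf2⟩
  have hs2 := hs1.trans hf2
  refine (achieves_emitLoop (n := K) (B := 231) (f := fun k => blockCode (κ k)) hl2 ?_ (by omega)
    ?_ ?_).mono (by simp [RamExpr.cost]) ?_
  · rw [List.nil_append]; exact hlen.trans (by omega)
  · intro s' hs'
    have h12 := (hs.of_loopFrame (hs2.trans hs')).blocks
    simp only [RamExpr.Bounded, RamExpr.eval, h12]
    omega
  · intro k hk s3 l3 hs3 h13 hl3 hlW
    have hI := hs.of_loopFrame (hs2.trans hs3)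
    have h10 : s3.reg 10 = J := ((hs2.trans hs3).1 10 (by norm_num) (by norm_num)).trans hJ
    have hmod : k % (d + 1) < d + 1 := Nat.mod_lt k (Nat.succ_pos d)
    have hdiv := Nat.div_le_self k (d + 1)
    -- A block code has at most 26 entries, and `183 = 26 * 7 + 1`.
    have hcode : ∀ κ', κ k = κ' → Achieves W (emitAll ((blockCode κ').map .num)) 183 s3 fun s'' =>
        HoldsList s'' (l3 ++ blockCode (κ k)) ∧ EmitFrame s3 s'' := by
      rintro κ' rfl
      refine (achieves_emitAll_num hl3 hlW fun v hv =>
        (le_four_of_mem_blockCode _ v hv).trans (by omega)).mono ?_ fun _ h => h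
      have := blockCode_length_le (κ k)
      omega
    refine (achieves_ifNonzero (B := 183 + 25) ?_ (fun h0 => (achieves_ifNonzero (B := 183) ?_
      (fun h1 => hcode _ ?_) fun h1 => hcode _ ?_).mono ?_ fun _ h => h) fun h0 =>
      (hcode _ ?_).mono (by omega) fun _ h => h).mono ?_ fun _ h => h
    · simp only [RamExpr.Bounded, RamExpr.eval, WordOp.eval, h13, hI.dim_succ]
      omega
    all_goals try simp only [RamExpr.eval, WordOp.eval, h13, hI.dim_succ] at h0
    all_goals try
      simp only [RamExpr.eval, WordOp.eval, h13, hI.dim_succ, hI.num, hI.dim, hI.size, h10] at h1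
    · have hr : (J * g + k / (d + 1)) % n < n := Nat.mod_lt _ (by omega)
      have hprod : (J * g + k / (d + 1)) % n * d ≤ n * d := Nat.mul_le_mul_right _ hr.le
      have hv := hI.vec_y _ hr (k % (d + 1) - 1) (by omega)
      have hb := (y ((J * g + k / (d + 1)) % n) (k % (d + 1) - 1)).toNat_lt
      simp only [RamExpr.Bounded, RamExpr.eval, WordOp.eval, h13, hI.dim_succ, hI.num, hI.dim,
        hI.size, h10, hv]
      omega
    · have hr : (J * g + k / (d + 1)) % n < n := Nat.mod_lt _ (by omega)
      rw [hI.vec_y _ hr (k % (d + 1) - 1) (by omega)] at h1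
      simpa [hκ, vectorKind, h0, groupVectors] using h1
    · have hr : (J * g + k / (d + 1)) % n < n := Nat.mod_lt _ (by omega)
      rw [hI.vec_y _ hr (k % (d + 1) - 1) (by omega)] at h1
      simpa [hκ, vectorKind, h0, groupVectors] using h1
    · simp [RamExpr.cost]
    · simp [hκ, vectorKind, h0]
    · simp [RamExpr.cost]
  · rintro s3 ⟨hl3, hf3⟩
    rw [List.nil_append] at hl3
    exact ⟨hl3, hs2.trans hf3⟩

lemma length_queryWord (d : ℕ) (x : ℕ → ℕ → Bool) (S : ℕ) :
    (queryWord d x S).length = 3 * (S * (d + 1)) + 5 := by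
  simp [queryWord, queryTail, List.length_flatMap]
  ring

lemma achieves_buildQuery {I : ℕ} (hs : HoldsInstance s n d g x y)
    (hI : s.reg 11 = I) (hg : 1 ≤ g) (hIn : I * g < n)
    (hW : 60 * ((g + 2) * (d + 1)) + n * d * 2 + n + 60 ≤ W) :
    Achieves W buildQuery ((g + 2) * (d + 1) * 100 + 100) s fun s' =>
      HoldsList s' (queryWord d (groupVectors n g x I) (g + 2)) ∧ LoopFrame s s' := by
  have hlen := length_queryWord d (groupVectors n g x I) (g + 2)
  have hword : queryWord d (groupVectors n g x I) (g + 2) = [] ++ [3, 3, 3] ++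
      (List.range ((g + 2) * (d + 1))).flatMap
        (fun m => [2, 2, queryLetter d (groupVectors n g x I) m]) ++ [3, 3] := by
    simp [queryWord, queryTail, List.range_eq_range']
  rw [hword] at hlen ⊢
  set M := (g + 2) * (d + 1) with hM
  have hlen1 := hlen
  rw [List.length_append] at hlen1
  have hIg : I ≤ I * g := Nat.le_mul_of_pos_right _ hg
  have hgM : g + 2 ≤ M := Nat.le_mul_of_pos_right _ (by omega)
  have hdM : d + 1 ≤ M := Nat.le_mul_of_pos_left _ (by omega)
  have hs0 : LoopFrame s (s.setReg 14 0) :=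
    ⟨fun x _ hx => by simp [RamState.setReg, hx], fun _ _ => rfl⟩
  refine (achieves_seq (achieves_assign (Nat.zero_le _) (achieves_seq
    ((achieves_emitAll_num (vs := [3, 3, 3]) (holdsList_nil s) (by simp; omega)
      (by simp; omega)).mono le_rfl ?_)))).mono (B := 2 + (22 +
        ((M * (1 + 82 + 7) + 1 + 5) + 15)))
      (by omega) fun _ h => h
  rintro s1 ⟨hl1, hf1⟩
  have hs1 := hs0.trans hf1.loopFrame
  refine achieves_seq ((achieves_emitLoop (n := M) (B := 82)
    (f := fun m => [2, 2, queryLetter d (groupVectors n g x I) m]) hl1 (by omega) (by omega)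
    ?_ ?_).mono (by simp [RamExpr.cost]) ?_)
  · intro s' hs'
    have h16 := (hs.of_loopFrame (hs1.trans hs')).letters
    simp only [RamExpr.Bounded, RamExpr.eval, h16]
    omega
  · intro m hm s2 l2 hs2 h13 hl2 hlW
    have hI2 := hs.of_loopFrame (hs1.trans hs2)
    have hmod : m % (d + 1) < d + 1 := Nat.mod_lt m (Nat.succ_pos d)
    have hdiv := Nat.div_le_self m (d + 1)
    refine (achieves_ifNonzero (B := 76) ?_ (fun h0 => ?_) fun h0 => ?_).mono ?_ fun _ h => h
    · simp only [RamExpr.Bounded, RamExpr.eval, WordOp.eval, h13, hI2.dim_succ, hI2.dim]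
      split_ifs <;> omega
    · simp only [RamExpr.eval, WordOp.eval, h13, hI2.dim_succ, hI2.dim] at h0
      have h0 : m % (d + 1) = d := by by_contra h; simp [h] at h0
      have e : queryLetter d (groupVectors n g x I) m = 3 := by simp [queryLetter, h0]
      rw [e] at hlW ⊢
      exact (achieves_emitAll_num hl2 hlW (by simp; omega)).mono (by simp) fun _ h => h
    · simp only [RamExpr.eval, WordOp.eval, h13, hI2.dim_succ, hI2.dim] at h0
      have h0 : m % (d + 1) ≠ d := by intro h; simp [h] at h0
      refine (achieves_emitAll (c := 19) hl2 hlW (by simp [RamExpr.cost]) ?_).mono (by simp)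
        fun _ h => h
      simp only [List.forall₂_cons, List.Forall₂.nil, and_true]
      refine ⟨fun s' _ => ⟨by simp only [RamExpr.Bounded]; omega, rfl⟩,
        fun s' _ => ⟨by simp only [RamExpr.Bounded]; omega, rfl⟩, fun s' hs' => ?_⟩
      have hI3 := hI2.of_loopFrame hs'.loopFrame
      have h13' : s'.reg 13 = m := (hs'.1 13 (by norm_num)).trans h13
      have h11 : s'.reg 11 = I :=
        ((hs1.trans (hs2.trans hs'.loopFrame)).1 11 (by norm_num) (by norm_num)).trans hI
      have hr : (I * g + m / (d + 1)) % n < n := Nat.mod_lt _ (by omega)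
      have hprod : (I * g + m / (d + 1)) % n * d ≤ n * d := Nat.mul_le_mul_right _ hr.le
      have hv := hI3.vec_x _ hr (m % (d + 1)) (by omega)
      have hb := (x ((I * g + m / (d + 1)) % n) (m % (d + 1))).toNat_lt
      simp only [RamExpr.Bounded, RamExpr.eval, WordOp.eval, h13', hI3.dim_succ, hI3.num, hI3.dim,
        hI3.size, h11, hv]
      refine ⟨by omega, ?_⟩
      simp [queryLetter, h0, groupVectors]
    · simp [RamExpr.cost]
  rintro s2 ⟨hl2, hf2⟩
  refine (achieves_emitAll_num (vs := [3, 3]) hl2 (by omega) (by simp; omega)).mono (by simp) ?_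
  rintro s3 ⟨hl3, hf3⟩
  exact ⟨hl3, hs1.trans (hf2.trans hf3.loopFrame)⟩

end Build

/-! ### The program for Orthogonal Vectors -/

section Transfer

variable {A V W : ℕ} {s s' u : RamState}

lemma Simulates.congr (h : Simulates A V W s u) (e : s'.arr 2 = s.arr 2) :
    Simulates A V W s' u :=
  ⟨fun x => by rw [e]; exact h.reg x, fun a i ha => by rw [e]; exact h.arr a i ha, h.reg_le,
    fun i => by rw [e]; exact h.cell_le i⟩

lemma LogExtends.of_eq (h1 : s'.reg 1 = s.reg 1) (h2 : ∀ a, a = 2 ∨ a = 3 ∨ a = 4 →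
    s'.arr a = s.arr a) : LogExtends W s s' 0 :=
  ⟨h1, fun i _ => by rw [h2 3 (by simp), h2 4 (by simp)]; exact ⟨rfl, rfl⟩,
    fun i _ _ => by omega, h2 2 (by simp)⟩

lemma LoopFrame.logExtends (h : LoopFrame s s') : LogExtends W s s' 0 :=
  .of_eq (h.1 1 (by norm_num) (by norm_num)) fun a ha => h.2 a (by omega)

lemma LogExtends.setReg {x v : ℕ} (hx : x ≠ 1) : LogExtends W s (s.setReg x v) 0 :=
  .of_eq (by simp [RamState.setReg, hx.symm]) fun _ _ => rfl

lemma LogExtends.arr_two (h : LogExtends W s s' 0) : s'.arr 2 = s.arr 2 := h.undo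

lemma HoldsInstance.congr {n d g : ℕ} {x y : ℕ → ℕ → Bool} (h : HoldsInstance s n d g x y)
    (hr : ∀ i, i ∈ [5, 6, 7, 8, 12, 16] → s'.reg i = s.reg i) (ha : s'.arr 0 = s.arr 0) :
    HoldsInstance s' n d g x y where
  num := (hr 5 (by simp)).trans h.num
  dim := (hr 6 (by simp)).trans h.dim
  size := (hr 7 (by simp)).trans h.size
  dim_succ := (hr 8 (by simp)).trans h.dim_succ
  blocks := (hr 12 (by simp)).trans h.blocks
  letters := (hr 16 (by simp)).trans h.letters
  vec_x := by rw [ha]; exact h.vec_x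
  vec_y := by rw [ha]; exact h.vec_y

lemma ramExec_mono {V' t : ℕ} {p : RamProgram} (h : RamExec V p s t s') (hV : V ≤ V') :
    RamExec V' p s t s' := by
  induction h with
  | skip => exact .skip _
  | const _ _ _ h => exact .const _ _ _ (h.trans hV)
  | op _ _ _ _ _ h => exact .op _ _ _ _ _ (h.trans hV)
  | load _ _ _ _ h => exact .load _ _ _ _ (h.trans hV)
  | store _ _ _ _ h => exact .store _ _ _ _ (h.trans hV)
  | seq _ _ _ _ _ _ _ _ _ ih1 ih2 => exact .seq _ _ _ _ _ _ _ ih1 ih2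
  | iteTrue _ _ _ _ _ _ h _ ih => exact .iteTrue _ _ _ _ _ _ h ih
  | iteFalse _ _ _ _ _ _ h _ ih => exact .iteFalse _ _ _ _ _ _ h ih
  | loopDone _ _ _ h => exact .loopDone _ _ _ h
  | loopStep _ _ _ _ _ _ _ h _ _ ih1 ih2 => exact .loopStep _ _ _ _ _ _ _ h ih1 ih2

end Transfer

/-- Answer the query of group number `r[11]` and restore the simulated memory. -/
def runQuery (A : ℕ) (query : RamProgram) : RamProgram :=
  .seq buildQuery <| .seq (copyList A 1) <| .seq (logWrite (.num 0) (.var 14)) <|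
  .seq (compile A query) <| .seq (ifNonzero (.get 2 (.num 0)) (assign 0 (.num 1)) .skip) undoAll

/-- Answer the queries of all groups. -/
def runQueries (A : ℕ) (query : RamProgram) : RamProgram :=
  .seq (assign 9 (.var 1)) <| .seq (assign 11 (.num 0)) <|
  whileNonzero (.op .lt (.op .mul (.var 11) (.var 7)) (.var 5)) <|
    .seq (runQuery A query) (assign 11 (.op .add (.var 11) (.num 1)))

/-- Preprocess the graph of group number `r[10]`, answer all queries and clear the simulated
memory. -/
def runGroup (A : ℕ) (pre query : RamProgram) : RamProgram :=
  .seq buildGraph <| .seq (copyList A 0) <| .seq (compile A pre) <| .seq (runQueries A query) <|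
  .seq (assign 9 (.num 0)) undoAll

/-- Treat the graphs of all groups. -/
def runGroups (A : ℕ) (pre query : RamProgram) : RamProgram :=
  .seq (assign 10 (.num 0)) <|
  whileNonzero (.op .lt (.op .mul (.var 10) (.var 7)) (.var 5)) <|
    .seq (runGroup A pre query) (assign 10 (.op .add (.var 10) (.num 1)))

/-- The power `e ^ k`. -/
def powExpr (e : RamExpr) : ℕ → RamExpr
  | 0 => .num 1
  | k + 1 => .op .mul (powExpr e k) e

/-- Read the size of the instance and compute the size of the groups, which is the integer part
of the `k`-th root of the number of vectors. -/
def setup (k : ℕ) : RamProgram :=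
  .seq (assign 5 (.get 0 (.num 0))) <| .seq (assign 6 (.get 0 (.num 1))) <|
  .seq (assign 7 (.num 1)) <|
  .seq (whileNonzero
    (.op .eq (.op .lt (.var 5) (powExpr (.op .add (.var 7) (.num 1)) k)) (.num 0))
    (assign 7 (.op .add (.var 7) (.num 1)))) <|
  .seq (assign 8 (.op .add (.var 6) (.num 1))) <|
  .seq (assign 12 (.op .mul (.op .add (.op .mul (.num 3) (.var 7)) (.num 2)) (.var 8)))
    (assign 16 (.op .mul (.op .add (.var 7) (.num 2)) (.var 8)))

/-- The program for Orthogonal Vectors that uses the indexing scheme `pre`, `query`. -/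
def ovProgram (A k : ℕ) (pre query : RamProgram) : RamProgram :=
  .seq (setup k) (runGroups A pre query)

/-- The word bound `W` suffices for graphs and queries that are processed with word bound `V` in
times `tp` and `tq`. -/
structure WordBound (W A V n d g tp tq : ℕ) : Prop where
  names : A * A ≤ W
  cells : (V + 1) * A ≤ W
  numbers : 60 * ((3 * g + 2) * (d + 1)) + n * d * 2 + n + 60 ≤ W
  lists : (50 * ((3 * g + 2) * (d + 1)) + 3) * A ≤ W
  log : 54 * ((3 * g + 2) * (d + 1)) + 20 + tp + tq ≤ W
  query_length : 3 * ((g + 2) * (d + 1)) + 5 ≤ V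

/-! ### Correctness and running time of the program for Orthogonal Vectors -/

section Main

variable {A V W n d g tp tq : ℕ} {x y : ℕ → ℕ → Bool} {s : RamState} {pre query : RamProgram}

/-- The query word, its length and all writes of the simulated query go through the log, so the
rollback leaves exactly the memory produced by the preprocessing. The answer is transferred to
variable 0 before the rollback; variable 0 collects the disjunction of all answers. -/
lemma achieves_runQuery (hW : WordBound W A V n d g tp tq) (hA : query.names + 3 ≤ A) {u : RamState}
    {I : ℕ} (hs : HoldsInstance s n d g x y) (hu : Simulates A V W s u) (h11 : s.reg 11 = I)
    (hg : 1 ≤ g) (hI : I * g < n) (h9 : s.reg 9 = s.reg 1)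
    (htop : s.reg 1 ≤ 50 * ((3 * g + 2) * (d + 1)) + 2 + tp) {t : ℕ} {u' : RamState}
    (hex : RamExec V query (u.withQuery (queryWord d (groupVectors n g x I) (g + 2))) t u')
    (ht : t ≤ tq) :
    Achieves W (runQuery A query) (250 * ((g + 2) * (d + 1)) + 37 * tq + 400) s fun s' =>
      LogExtends W s s' 0 ∧ (∀ i, 5 ≤ i → i ≠ 13 → i ≠ 14 → s'.reg i = s.reg i) ∧
      s'.arr 0 = s.arr 0 ∧ (s'.reg 0 ≠ 0 ↔ s.reg 0 ≠ 0 ∨ u'.reg 0 ≠ 0) := by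
  obtain ⟨hW1, hW2, hW3, hW4, hW5, hW6⟩ := hW
  have hMK : (g + 2) * (d + 1) ≤ (3 * g + 2) * (d + 1) := Nat.mul_le_mul_right _ (by omega)
  have hlen := length_queryWord d (groupVectors n g x I) (g + 2)
  have hlt := queryWord_lt_four d (groupVectors n g x I) (g + 2)
  set Q := queryWord d (groupVectors n g x I) (g + 2) with hQ
  set M := (g + 2) * (d + 1) with hM
  set K := (3 * g + 2) * (d + 1) with hK
  have hK1 : 1 ≤ K := Nat.mul_pos (by omega) (by omega)
  have hQA : (Q.length + 1) * A ≤ W := (Nat.mul_le_mul_right A (by omega)).trans hW4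
  refine (achieves_seq ((achieves_buildQuery hs h11 hg hI (by omega)).mono le_rfl ?_)).mono
    (B := M * 100 + 100 + (Q.length * 31 + 6 + (18 + (24 * t + (5 + ((Q.length + 1 + t) * 13 + 4))))))
    (by rw [hlen]; omega) fun _ h => h
  rintro s1 ⟨hl1, hf1⟩
  replace hl1 : HoldsList s1 Q := hl1
  have hlog1 : LogExtends W s s1 0 := hf1.logExtends
  refine achieves_seq ((achieves_copyList (a := 1) (by omega) (hu.congr hlog1.arr_two) hl1
    (fun v hv => (hlt v hv).le.trans (by omega)) hQA (by rw [hlog1.top]; omega)).mono le_rfl ?_)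
  rintro s2 ⟨hs2, hlog2⟩
  have h14 : s2.reg 14 = Q.length := (hlog2.reg 14 (by norm_num)).trans hl1.1
  have ht1 := hlog1.top
  have ht2 := hlog2.top
  -- Register 0 of the simulated machine receives the length of the query. Its cell is written as `0
  -- * A` to match `Simulates.setReg`.
  refine achieves_seq ((achieves_logWrite (e := .num 0) (f := .var 14) (addr := 0 * A)
    (v := Q.length) (Nat.zero_le _) (by simp [RamExpr.eval]) ?_ ?_ ?_ (hs2.cell_le _)
    (Q := fun s3 => Simulates A V W s3 (u.withQuery Q) ∧ Logged W s2 s3 1)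
    ⟨?_, logged_loggedState (by simp) (hs2.cell_le _)⟩).mono
      (by simp [RamExpr.cost]) ?_)
  · simp [RamExpr.Bounded, RamState.setReg, h14]; omega
  · simp [RamExpr.eval, RamState.setReg, h14]
  · omega
  · exact hs2.setReg (by omega) (by omega) (by omega)
  rintro s3 ⟨hs3, hlog3⟩
  have ht3 := hlog3.top
  refine achieves_seq ((achieves_compile hW1 hW2 hex (by omega) s3 hs3 (by omega)).mono le_rfl ?_)
  rintro s4 ⟨hs4, w, hw, hlog4⟩
  have hlog : LogExtends W s s4 (0 + Q.length + 1 + w) :=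
    ((hlog1.trans hlog2.toLogExtends).trans hlog3.toLogExtends).trans hlog4.toLogExtends
  have hreg4 : ∀ i, i = 0 ∨ 5 ≤ i → i ≠ 13 → i ≠ 14 → s4.reg i = s.reg i := fun i hi h1 h2 => by
    rw [hlog4.reg i hi, hlog3.reg i hi, hlog2.reg i hi, hf1.1 i h1 h2]
  have harr4 : s4.arr 0 = s.arr 0 := by
    rw [hlog4.arr 0 (by simp), hlog3.arr 0 (by simp), hlog2.arr 0 (by simp), hf1.2 0 (by norm_num)]
  have hv : RamExpr.eval s4 (.get 2 (.num 0)) = u'.reg 0 := by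
    have := hs4.reg 0
    rwa [zero_mul] at this
  have hb : RamExpr.Bounded W s4 (.get 2 (.num 0)) := ⟨Nat.zero_le _, hs4.cell_le _⟩
  have hundo : ∀ s5 : RamState, (∀ i, i ≠ 0 → s5.reg i = s4.reg i) → s5.arr = s4.arr →
      (s5.reg 0 ≠ 0 ↔ s.reg 0 ≠ 0 ∨ u'.reg 0 ≠ 0) →
      Achieves W undoAll ((Q.length + 1 + t) * 13 + 4) s5 fun s' =>
      LogExtends W s s' 0 ∧ (∀ i, 5 ≤ i → i ≠ 13 → i ≠ 14 → s'.reg i = s.reg i) ∧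
      s'.arr 0 = s.arr 0 ∧ (s'.reg 0 ≠ 0 ↔ s.reg 0 ≠ 0 ∨ u'.reg 0 ≠ 0) := by
    intro s5 hr ha h0
    have hlog5 : LogExtends W s s5 (0 + Q.length + 1 + w) :=
      hlog.trans (LogExtends.of_eq (hr 1 (by norm_num)) fun a _ => by rw [ha])
    refine (achieves_undoAll hlog5 (by omega) (by omega) ?_).mono (by omega) ?_
    · rw [hr 9 (by norm_num), hreg4 9 (by norm_num) (by norm_num) (by norm_num), h9]
    · rintro s6 ⟨k1, k2, k3⟩
      refine ⟨k1, fun i hi h1 h2 => ?_, ?_, ?_⟩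
      · rw [k2 i (by omega), hr i (by omega), hreg4 i (by omega) h1 h2]
      · rw [k3 0 (by norm_num), ha, harr4]
      · rw [k2 0 (by simp)]; exact h0
  have h00 := hreg4 0 (by simp) (by norm_num) (by norm_num)
  refine achieves_seq ((achieves_ifNonzero (B := 2) hb (fun hne => ?_) fun he => ?_).mono
    (by simp [RamExpr.cost]) fun _ h => h)
  · refine achieves_assign (by simp only [RamExpr.Bounded]; omega) (hundo _ (fun i hi => ?_) rfl ?_)
    · simp [RamState.setReg, hi]
    · rw [hv] at hne
      simp [RamState.setReg, RamExpr.eval, hne]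
  · refine (achieves_skip (hundo s4 (fun _ _ => rfl) rfl ?_)).mono (by norm_num) fun _ h => h
    rw [hv] at he
    simp [h00, he]

/-- It converts the loop tests, which compare the start of a group with `n`, into the number of
rounds. -/
lemma mul_lt_iff_lt_ceilDiv {n g : ℕ} (hg : 1 ≤ g) (i : ℕ) :
    i * g < n ↔ i < (n + g - 1) / g := by
  rw [← Nat.succ_le_iff (m := i), Nat.le_div_iff_mul_le hg, Nat.succ_mul]
  omega

lemma achieves_runQueries (hW : WordBound W A V n d g tp tq) (hA : query.names + 3 ≤ A)
    {u : RamState} (hs : HoldsInstance s n d g x y) (hu : Simulates A V W s u) (hg : 1 ≤ g)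
    (hn : n + 2 * g + 2 ≤ W)
    (htop : s.reg 1 ≤ 50 * ((3 * g + 2) * (d + 1)) + 2 + tp) {O : ℕ → Prop}
    (hex : ∀ I, I * g < n → ∃ t u', RamExec V query
      (u.withQuery (queryWord d (groupVectors n g x I) (g + 2))) t u' ∧ t ≤ tq ∧
      (u'.reg 0 ≠ 0 ↔ O I)) :
    Achieves W (runQueries A query)
      ((n + g - 1) / g * (250 * ((g + 2) * (d + 1)) + 37 * tq + 410) + 10) s fun s' =>
      LogExtends W s s' 0 ∧
      (∀ i, 5 ≤ i → i ≠ 9 → i ≠ 11 → i ≠ 13 → i ≠ 14 → s'.reg i = s.reg i) ∧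
      s'.arr 0 = s.arr 0 ∧ (s'.reg 0 ≠ 0 ↔ s.reg 0 ≠ 0 ∨ ∃ I, I * g < n ∧ O I) := by
  set N := (n + g - 1) / g with hN
  have hNg : ∀ i, i ≤ N → i * g < n + g := by
    intro i hi
    have : N * g ≤ n + g - 1 := Nat.div_mul_le_self _ _
    have := Nat.mul_le_mul_right g hi
    omega
  have hNi : ∀ i, i ≤ N → i < n + g := fun i hi =>
    (Nat.le_mul_of_pos_right i hg).trans_lt (hNg i hi)
  have hlog := hW.log
  have hcond : ∀ s', s'.reg 7 = g → s'.reg 5 = n → ∀ i ≤ N, s'.reg 11 = i →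
      RamExpr.Bounded W s' (.op .lt (.op .mul (.var 11) (.var 7)) (.var 5)) ∧
      RamExpr.eval s' (.op .lt (.op .mul (.var 11) (.var 7)) (.var 5)) =
        if i * g < n then 1 else 0 := by
    intro s' h7 h5 i hi h11
    have h1 := hNg i hi
    have h2 := hNi i hi
    simp only [RamExpr.Bounded, RamExpr.eval, WordOp.eval, h7, h5, h11, and_true]
    split_ifs <;> omega
  refine (achieves_seq (achieves_assign (by simp only [RamExpr.Bounded]; omega)
    (achieves_seq (achieves_assign (Nat.zero_le _) ((achieves_whileNonzero
    (B := 250 * ((g + 2) * (d + 1)) + 37 * tq + 400 + 4) N (fun i s' => LogExtends W s s' 0 ∧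
      (∀ i, 5 ≤ i → i ≠ 9 → i ≠ 11 → i ≠ 13 → i ≠ 14 → s'.reg i = s.reg i) ∧
      s'.arr 0 = s.arr 0 ∧ s'.reg 9 = s.reg 1 ∧ s'.reg 11 = i ∧
      (s'.reg 0 ≠ 0 ↔ s.reg 0 ≠ 0 ∨ ∃ I < i, O I)) ?_ ?_ ?_).mono le_rfl ?_))))).mono
      (B := 2 + (2 + (N * (6 + (250 * ((g + 2) * (d + 1)) + 37 * tq + 400 + 4)) + 6)))
      ?_ fun _ h => h
  · rintro i hi r ⟨k1, k2, k3, k4, k5, k6⟩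
    have hin := (mul_lt_iff_lt_ceilDiv hg i).mpr hi
    have hr : HoldsInstance r n d g x y := hs.congr (fun j hj => by
      fin_cases hj <;> exact k2 _ (by norm_num) (by norm_num) (by norm_num) (by norm_num)
        (by norm_num)) k3
    obtain ⟨hb, hv⟩ := hcond r hr.size hr.num i hi.le k5
    obtain ⟨t, u', e1, e2, e3⟩ := hex i hin
    have ktop := k1.top
    refine ⟨hb, by simp [hv, hin], achieves_seq ((achieves_runQuery hW hA hr
      (hu.congr k1.arr_two) k5 hg hin (by omega) (by omega) e1 e2).mono le_rfl ?_)⟩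
    rintro r' ⟨l1, l2, l3, l4⟩
    have r11 : r'.reg 11 = i := (l2 11 (by norm_num) (by norm_num) (by norm_num)).trans k5
    have hiN := hNi i hi.le
    refine achieves_assign ?_ ⟨?_, fun j h1 h2 h3 h4 h5 => ?_, ?_, ?_, ?_, ?_⟩
    · simp only [RamExpr.Bounded, RamExpr.eval, WordOp.eval, r11]; omega
    · exact (k1.trans l1).trans (.setReg (by norm_num))
    · rw [← k2 j h1 h2 h3 h4 h5, ← l2 j h1 h4 h5]
      simp [RamState.setReg, h3]
    · exact l3.trans k3
    · rw [← k4, ← l2 9 (by norm_num) (by norm_num) (by norm_num)]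
      simp [RamState.setReg]
    · simp [RamState.setReg, RamExpr.eval, WordOp.eval, r11]
    · have : ((r'.setReg 11 (RamExpr.eval r' (.op .add (.var 11) (.num 1)))).reg 0) = r'.reg 0 := by
        simp [RamState.setReg]
      rw [this, l4, k6, e3, or_assoc]
      refine or_congr_right ⟨?_, ?_⟩
      · rintro (⟨I, h1, h2⟩ | h)
        · exact ⟨I, h1.trans (Nat.lt_succ_self i), h2⟩
        · exact ⟨i, Nat.lt_succ_self i, h⟩
      · rintro ⟨I, h1, h2⟩
        rcases (Nat.lt_succ_iff.mp h1).lt_or_eq with h | rfl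
        · exact .inl ⟨I, h, h2⟩
        · exact .inr h2
  · rintro r ⟨k1, k2, k3, k4, k5, k6⟩
    obtain ⟨hb, hv⟩ := hcond r ((k2 7 (by norm_num) (by norm_num) (by norm_num) (by norm_num)
      (by norm_num)).trans hs.size) ((k2 5 (by norm_num) (by norm_num) (by norm_num) (by norm_num)
      (by norm_num)).trans hs.num) N le_rfl k5
    refine ⟨hb, hv.trans (if_neg ?_)⟩
    rw [mul_lt_iff_lt_ceilDiv hg]
    exact lt_irrefl _
  · refine ⟨.of_eq (by simp [RamState.setReg]) fun _ _ => rfl, fun j _ h2 h3 _ _ => ?_, rfl, ?_, ?_,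
      ?_⟩
    · simp [RamState.setReg, h2, h3]
    · simp [RamState.setReg, RamExpr.eval]
    · simp [RamState.setReg, RamExpr.eval]
    · simp [RamState.setReg]
  · rintro r ⟨k1, k2, k3, k4, k5, k6⟩
    refine ⟨k1, k2, k3, k6.trans (or_congr_right (exists_congr fun I => ?_))⟩
    rw [mul_lt_iff_lt_ceilDiv hg]
  · rw [show 6 + (250 * ((g + 2) * (d + 1)) + 37 * tq + 400 + 4) =
      250 * ((g + 2) * (d + 1)) + 37 * tq + 410 by ring]
    omega

lemma le_of_mem_encode_blockGraph {σ : ℕ} (hσ : 4 ≤ σ) (κ : ℕ → Option Bool) (K : ℕ) :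
    ∀ v ∈ (blockGraph hσ κ K).encode, v ≤ 12 * K + 4 := by
  intro v hv
  simp only [encode_blockGraph, List.mem_append, List.mem_cons, List.not_mem_nil, or_false,
    List.mem_flatMap, List.mem_range] at hv
  rcases hv with (h | ⟨e, he, h⟩) | ⟨k, -, h⟩
  · omega
  · have := edgeTarget_lt (κ := κ) he
    omega
  · have := le_four_of_mem_blockCode _ v h
    omega

/-- The preprocessing expects zero memory apart from its input. The empty log and the zero array at
the start provide this, and the final rollback to log length 0 restores it for the next graph, at a
cost proportional to the preprocessing time and the size of the graph. -/
lemma achieves_runGroup {σ : ℕ} (hσ : 4 ≤ σ) (hW : WordBound W A V n d g tp tq)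
    (hA : query.names + 3 ≤ A) (hA' : pre.names + 3 ≤ A) {J : ℕ}
    (hs : HoldsInstance s n d g x y) (h2 : s.arr 2 = fun _ => 0) (h1 : s.reg 1 = 0)
    (hg : 1 ≤ g) (hn : n + 2 * g + 2 ≤ W) (h10 : s.reg 10 = J) (hJ : J * g < n)
    {O : ℕ → Prop} {t : ℕ} {u : RamState}
    (hpre : RamExec V pre (RamState.init (blockGraph hσ (vectorKind d (groupVectors n g y J))
      ((3 * g + 2) * (d + 1))).encode) t u) (ht : t ≤ tp)
    (hex : ∀ I, I * g < n → ∃ t u', RamExec V query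
      (u.withQuery (queryWord d (groupVectors n g x I) (g + 2))) t u' ∧ t ≤ tq ∧
      (u'.reg 0 ≠ 0 ↔ O I)) :
    Achieves W (runGroup A pre query) (4000 * ((3 * g + 2) * (d + 1)) + 40 * tp + 1000 +
      (n + g - 1) / g * (250 * ((g + 2) * (d + 1)) + 37 * tq + 410)) s fun s' =>
      LogExtends W s s' 0 ∧
      (∀ i, 5 ≤ i → i ≠ 9 → i ≠ 11 → i ≠ 13 → i ≠ 14 → s'.reg i = s.reg i) ∧
      s'.arr 0 = s.arr 0 ∧ (s'.reg 0 ≠ 0 ↔ s.reg 0 ≠ 0 ∨ ∃ I, I * g < n ∧ O I) := by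
  obtain ⟨hW1, hW2, hW3, hW4, hW5, hW6⟩ := id hW
  set E := (blockGraph hσ (vectorKind d (groupVectors n g y J)) ((3 * g + 2) * (d + 1))).encode
    with hE
  have hlen : E.length ≤ 50 * ((3 * g + 2) * (d + 1)) + 2 := length_encode_blockGraph_le hσ _ _
  have hmem : ∀ v ∈ E, v ≤ W := fun v hv =>
    (le_of_mem_encode_blockGraph hσ _ _ v hv).trans (by omega)
  set K := (3 * g + 2) * (d + 1) with hK
  refine (achieves_seq ((achieves_buildGraph hσ hs h10 hg hJ hW3).mono le_rfl ?_)).mono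
    (B := 12 * K * 100 + K * 300 + 300 + (E.length * 31 + 6 + (24 * t +
      ((n + g - 1) / g * (250 * ((g + 2) * (d + 1)) + 37 * tq + 410) + 10 + (2 +
        ((E.length + t) * 13 + 4))))))
    (by omega) fun _ h => h
  rintro s1 ⟨hl1, hf1⟩
  replace hl1 : HoldsList s1 E := hl1
  have hlog1 : LogExtends W s s1 0 := hf1.logExtends
  have hzero : Simulates A V W s1 ⟨fun _ => 0, fun _ _ => 0⟩ := by
    have e : s1.arr 2 = fun _ => 0 := hlog1.arr_two.trans h2
    exact ⟨by simp [e], by simp [e], by simp, by simp [e]⟩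
  have ht1 := hlog1.top
  refine achieves_seq ((achieves_copyList (a := 0) (by omega) hzero hl1 hmem
    ((Nat.mul_le_mul_right A (by omega)).trans hW4) (by omega)).mono le_rfl ?_)
  rintro s2 ⟨hs2, hlog2⟩
  -- The encoding written over zero memory is the initial state in which the scheme starts its
  -- preprocessing.
  have hinit : RamState.overwrite ⟨fun _ => 0, fun _ _ => 0⟩ 0 E = RamState.init E := by
    simp only [RamState.overwrite, RamState.init, RamState.mk.injEq, true_and]
    funext a i
    by_cases ha : a = 0 <;> simp [ha]
  rw [hinit] at hs2
  have ht2 := hlog2.top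
  refine achieves_seq ((achieves_compile hW1 hW2 hpre (by omega) s2 hs2 (by omega)).mono le_rfl ?_)
  rintro s3 ⟨hs3, w, hw, hlog3⟩
  have ht3 := hlog3.top
  have hreg3 : ∀ i, i = 0 ∨ 5 ≤ i → i ≠ 13 → i ≠ 14 → s3.reg i = s.reg i := fun i hi h1 h2 => by
    rw [hlog3.reg i hi, hlog2.reg i hi, hf1.1 i h1 h2]
  have harr3 : s3.arr 0 = s.arr 0 := by
    rw [hlog3.arr 0 (by simp), hlog2.arr 0 (by simp), hf1.2 0 (by norm_num)]
  have hI3 : HoldsInstance s3 n d g x y := hs.congr (fun j hj => by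
    fin_cases hj <;> exact hreg3 _ (by norm_num) (by norm_num) (by norm_num)) harr3
  refine achieves_seq ((achieves_runQueries hW hA hI3 hs3 hg hn (by omega) hex).mono le_rfl ?_)
  rintro s4 ⟨l1, l2, l3, l4⟩
  have hlog4 : LogExtends W s s4 (0 + E.length + w + 0) :=
    ((hlog1.trans hlog2.toLogExtends).trans hlog3.toLogExtends).trans l1
  refine achieves_seq (achieves_assign (Nat.zero_le _) ?_)
  have hlog5 := hlog4.trans (LogExtends.of_eq (s' := s4.setReg 9 (RamExpr.eval s4 (.num 0)))
    (by simp [RamState.setReg]) fun _ _ => rfl)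
  refine (achieves_undoAll hlog5 (by omega) (by omega) ?_).mono (by omega) ?_
  · simp [RamState.setReg, RamExpr.eval, h1]
  · rintro s5 ⟨k1, k2, k3⟩
    refine ⟨k1, fun i h1 h2 h3 h4 h5 => ?_, ?_, ?_⟩
    · rw [k2 i (by omega), ← hreg3 i (by omega) h4 h5, ← l2 i h1 h2 h3 h4 h5]
      simp [RamState.setReg, h2]
    · rw [k3 0 (by norm_num), ← harr3, ← l3]; rfl
    · rw [k2 0 (by simp), ← hreg3 0 (by simp) (by norm_num) (by norm_num), ← l4]
      simp [RamState.setReg]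

lemma achieves_runGroups {σ : ℕ} (hσ : 4 ≤ σ) (hW : WordBound W A V n d g tp tq)
    (hA : query.names + 3 ≤ A) (hA' : pre.names + 3 ≤ A)
    (hs : HoldsInstance s n d g x y) (h2 : s.arr 2 = fun _ => 0) (h1 : s.reg 1 = 0)
    (h0 : s.reg 0 = 0) (hg : 1 ≤ g) (hn : n + 2 * g + 2 ≤ W) {O : ℕ → ℕ → Prop}
    (hex : ∀ J, J * g < n → ∃ t u,
      RamExec V pre (RamState.init (blockGraph hσ (vectorKind d (groupVectors n g y J))
        ((3 * g + 2) * (d + 1))).encode) t u ∧ t ≤ tp ∧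
      ∀ I, I * g < n → ∃ t u', RamExec V query
        (u.withQuery (queryWord d (groupVectors n g x I) (g + 2))) t u' ∧ t ≤ tq ∧
        (u'.reg 0 ≠ 0 ↔ O J I)) :
    Achieves W (runGroups A pre query) ((n + g - 1) / g *
      (4000 * ((3 * g + 2) * (d + 1)) + 40 * tp + 1010 +
        (n + g - 1) / g * (250 * ((g + 2) * (d + 1)) + 37 * tq + 410)) + 8) s fun s' =>
      (s'.reg 0 ≠ 0 ↔ ∃ J, J * g < n ∧ ∃ I, I * g < n ∧ O J I) := by
  set N := (n + g - 1) / g with hN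
  have hNg : ∀ i, i ≤ N → i * g < n + g := by
    intro i hi
    have : N * g ≤ n + g - 1 := Nat.div_mul_le_self _ _
    have := Nat.mul_le_mul_right g hi
    omega
  have hNi : ∀ i, i ≤ N → i < n + g := fun i hi =>
    (Nat.le_mul_of_pos_right i hg).trans_lt (hNg i hi)
  have hcond : ∀ s', s'.reg 7 = g → s'.reg 5 = n → ∀ i ≤ N, s'.reg 10 = i →
      RamExpr.Bounded W s' (.op .lt (.op .mul (.var 10) (.var 7)) (.var 5)) ∧
      RamExpr.eval s' (.op .lt (.op .mul (.var 10) (.var 7)) (.var 5)) =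
        if i * g < n then 1 else 0 := by
    intro s' h7 h5 i hi h11
    have h1 := hNg i hi
    have h2 := hNi i hi
    simp only [RamExpr.Bounded, RamExpr.eval, WordOp.eval, h7, h5, h11, and_true]
    split_ifs <;> omega
  set B := 4000 * ((3 * g + 2) * (d + 1)) + 40 * tp + 1000 +
      N * (250 * ((g + 2) * (d + 1)) + 37 * tq + 410) with hB
  refine (achieves_seq (achieves_assign (Nat.zero_le _) ((achieves_whileNonzero
    (B := B + 4) N (fun i s' => LogExtends W s s' 0 ∧
      (∀ i, 5 ≤ i → i ≠ 9 → i ≠ 10 → i ≠ 11 → i ≠ 13 → i ≠ 14 → s'.reg i = s.reg i) ∧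
      s'.arr 0 = s.arr 0 ∧ s'.reg 10 = i ∧
      (s'.reg 0 ≠ 0 ↔ ∃ J < i, ∃ I, I * g < n ∧ O J I)) ?_ ?_ ?_).mono le_rfl ?_))).mono
      (B := 2 + (N * (6 + (B + 4)) + 6)) ?_ fun _ h => h
  · rintro i hi r ⟨k1, k2, k3, k5, k6⟩
    have hin := (mul_lt_iff_lt_ceilDiv hg i).mpr hi
    have hr : HoldsInstance r n d g x y := hs.congr (fun j hj => by
      fin_cases hj <;> exact k2 _ (by norm_num) (by norm_num) (by norm_num) (by norm_num)
        (by norm_num) (by norm_num)) k3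
    obtain ⟨hb, hv⟩ := hcond r hr.size hr.num i hi.le k5
    obtain ⟨t, u', e1, e2, e3⟩ := hex i hin
    refine ⟨hb, by simp [hv, hin], achieves_seq ((achieves_runGroup hσ hW hA hA' hr
      (k1.arr_two.trans h2) (k1.top.trans h1) hg hn k5 hin e1 e2 e3).mono le_rfl ?_)⟩
    rintro r' ⟨l1, l2, l3, l4⟩
    have r10 : r'.reg 10 = i := (l2 10 (by norm_num) (by norm_num) (by norm_num) (by norm_num)
      (by norm_num)).trans k5
    have hiN := hNi i hi.le
    refine achieves_assign ?_ ⟨?_, fun j h1 h2 h3 h4 h5 h6 => ?_, ?_, ?_, ?_⟩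
    · simp only [RamExpr.Bounded, RamExpr.eval, WordOp.eval, r10]; omega
    · exact (k1.trans l1).trans (.setReg (by norm_num))
    · rw [← k2 j h1 h2 h3 h4 h5 h6, ← l2 j h1 h2 h4 h5 h6]
      simp [RamState.setReg, h3]
    · exact l3.trans k3
    · simp [RamState.setReg, RamExpr.eval, WordOp.eval, r10]
    · have : ((r'.setReg 10 (RamExpr.eval r' (.op .add (.var 10) (.num 1)))).reg 0) = r'.reg 0 := by
        simp [RamState.setReg]
      rw [this, l4, k6]
      constructor
      · rintro (⟨J, h1, h2⟩ | h)
        · exact ⟨J, h1.trans (Nat.lt_succ_self i), h2⟩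
        · exact ⟨i, Nat.lt_succ_self i, h⟩
      · rintro ⟨J, h1, h2⟩
        rcases (Nat.lt_succ_iff.mp h1).lt_or_eq with h | rfl
        · exact .inl ⟨J, h, h2⟩
        · exact .inr h2
  · rintro r ⟨k1, k2, k3, k5, k6⟩
    obtain ⟨hb, hv⟩ := hcond r ((k2 7 (by norm_num) (by norm_num) (by norm_num) (by norm_num)
      (by norm_num) (by norm_num)).trans hs.size) ((k2 5 (by norm_num) (by norm_num) (by norm_num)
      (by norm_num) (by norm_num) (by norm_num)).trans hs.num) N le_rfl k5
    refine ⟨hb, hv.trans (if_neg ?_)⟩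
    rw [mul_lt_iff_lt_ceilDiv hg]
    exact lt_irrefl _
  · refine ⟨.of_eq (by simp [RamState.setReg]) fun _ _ => rfl, fun j _ _ h3 _ _ _ => ?_, rfl, ?_,
      ?_⟩
    · simp [RamState.setReg, h3]
    · simp [RamState.setReg, RamExpr.eval]
    · simp [RamState.setReg, h0]
  · rintro r ⟨k1, k2, k3, k5, k6⟩
    refine k6.trans (exists_congr fun J => ?_)
    rw [mul_lt_iff_lt_ceilDiv hg]
  · rw [show 6 + (B + 4) = B + 10 by ring, show 4000 * ((3 * g + 2) * (d + 1)) + 40 * tp + 1010 +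
      N * (250 * ((g + 2) * (d + 1)) + 37 * tq + 410) = B + 10 by rw [hB]; ring]
    omega

/-- Since the base is at least 1, the intermediate products do not exceed the final power, so they
fit into a word. -/
lemma powExpr_spec {e : RamExpr} {v k : ℕ} (hb : e.Bounded W s) (hv : e.eval s = v) (h1 : 1 ≤ v)
    (hk : v ^ k ≤ W) : (powExpr e k).Bounded W s ∧ (powExpr e k).eval s = v ^ k := by
  induction k with
  | zero => exact ⟨by simpa [powExpr, RamExpr.Bounded] using hk, by simp [powExpr, RamExpr.eval]⟩
  | succ k ih =>
    obtain ⟨i1, i2⟩ := ih ((Nat.pow_le_pow_right h1 (Nat.le_succ k)).trans hk)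
    have : WordOp.mul.eval ((powExpr e k).eval s) (e.eval s) = v ^ (k + 1) := by
      rw [i2, hv]; rfl
    exact ⟨⟨i1, hb, this.trans_le hk⟩, this⟩

lemma cost_powExpr (e : RamExpr) (k : ℕ) : (powExpr e k).cost = 1 + k * (e.cost + 1) := by
  induction k with
  | zero => simp [powExpr, RamExpr.cost]
  | succ k ih => simp only [powExpr, RamExpr.cost, ih]; ring

/-- The root is found by counting up from 1 as long as the power of the successor is at most `n`.
This takes `g - 1` rounds of cost `4 * k + 10`. -/
lemma achieves_setup {k : ℕ} (hn : s.arr 0 0 = n) (hd : s.arr 0 1 = d) (hg : 1 ≤ g)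
    (hgk : g ^ k ≤ n) (hkg : n < (g + 1) ^ k) (hW : (g + 1) ^ k ≤ W)
    (hW' : 60 * ((3 * g + 2) * (d + 1)) + n * d * 2 + n + 60 ≤ W)
    (vec_x : ∀ i < n, ∀ h < d, s.arr 0 (2 + i * d + h) = (x i h).toNat)
    (vec_y : ∀ j < n, ∀ h < d, s.arr 0 (2 + n * d + j * d + h) = (y j h).toNat) :
    Achieves W (setup k) (g * (4 * k + 10) + 50) s fun s' => HoldsInstance s' n d g x y ∧
      s'.reg 0 = s.reg 0 ∧ s'.reg 1 = s.reg 1 ∧ s'.arr = s.arr := by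
  have hdK : d + 1 ≤ (3 * g + 2) * (d + 1) := Nat.le_mul_of_pos_left _ (by omega)
  have hgK : 3 * g + 2 ≤ (3 * g + 2) * (d + 1) := Nat.le_mul_of_pos_right _ (by omega)
  have hMK : (g + 2) * (d + 1) ≤ (3 * g + 2) * (d + 1) := Nat.mul_le_mul_right _ (by omega)
  set c : RamExpr := .op .eq (.op .lt (.var 5) (powExpr (.op .add (.var 7) (.num 1)) k)) (.num 0)
  have hc : ∀ r : RamState, ∀ i, r.reg 5 = n → r.reg 7 = i → i ≤ g → c.Bounded W r ∧
      c.eval r = if n < (i + 1) ^ k then 0 else 1 := by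
    intro r i h5 h7 hi
    obtain ⟨p1, p2⟩ := powExpr_spec (W := W) (s := r) (e := .op .add (.var 7) (.num 1))
      (v := i + 1) (k := k)
      (by simp only [RamExpr.Bounded, RamExpr.eval, WordOp.eval, h7]; omega)
      (by simp [RamExpr.eval, WordOp.eval, h7]) (by omega)
      ((Nat.pow_le_pow_left (by omega) k).trans hW)
    simp only [c, RamExpr.Bounded, RamExpr.eval, WordOp.eval, h5, p1, p2, true_and]
    by_cases h : n < (i + 1) ^ k <;> simp [h] <;> omega
  refine (achieves_seq (achieves_assign ?_ (achieves_seq (achieves_assign ?_ (achieves_seq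
    (achieves_assign ?_ (achieves_seq ((achieves_whileNonzero (B := 4) (g - 1) (fun i r =>
      r.reg 7 = i + 1 ∧ r.reg 5 = n ∧ r.reg 6 = d ∧ r.reg 0 = s.reg 0 ∧ r.reg 1 = s.reg 1 ∧
      r.arr = s.arr) ?_ ?_ ?_).mono le_rfl ?_)))))))).mono
    (B := 3 + (3 + (2 + ((g - 1) * (c.cost + 1 + 4) + (c.cost + 1) + (4 + (8 + 6)))))) ?_
    fun _ h => h
  · simp only [RamExpr.Bounded, RamExpr.eval, hn]; omega
  · simp only [RamExpr.Bounded, RamExpr.eval, RamState.setReg, hd]; omega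
  · simp only [RamExpr.Bounded]; omega
  · rintro i hi r ⟨h7, h5, h6, h0, h1, ha⟩
    obtain ⟨b, v⟩ := hc r (i + 1) h5 h7 (by omega)
    have hle : ¬ n < (i + 1 + 1) ^ k :=
      not_lt.mpr ((Nat.pow_le_pow_left (by omega) k).trans hgk)
    refine ⟨b, fun h => ?_, achieves_assign ?_ ?_⟩
    · have := v.symm.trans h
      simp [hle] at this
    · simp only [RamExpr.Bounded, RamExpr.eval, WordOp.eval, h7]; omega
    · simp [RamState.setReg, RamExpr.eval, WordOp.eval, h7, h5, h6, h0, h1, ha]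
  · rintro r ⟨h7, h5, h6, h0, h1, ha⟩
    obtain ⟨b, v⟩ := hc r g h5 (by omega) le_rfl
    exact ⟨b, v.trans (if_pos hkg)⟩
  · simp [RamState.setReg, RamExpr.eval, hn, hd]
  · rintro r ⟨h7, h5, h6, h0, h1, ha⟩
    have h7 : r.reg 7 = g := by omega
    refine achieves_seq (achieves_assign ?_ (achieves_seq (achieves_assign ?_
      (achieves_assign ?_ ?_))))
    · simp only [RamExpr.Bounded, RamExpr.eval, WordOp.eval, h6]; omega
    · simp [RamExpr.Bounded, RamExpr.eval, WordOp.eval, RamState.setReg, h6, h7]; omega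
    · simp [RamExpr.Bounded, RamExpr.eval, WordOp.eval, RamState.setReg, h6, h7]; omega
    · refine ⟨⟨?_, ?_, ?_, ?_, ?_, ?_, ?_, ?_⟩, ?_, ?_, ha⟩
      · simpa [RamState.setReg] using h5
      · simpa [RamState.setReg] using h6
      · simpa [RamState.setReg] using h7
      · simp [RamState.setReg, RamExpr.eval, WordOp.eval, h6]
      · simp [RamState.setReg, RamExpr.eval, WordOp.eval, h6, h7]
      · simp [RamState.setReg, RamExpr.eval, WordOp.eval, h6, h7]
      · simpa only [RamState.setReg, ha] using vec_x
      · simpa only [RamState.setReg, ha] using vec_y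
      · simpa [RamState.setReg] using h0
      · simpa [RamState.setReg] using h1
  · have e : c.cost = 4 * k + 5 := by simp only [c, RamExpr.cost, cost_powExpr]; ring
    obtain ⟨g', rfl⟩ := Nat.exists_eq_add_of_le' hg
    rw [e, show g' + 1 - 1 = g' from rfl, show (g' + 1) * (4 * k + 10) = g' * (4 * k + 10) +
      (4 * k + 10) by ring, show 4 * k + 5 + 1 + 4 = 4 * k + 10 by ring]
    omega

/-- The running time and the answer of the program for Orthogonal Vectors. -/
lemma achieves_ovProgram {σ : ℕ} (hσ : 4 ≤ σ) {k : ℕ} (hW : WordBound W A V n d g tp tq)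
    (hA : query.names + 3 ≤ A) (hA' : pre.names + 3 ≤ A)
    (hn : s.arr 0 0 = n) (hd : s.arr 0 1 = d) (hg : 1 ≤ g)
    (hgk : g ^ k ≤ n) (hkg : n < (g + 1) ^ k) (hWk : (g + 1) ^ k ≤ W)
    (vec_x : ∀ i < n, ∀ h < d, s.arr 0 (2 + i * d + h) = (x i h).toNat)
    (vec_y : ∀ j < n, ∀ h < d, s.arr 0 (2 + n * d + j * d + h) = (y j h).toNat)
    (h2 : s.arr 2 = fun _ => 0) (h1 : s.reg 1 = 0) (h0 : s.reg 0 = 0) {O : ℕ → ℕ → Prop}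
    (hex : ∀ J, J * g < n → ∃ t u,
      RamExec V pre (RamState.init (blockGraph hσ (vectorKind d (groupVectors n g y J))
        ((3 * g + 2) * (d + 1))).encode) t u ∧ t ≤ tp ∧
      ∀ I, I * g < n → ∃ t u', RamExec V query
        (u.withQuery (queryWord d (groupVectors n g x I) (g + 2))) t u' ∧ t ≤ tq ∧
        (u'.reg 0 ≠ 0 ↔ O J I)) :
    Achieves W (ovProgram A k pre query) (g * (4 * k + 10) + 60 + (n + g - 1) / g *
      (4000 * ((3 * g + 2) * (d + 1)) + 40 * tp + 1010 +
        (n + g - 1) / g * (250 * ((g + 2) * (d + 1)) + 37 * tq + 410))) s fun s' =>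
      (s'.reg 0 ≠ 0 ↔ ∃ J, J * g < n ∧ ∃ I, I * g < n ∧ O J I) := by
  have hgK : 3 * g + 2 ≤ (3 * g + 2) * (d + 1) := Nat.le_mul_of_pos_right _ (by omega)
  have hW3 := hW.numbers
  refine (achieves_seq ((achieves_setup hn hd hg hgk hkg hWk hW3 vec_x vec_y).mono le_rfl ?_)).mono
    (B := g * (4 * k + 10) + 50 + ((n + g - 1) / g *
      (4000 * ((3 * g + 2) * (d + 1)) + 40 * tp + 1010 +
        (n + g - 1) / g * (250 * ((g + 2) * (d + 1)) + 37 * tq + 410)) + 8))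
    ?_ fun _ h => h
  · rintro s' ⟨i1, i2, i3, i4⟩
    exact achieves_runGroups hσ hW hA hA' i1 (by rw [i4, h2]) (i3.trans h1) (i2.trans h0) hg
      (by omega) hex
  · omega

end Main

/-! ### Correctness of the reduction -/

lemma length_flatten_ofFn_ofFn {α : Type*} {n d : ℕ} (f : Fin n → Fin d → α) :
    (List.ofFn fun i => List.ofFn fun h => f i h).flatten.length = n * d := by
  simp [List.length_flatten, List.map_ofFn, Function.comp_def]

lemma getD_flatten_ofFn_ofFn {n d : ℕ} (f : Fin n → Fin d → ℕ) {i h : ℕ} (hi : i < n)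
    (hh : h < d) :
    (List.ofFn fun i => List.ofFn fun h => f i h).flatten.getD (i * d + h) 0 =
      f ⟨i, hi⟩ ⟨h, hh⟩ := by
  have hlt : i * d + h < n * d := by
    have := Nat.mul_le_mul_right d (Nat.succ_le_iff.mpr hi)
    rw [Nat.succ_mul] at this
    omega
  have hdiv : ∀ i h, h < d → (i * d + h) / d = i ∧ (i * d + h) % d = h := by
    intro i h hh
    rw [mul_comm, Nat.mul_add_div (by omega), Nat.div_eq_of_lt hh, Nat.mul_add_mod,
      Nat.mod_eq_of_lt hh]
    simp
  have key : (List.ofFn fun i => List.ofFn fun h => f i h).flatten = List.ofFn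
      fun k : Fin (n * d) => f ⟨k / d, Nat.div_lt_of_lt_mul (k.2.trans_eq (mul_comm n d))⟩
        ⟨k % d, Nat.mod_lt _ (by omega)⟩ := by
    rw [List.ofFn_mul]
    congr 2
    funext i
    congr 1
    funext h
    congr 1 <;> apply Fin.ext
    · exact (hdiv i h h.2).1.symm
    · exact (hdiv i h h.2).2.symm
  rw [key, List.getD_eq_getElem _ _ (by simpa using hlt), List.getElem_ofFn]
  congr 1 <;> apply Fin.ext
  · exact (hdiv i h hh).1
  · exact (hdiv i h hh).2

/-- The entries of a family of binary vectors, extended by `false`. -/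
def extendVectors {n d : ℕ} (X : Fin n → Fin d → Bool) (i h : ℕ) : Bool :=
  if hi : i < n ∧ h < d then X ⟨i, hi.1⟩ ⟨h, hi.2⟩ else false

section EncodeOV

variable {n d : ℕ} (X Y : Fin n → Fin d → Bool)

lemma length_encodeOV : (encodeOV X Y).length = 2 * (n * d) + 2 := by
  rw [encodeOV, List.length_append, List.length_append, length_flatten_ofFn_ofFn,
    length_flatten_ofFn_ofFn]
  simp; ring

lemma encodeOV_getD_left {i h : ℕ} (hi : i < n) (hh : h < d) :
    (encodeOV X Y).getD (2 + i * d + h) 0 = (extendVectors X i h).toNat := by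
  have hlt : i * d + h < n * d := by
    have := Nat.mul_le_mul_right d (Nat.succ_le_iff.mpr hi)
    rw [Nat.succ_mul] at this
    omega
  rw [encodeOV, List.append_assoc, List.getD_append_right _ _ _ _ (by simp; omega),
    List.getD_append _ _ _ _ (by rw [length_flatten_ofFn_ofFn]; simp; omega)]
  have e : 2 + i * d + h - [n, d].length = i * d + h := by simp; omega
  rw [e, getD_flatten_ofFn_ofFn (fun i h => (X i h).toNat) hi hh]
  simp [extendVectors, hi, hh]

lemma encodeOV_getD_right {j h : ℕ} (hj : j < n) (hh : h < d) :
    (encodeOV X Y).getD (2 + n * d + j * d + h) 0 = (extendVectors Y j h).toNat := by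
  rw [encodeOV, List.getD_append_right _ _ _ _
    (by rw [List.length_append, length_flatten_ofFn_ofFn]; simp; omega)]
  have e : 2 + n * d + j * d + h - ([n, d] ++ (List.ofFn fun i => List.ofFn fun h =>
      (X i h).toNat).flatten).length = j * d + h := by
    rw [List.length_append, length_flatten_ofFn_ofFn]; simp; omega
  rw [e, getD_flatten_ofFn_ofFn (fun i h => (Y i h).toNat) hj hh]
  simp [extendVectors, hj, hh]

lemma hasOrthogonalPair_iff : HasOrthogonalPair X Y ↔ ∃ i < n, ∃ j < n, ∀ h < d,
    ¬ (extendVectors X i h = true ∧ extendVectors Y j h = true) := by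
  have key : ∀ i j, (∑ h, (X i h).toNat * (Y j h).toNat = 0) ↔ ∀ h < d,
      ¬ (extendVectors X i h = true ∧ extendVectors Y j h = true) := by
    intro i j
    rw [Finset.sum_eq_zero_iff]
    constructor
    · intro H h hh
      have := H ⟨h, hh⟩ (Finset.mem_univ _)
      simp only [extendVectors, i.2, j.2, hh, and_self, dif_pos]
      rintro ⟨h1, h2⟩
      rw [Fin.eta] at h1 h2
      simp [h1, h2] at this
    · intro H h _
      have := H h h.2
      simp only [extendVectors, i.2, j.2, h.2, and_self, dif_pos, Fin.eta] at this
      cases h1 : X i h <;> cases h2 : Y j h <;> simp_all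
  constructor
  · rintro ⟨i, j, hij⟩
    exact ⟨i, i.2, j, j.2, (key i j).mp hij⟩
  · rintro ⟨i, hi, j, hj, hij⟩
    exact ⟨⟨i, hi⟩, ⟨j, hj⟩, (key ⟨i, hi⟩ ⟨j, hj⟩).mpr hij⟩

end EncodeOV

/-- Two families contain an orthogonal pair if and only if for two of their groups the query occurs
in the graph. -/
lemma exists_occurs_iff {σ : ℕ} (hσ : 4 ≤ σ) {n d g : ℕ} (hd : 1 ≤ d) (hg : 1 ≤ g) (hgn : g ≤ n)
    (x y : ℕ → ℕ → Bool) :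
    (∃ J, J * g < n ∧ ∃ I, I * g < n ∧
      (blockGraph hσ (vectorKind d (groupVectors n g y J)) ((3 * g + 2) * (d + 1))).Occurs
        ((queryWord d (groupVectors n g x I) (g + 2)).map (letter hσ))) ↔
    ∃ i < n, ∃ j < n, ∀ h < d, ¬ (x i h = true ∧ y j h = true) := by
  constructor
  -- Periodic continuation only repeats vectors of the instance, so a pair found at any positions is
  -- a pair of the instance.
  · rintro ⟨J, -, I, -, hocc⟩
    obtain ⟨i, j, hij⟩ := exists_orthogonal_of_occurs hσ hd (by omega) hocc
    exact ⟨_, Nat.mod_lt (I * g + i) (by omega), _, Nat.mod_lt (J * g + j) (by omega), hij⟩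
  · rintro ⟨i, hi, j, hj, hij⟩
    -- A query tests the inner positions `1, …, g` of its `g + 2` vectors, hence the cyclic shift by
    -- one.
    obtain ⟨i', hi1, hi2, hi3⟩ : ∃ i', i' < n ∧ 0 ≤ i' ∧ (i' + 1) % n = i := by
      rcases i with _ | i
      · exact ⟨n - 1, by omega, by omega, by rw [Nat.sub_add_cancel (by omega), Nat.mod_self]⟩
      · exact ⟨i, by omega, by omega, Nat.mod_eq_of_lt hi⟩
    -- In the graph of `3 * g + 2` vectors the positions `g, …, 2 * g - 1` leave enough room on both
    -- sides for every alignment of the query, hence the cyclic shift by `g`.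
    obtain ⟨j', hj1, hj3⟩ : ∃ j', j' < n ∧ (j' + g) % n = j := by
      by_cases h : g ≤ j
      · exact ⟨j - g, by omega, by rw [Nat.sub_add_cancel h, Nat.mod_eq_of_lt hj]⟩
      · refine ⟨j + n - g, by omega, ?_⟩
        rw [Nat.sub_add_cancel (by omega), Nat.add_mod_right, Nat.mod_eq_of_lt hj]
    have hir := Nat.mod_lt i' (show g > 0 by omega)
    have hjr := Nat.mod_lt j' (show g > 0 by omega)
    have hidiv := Nat.div_add_mod' i' g
    have hjdiv := Nat.div_add_mod' j' g
    refine ⟨j' / g, by omega, i' / g, by omega, occurs_of_orthogonal hσ (i := i' % g + 1)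
      (j := j' % g + g) hd (by omega) (by omega) (by omega) (by omega) ?_⟩
    intro h hh
    simp only [groupVectors, ← add_assoc, hidiv, hjdiv, hi3, hj3]
    exact hij h hh

lemma exists_root {n k : ℕ} (hn : 1 ≤ n) (hk : 1 ≤ k) :
    ∃ g, 1 ≤ g ∧ g ^ k ≤ n ∧ n < (g + 1) ^ k := by
  have hex : ∃ g, n < (g + 1) ^ k :=
    ⟨n, (Nat.lt_succ_self n).trans_le (Nat.le_self_pow (by omega) _)⟩
  have h1 : 1 ≤ Nat.find hex := by
    rw [Nat.one_le_iff_ne_zero]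
    intro h0
    have := Nat.find_spec hex
    rw [h0] at this
    simp at this
    omega
  refine ⟨Nat.find hex, h1, ?_, Nat.find_spec hex⟩
  have := Nat.find_min hex (m := Nat.find hex - 1) (by omega)
  rwa [Nat.sub_add_cancel h1, not_lt] at this

/-! ### The bounds on words and time -/

/-- All quantities are at most powers of `N = 2 * (n * d) + 4`, with exponents that do not depend on
the instance; constants are absorbed by `i ≤ N ^ i`. The base of `V` bounds the lengths of encoding
and query plus 2. Its exponent is `c + 1` so that `V` exceeds the length of a query even if `c = 0`.
-/
lemma exists_wordBound (A c C a k : ℕ) : ∃ c', ∀ n d g tp tq : ℕ, 1 ≤ n → 1 ≤ d → 1 ≤ g → g ≤ n →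
    tp ≤ C * (120 * (g * d)) ^ a → tq ≤ 2 * C * (120 * (g * d)) ^ 2 →
    WordBound ((2 * (n * d) + 2 + 2) ^ c') A
      ((50 * ((3 * g + 2) * (d + 1)) + 3 * ((g + 2) * (d + 1)) + 9) ^ (c + 1)) n d g tp tq ∧
    (g + 1) ^ k ≤ (2 * (n * d) + 2 + 2) ^ c' := by
  refine ⟨5 * (c + 1) + 20 + 2 * A + 3 * C + 4 * a + k, fun n d g tp tq hn hd hg hgn htp htq => ?_⟩
  have hMK : (g + 2) * (d + 1) ≤ (3 * g + 2) * (d + 1) := Nat.mul_le_mul_right _ (by omega)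
  have hgd : g * d ≤ n * d := Nat.mul_le_mul_right _ hgn
  have hgd1 : 1 ≤ g * d := Nat.mul_pos hg hd
  have hnd : n ≤ n * d := Nat.le_mul_of_pos_right _ hd
  have hK : (3 * g + 2) * (d + 1) ≤ 10 * (g * d) := by nlinarith
  set K := (3 * g + 2) * (d + 1) with hKdef
  set M := (g + 2) * (d + 1) with hMdef
  obtain ⟨N, hN⟩ : ∃ N, N = 2 * (n * d) + 2 + 2 := ⟨_, rfl⟩
  rw [← hN]
  have hN6 : 6 ≤ N := by omega
  have pw : ∀ {i j : ℕ}, i ≤ j → N ^ i ≤ N ^ j := fun h => Nat.pow_le_pow_right (by omega) h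
  have self : ∀ i, i ≤ N ^ i := fun i => (Nat.lt_pow_self (by omega)).le
  -- The factor 312 is at most `6 ^ 4`, and `312 * N` exceeds all the linear bounds below.
  have h5 : 312 * N ≤ N ^ 5 := by
    have : 6 ^ 4 ≤ N ^ 4 := Nat.pow_le_pow_left hN6 4
    rw [pow_succ]; nlinarith
  have hZ : 120 * (g * d) ≤ N ^ 4 := by
    have : 6 ^ 3 ≤ N ^ 3 := Nat.pow_le_pow_left hN6 3
    rw [pow_succ]; nlinarith
  have hV : (50 * K + 3 * M + 9) ^ (c + 1) + 1 ≤ N ^ (5 * (c + 1) + 1) := by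
    have h1 : (50 * K + 3 * M + 9) ^ (c + 1) ≤ N ^ (5 * (c + 1)) := by
      rw [pow_mul]; exact Nat.pow_le_pow_left (by omega) _
    have h2 : 1 ≤ N ^ (5 * (c + 1)) := Nat.one_le_pow _ _ (by omega)
    exact (show _ ≤ N ^ (5 * (c + 1)) * 2 by omega).trans (Nat.mul_le_mul_left _ (by omega))
  have htp' : tp ≤ N ^ (C + 4 * a) := by
    rw [pow_add, pow_mul]
    exact htp.trans (Nat.mul_le_mul (self C) (Nat.pow_le_pow_left hZ _))
  have htq' : tq ≤ N ^ (2 * C + 8) := by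
    rw [pow_add, show N ^ 8 = (N ^ 4) ^ 2 by rw [← pow_mul]]
    exact htq.trans (Nat.mul_le_mul (self _) (Nat.pow_le_pow_left hZ _))
  refine ⟨⟨?_, ?_, ?_, ?_, ?_, ?_⟩, ?_⟩
  · calc A * A ≤ N ^ A * N ^ A := Nat.mul_le_mul (self A) (self A)
      _ = N ^ (A + A) := (pow_add _ _ _).symm
      _ ≤ _ := pw (by omega)
  · calc _ ≤ N ^ (5 * (c + 1) + 1) * N ^ A := Nat.mul_le_mul hV (self A)
      _ = N ^ (5 * (c + 1) + 1 + A) := (pow_add _ _ _).symm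
      _ ≤ _ := pw (by omega)
  · exact (show _ ≤ N ^ 5 by omega).trans (pw (by omega))
  · calc _ ≤ N ^ 5 * N ^ A := Nat.mul_le_mul (by omega) (self A)
      _ = N ^ (5 + A) := (pow_add _ _ _).symm
      _ ≤ _ := pw (by omega)
  · have h1 : tp ≤ N ^ (13 + 3 * C + 4 * a) := htp'.trans (pw (by omega))
    have h2 : tq ≤ N ^ (13 + 3 * C + 4 * a) := htq'.trans (pw (by omega))
    have h3 : 54 * K + 20 ≤ N ^ (13 + 3 * C + 4 * a) :=
      (show _ ≤ N ^ 5 by omega).trans (pw (by omega))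
    calc _ ≤ N ^ (13 + 3 * C + 4 * a) * 6 := by omega
      _ ≤ N ^ (13 + 3 * C + 4 * a) * N := Nat.mul_le_mul_left _ hN6
      _ = N ^ (13 + 3 * C + 4 * a + 1) := (pow_succ _ _).symm
      _ ≤ _ := pw (by omega)
  · rw [pow_succ]
    exact (show 3 * M + 5 ≤ 50 * K + 3 * M + 9 by omega).trans
      (Nat.le_mul_of_pos_left _ (Nat.pow_pos (by omega)))
  · exact (Nat.pow_le_pow_left (by omega) k).trans (pw (by omega))

/-- The cost of the preprocessings: `g ≤ n ^ (1 / k)` and `α ≤ k / 2` give `g ^ α ≤ n ^ (1 / 2)`. -/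
lemma rpow_group_le {n g k : ℕ} {α : ℝ} (hg : 1 ≤ g) (hk : 2 * α ≤ k) (hgk : g ^ k ≤ n) :
    (n : ℝ) * (g : ℝ) ^ α ≤ (n : ℝ) ^ (3 / 2 : ℝ) := by
  have hg' : (1 : ℝ) ≤ g := by exact_mod_cast hg
  have hn : (0 : ℝ) < n := by
    have : 0 < n := (Nat.pow_pos hg).trans_le hgk
    exact_mod_cast this
  have h1 : (g : ℝ) ^ α ≤ (n : ℝ) ^ (1 / 2 : ℝ) := by
    calc (g : ℝ) ^ α ≤ (g : ℝ) ^ ((k : ℝ) * (1 / 2)) :=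
          Real.rpow_le_rpow_of_exponent_le hg' (by linarith)
      _ = ((g : ℝ) ^ k) ^ (1 / 2 : ℝ) := by rw [Real.rpow_mul (by linarith), Real.rpow_natCast]
      _ ≤ _ := Real.rpow_le_rpow (by positivity) (by exact_mod_cast hgk) (by norm_num)
  calc _ ≤ (n : ℝ) * (n : ℝ) ^ (1 / 2 : ℝ) := by gcongr
    _ = (n : ℝ) ^ (1 + 1 / 2 : ℝ) := by rw [Real.rpow_add hn, Real.rpow_one]
    _ = _ := by norm_num

/-- The cost of the queries: `r ≤ 2 n / g` gives at most `4 n ^ 2 / g ^ (2 - η)`, and `n < (2 g) ^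
k` turns the denominator into a power of `n`, up to the factor 4. -/
lemma sq_mul_rpow_group_le {n g k r : ℕ} {η ε : ℝ} (hn : 1 ≤ n) (hg : 1 ≤ g) (hk : 1 ≤ k)
    (hη : 1 ≤ η) (hη2 : η < 2) (hε : ε ≤ (2 - η) / k) (hgk : n < (g + 1) ^ k)
    (hr : r * g ≤ 2 * n) :
    (r : ℝ) ^ 2 * (g : ℝ) ^ η ≤ 16 * (n : ℝ) ^ (2 - ε) := by
  have hg' : (1 : ℝ) ≤ g := by exact_mod_cast hg
  have hn' : (1 : ℝ) ≤ n := by exact_mod_cast hn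
  have hk' : (0 : ℝ) < k := by exact_mod_cast hk
  have h1 : (n : ℝ) ^ ε ≤ 4 * (g : ℝ) ^ (2 - η) := by
    have h2 : (n : ℝ) ≤ (2 * g : ℝ) ^ k := by
      have : n ≤ (2 * g) ^ k := hgk.le.trans (Nat.pow_le_pow_left (by omega) k)
      exact_mod_cast this
    calc (n : ℝ) ^ ε ≤ (n : ℝ) ^ ((2 - η) / k) := Real.rpow_le_rpow_of_exponent_le hn' hε
      _ ≤ ((2 * g : ℝ) ^ k) ^ ((2 - η) / k) :=
          Real.rpow_le_rpow (by linarith) h2 (div_nonneg (by linarith) hk'.le)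
      _ = (2 * g : ℝ) ^ (2 - η) := by
          rw [← Real.rpow_natCast, ← Real.rpow_mul (by linarith)]
          congr 1; field_simp
      _ = (2 : ℝ) ^ (2 - η) * (g : ℝ) ^ (2 - η) := Real.mul_rpow (by norm_num) (by linarith)
      _ ≤ (2 : ℝ) ^ (2 : ℝ) * (g : ℝ) ^ (2 - η) := by
          gcongr
          · norm_num
          · linarith
      _ = _ := by norm_num
  have hpos : (0 : ℝ) < (n : ℝ) ^ ε := Real.rpow_pos_of_pos (by linarith) _
  have hrg : (r : ℝ) * g ≤ 2 * n := by exact_mod_cast hr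
  refine le_of_mul_le_mul_right ?_ hpos
  calc (r : ℝ) ^ 2 * (g : ℝ) ^ η * (n : ℝ) ^ ε
      ≤ (r : ℝ) ^ 2 * (g : ℝ) ^ η * (4 * (g : ℝ) ^ (2 - η)) := by gcongr
    _ = 4 * (r : ℝ) ^ 2 * ((g : ℝ) ^ η * (g : ℝ) ^ (2 - η)) := by ring
    _ = 4 * ((r : ℝ) * g) ^ 2 := by
        rw [← Real.rpow_add (by linarith), show η + (2 - η) = ((2 : ℕ) : ℝ) by norm_num,
          Real.rpow_natCast]
        ring
    _ ≤ 4 * (2 * n) ^ 2 := by gcongr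
    _ = 16 * ((n : ℝ) ^ (2 - ε) * (n : ℝ) ^ ε) := by
        rw [← Real.rpow_add (by linarith), show 2 - ε + ε = ((2 : ℕ) : ℝ) by norm_num,
          Real.rpow_natCast]
        ring
    _ = _ := by ring

/-- The three summands are the setup, the work per graph and the work per pair of groups. As `α` and
`η` are at least 1, the linear costs of writing and copying are absorbed by the bounds for `tp` and
`tq`. Then `(120 g d) ^ z` is split; the power of `d` goes into the polynomial factor, and the power
of `g` is handled by the two preceding lemmas. -/
lemma time_ovProgram_le {n d g k e tp tq : ℕ} {α η ε C : ℝ} (hC : 0 ≤ C) (hn : 1 ≤ n) (hd : 1 ≤ d)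
    (hg : 1 ≤ g) (hk : 1 ≤ k) (hgk : g ^ k ≤ n) (hkg : n < (g + 1) ^ k) (hα : 1 ≤ α)
    (hαk : 2 * α ≤ k) (hαe : α ≤ e) (hη : 1 ≤ η) (hη2 : η < 2) (he : 2 ≤ e)
    (hε : ε ≤ 1 / 2) (hε' : ε ≤ (2 - η) / k)
    (htp : (tp : ℝ) ≤ C * (120 * (g * d) : ℝ) ^ α)
    (htq : (tq : ℝ) ≤ 2 * C * (120 * (g * d) : ℝ) ^ η) :
    ((g * (4 * k + 10) + 60 +
      (n + g - 1) / g * (4000 * ((3 * g + 2) * (d + 1)) + 40 * tp + 1010 +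
        (n + g - 1) / g * (250 * ((g + 2) * (d + 1)) + 37 * tq + 410)) : ℕ) : ℝ) ≤
    (4 * k + 70 + (400 + 40 * C) * 120 ^ α * 2 + (16 + 74 * C) * 120 ^ η * 16) *
      (d : ℝ) ^ e * (n : ℝ) ^ (2 - ε) := by
  have hgn : g ≤ n := (Nat.le_self_pow (by omega) g).trans hgk
  have hr : (n + g - 1) / g * g ≤ 2 * n := (Nat.div_mul_le_self _ _).trans (by omega)
  generalize (n + g - 1) / g = r at *
  have hr1 : r ≤ 2 * n := le_trans (Nat.le_mul_of_pos_right _ hg) hr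
  have hg' : (1 : ℝ) ≤ g := by exact_mod_cast hg
  have hd' : (1 : ℝ) ≤ d := by exact_mod_cast hd
  have hn' : (1 : ℝ) ≤ n := by exact_mod_cast hn
  have hgn' : (g : ℝ) ≤ n := by exact_mod_cast hgn
  have hr1' : (r : ℝ) ≤ 2 * n := by exact_mod_cast hr1
  have hgd : (1 : ℝ) ≤ g * d := one_le_mul_of_one_le_of_one_le hg' hd'
  have hZ : (1 : ℝ) ≤ 120 * (g * d) := by linarith
  have split : ∀ z : ℝ, (120 * (g * d) : ℝ) ^ z = 120 ^ z * ((g : ℝ) ^ z * (d : ℝ) ^ z) := by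
    intro z
    rw [Real.mul_rpow (by norm_num) (by positivity), Real.mul_rpow (by positivity) (by positivity)]
  have hde : ∀ z : ℝ, z ≤ e → (d : ℝ) ^ z ≤ (d : ℝ) ^ e := by
    intro z hz
    rw [← Real.rpow_natCast]
    exact Real.rpow_le_rpow_of_exponent_le hd' hz
  have hde1 : (1 : ℝ) ≤ (d : ℝ) ^ e := one_le_pow₀ hd'
  have hnp : (n : ℝ) ≤ (n : ℝ) ^ (2 - ε) := by
    conv_lhs => rw [← Real.rpow_one (n : ℝ)]
    exact Real.rpow_le_rpow_of_exponent_le hn' (by linarith)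
  have hself : ∀ z : ℝ, 1 ≤ z → (120 * (g * d) : ℝ) ≤ (120 * (g * d) : ℝ) ^ z := by
    intro z hz
    conv_lhs => rw [← Real.rpow_one (120 * (g * d) : ℝ)]
    exact Real.rpow_le_rpow_of_exponent_le hZ hz
  -- With `(3 g + 2) (d + 1) ≤ 10 g d` the terms without `tp` are at most `41010 g d`, which is
  -- below `400 * 120 g d`.
  have hB1 : (4000 * ((3 * g + 2) * (d + 1)) + 40 * tp + 1010 : ℝ) ≤
      (400 + 40 * C) * (120 * (g * d) : ℝ) ^ α := by
    have := hself α hα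
    nlinarith
  -- With `(g + 2) (d + 1) ≤ 6 g d` the terms without `tq` are at most `1910 g d`, which is below
  -- `16 * 120 g d`.
  have hB2 : (250 * ((g + 2) * (d + 1)) + 37 * tq + 410 : ℝ) ≤
      (16 + 74 * C) * (120 * (g * d) : ℝ) ^ η := by
    have := hself η hη
    nlinarith
  have hT1 : (g * (4 * k + 10) + 60 : ℝ) ≤ (4 * k + 70) * ((d : ℝ) ^ e * (n : ℝ) ^ (2 - ε)) := by
    have h1 : (g * (4 * k + 10) + 60 : ℝ) ≤ (4 * k + 70) * n := by
      have : (g : ℝ) * (4 * k + 10) ≤ n * (4 * k + 10) := by gcongr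
      linarith
    refine h1.trans (mul_le_mul_of_nonneg_left ?_ (by positivity))
    exact hnp.trans (le_mul_of_one_le_left (by positivity) hde1)
  have hT2 : (r : ℝ) * (4000 * ((3 * g + 2) * (d + 1)) + 40 * tp + 1010) ≤
      (400 + 40 * C) * 120 ^ α * 2 * ((d : ℝ) ^ e * (n : ℝ) ^ (2 - ε)) := by
    have h1 : (n : ℝ) * (g : ℝ) ^ α ≤ (n : ℝ) ^ (2 - ε) := (rpow_group_le hg hαk hgk).trans
      (Real.rpow_le_rpow_of_exponent_le hn' (by linarith))
    calc _ ≤ (2 * n : ℝ) * ((400 + 40 * C) * (120 * (g * d) : ℝ) ^ α) := by gcongr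
      _ = (400 + 40 * C) * 120 ^ α * 2 * ((d : ℝ) ^ α * (n * (g : ℝ) ^ α)) := by rw [split]; ring
      _ ≤ _ := by gcongr; exact hde α hαe
  have hT3 : (r : ℝ) ^ 2 * (250 * ((g + 2) * (d + 1)) + 37 * tq + 410) ≤
      (16 + 74 * C) * 120 ^ η * 16 * ((d : ℝ) ^ e * (n : ℝ) ^ (2 - ε)) := by
    have h1 := sq_mul_rpow_group_le hn hg hk hη hη2 hε' hkg hr
    have he' : (2 : ℝ) ≤ e := by exact_mod_cast he
    calc _ ≤ (r : ℝ) ^ 2 * ((16 + 74 * C) * (120 * (g * d) : ℝ) ^ η) := by gcongr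
      _ = (16 + 74 * C) * 120 ^ η * ((d : ℝ) ^ η * ((r : ℝ) ^ 2 * (g : ℝ) ^ η)) := by
          rw [split]; ring
      _ ≤ (16 + 74 * C) * 120 ^ η * ((d : ℝ) ^ e * (16 * (n : ℝ) ^ (2 - ε))) := by
          gcongr; exact hde η (by linarith)
      _ = _ := by ring
  push_cast
  calc _ = (g * (4 * k + 10) + 60 : ℝ) +
        (r : ℝ) * (4000 * ((3 * g + 2) * (d + 1)) + 40 * tp + 1010) +
        (r : ℝ) ^ 2 * (250 * ((g + 2) * (d + 1)) + 37 * tq + 410) := by ring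
    _ ≤ _ := add_le_add (add_le_add hT1 hT2) hT3
    _ = _ := by ring

/-! ### The choice of the parameters and the conclusion -/

lemma mul_rpow_le_rpow_max {E q Z β δ : ℝ} (hE : 0 ≤ E) (hq : 0 ≤ q) (hEZ : E ≤ Z) (hqZ : q ≤ Z)
    (hZ : 1 ≤ Z) (hβ : 0 < β) (hδ : 0 < δ) :
    q + E ^ δ * q ^ β ≤ 2 * Z ^ max 1 (β + δ) := by
  have h1 : q ≤ Z ^ max 1 (β + δ) := by
    calc q ≤ Z ^ (1 : ℝ) := by rwa [Real.rpow_one]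
      _ ≤ _ := Real.rpow_le_rpow_of_exponent_le hZ (le_max_left _ _)
  have h2 : E ^ δ * q ^ β ≤ Z ^ max 1 (β + δ) := by
    calc E ^ δ * q ^ β ≤ Z ^ δ * Z ^ β := by gcongr
      _ = Z ^ (δ + β) := (Real.rpow_add (by linarith) _ _).symm
      _ ≤ _ := Real.rpow_le_rpow_of_exponent_le hZ (by rw [add_comm]; exact le_max_right _ _)
  linarith

theorem mainTheorem2 (hOVH : OVH) (α β δ : ℝ) (hα : 0 < α) (hβ : 0 < β) (hδ : 0 < δ)
    (hβδ : β + δ < 2) (σ : ℕ) (hσ : 4 ≤ σ) (L : ℕ∞) (hL : 4 ≤ L) :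
    ¬ ∃ pre query : RamProgram, IndexesEFGs σ L α β δ pre query := by
  rintro ⟨pre, query, C, c, hix⟩
  obtain ⟨C', hC'⟩ := exists_nat_ge C
  obtain ⟨e, he⟩ := exists_nat_ge (max α 2)
  -- The exponents are raised to at least 1, which leaves `η < 2`, so that they also cover the
  -- linear overhead.
  obtain ⟨α', hα'⟩ : ∃ α', α' = max α 1 := ⟨_, rfl⟩
  obtain ⟨η, hη⟩ : ∃ η, η = max 1 (β + δ) := ⟨_, rfl⟩
  have hα1 : 1 ≤ α' := hα' ▸ le_max_right _ _
  have hαα : α ≤ α' := hα' ▸ le_max_left _ _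
  have hη1 : 1 ≤ η := hη ▸ le_max_left _ _
  have hη2 : η < 2 := hη ▸ max_lt (by norm_num) hβδ
  have he2 : 2 ≤ e := by
    have := (le_max_right _ _).trans he
    exact_mod_cast this
  have hαe : α' ≤ e := hα' ▸ max_le ((le_max_left _ _).trans he)
    (le_trans (by norm_num) ((le_max_right _ _).trans he))
  -- This `k` is at least `2 α'`, as needed to bound all preprocessings by `n ^ (3 / 2)`; the first
  -- term of the minimum in `ε` below belongs to them, the second to the queries.
  obtain ⟨k, hkdef⟩ : ∃ k, k = 2 * e := ⟨_, rfl⟩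
  have hk : 1 ≤ k := by omega
  have hαk : 2 * α' ≤ k := by rw [hkdef]; push_cast; linarith
  have hk' : (0 : ℝ) < k := by exact_mod_cast hk
  obtain ⟨ε, hεdef⟩ : ∃ ε : ℝ, ε = min (1 / 2) ((2 - η) / k) := ⟨_, rfl⟩
  have hε : 0 < ε := hεdef ▸ lt_min (by norm_num) (div_pos (by linarith) hk')
  obtain ⟨A, hA⟩ : ∃ A, A = pre.names + query.names + 3 := ⟨_, rfl⟩
  obtain ⟨c', hc'⟩ := exists_wordBound A c C' e k
  refine hOVH ε hε ⟨ovProgram A k pre query, 4 * k + 70 + (400 + 40 * C') * 120 ^ α' * 2 +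
    (16 + 74 * C') * 120 ^ η * 16, e, c', fun n d hn hd X Y => ?_⟩
  obtain ⟨g, hg, hgk, hkg⟩ := exists_root hn hk
  have hgn : g ≤ n := (Nat.le_self_pow (by omega) g).trans hgk
  have hgd : 1 ≤ g * d := Nat.mul_pos hg hd
  have hZ : (1 : ℝ) ≤ 120 * (g * d) := by
    have : 1 ≤ 120 * (g * d) := by omega
    exact_mod_cast this
  -- Integer bounds for the running times of `pre` and `query`: both the number of edges and the
  -- length of a query are at most `120 * (g * d)`.
  obtain ⟨tp, htp⟩ : ∃ tp, tp = ⌊C' * (120 * (g * d) : ℝ) ^ α'⌋₊ := ⟨_, rfl⟩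
  obtain ⟨tq, htq⟩ : ∃ tq, tq = ⌊2 * C' * (120 * (g * d) : ℝ) ^ η⌋₊ := ⟨_, rfl⟩
  have htp_le : (tp : ℝ) ≤ C' * (120 * (g * d) : ℝ) ^ α' := htp ▸ Nat.floor_le (by positivity)
  have htq_le : (tq : ℝ) ≤ 2 * C' * (120 * (g * d) : ℝ) ^ η := htq ▸ Nat.floor_le (by positivity)
  have htp_nat : tp ≤ C' * (120 * (g * d)) ^ e := by
    have : (tp : ℝ) ≤ C' * (120 * (g * d) : ℝ) ^ e := by
      refine htp_le.trans ?_
      gcongr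
      rw [← Real.rpow_natCast]
      exact Real.rpow_le_rpow_of_exponent_le hZ hαe
    exact_mod_cast this
  have htq_nat : tq ≤ 2 * C' * (120 * (g * d)) ^ 2 := by
    have : (tq : ℝ) ≤ 2 * C' * (120 * (g * d) : ℝ) ^ 2 := by
      refine htq_le.trans ?_
      gcongr
      rw [← Real.rpow_natCast]
      exact Real.rpow_le_rpow_of_exponent_le hZ (by push_cast; linarith)
    exact_mod_cast this
  obtain ⟨hW, hWk⟩ := hc' n d g tp tq hn hd hg hgn htp_nat htq_nat
  have hK : (3 * g + 2) * (d + 1) ≤ 10 * (g * d) := by nlinarith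
  have hMK : (g + 2) * (d + 1) ≤ (3 * g + 2) * (d + 1) := Nat.mul_le_mul_right _ (by omega)
  have hM6 : 6 ≤ (g + 2) * (d + 1) := by nlinarith
  have hlen : (encodeOV X Y).length + 2 = 2 * (n * d) + 2 + 2 := by rw [length_encodeOV]
  rw [hlen]
  obtain ⟨t, m', s', hexec, ht, hrep, hans⟩ := achieves_ovProgram (pre := pre) (query := query) hσ hW (by omega) (by omega)
    (s := RamState.init (encodeOV X Y)) (x := extendVectors X) (y := extendVectors Y)
    (by simp [RamState.init, encodeOV]) (by simp [RamState.init, encodeOV]) hg hgk hkg hWk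
    (fun i hi h hh => by simpa [RamState.init] using encodeOV_getD_left X Y hi hh)
    (fun j hj h hh => by simpa [RamState.init] using encodeOV_getD_right X Y hj hh)
    (by funext i; simp [RamState.init]) rfl rfl
    (O := fun J I => (blockGraph hσ (vectorKind d (groupVectors n g (extendVectors Y) J))
      ((3 * g + 2) * (d + 1))).Occurs
        ((queryWord d (groupVectors n g (extendVectors X) I) (g + 2)).map (letter hσ)))
    (fun J _ => by
      have hlenG := length_encode_blockGraph_le hσ
        (vectorKind d (groupVectors n g (extendVectors Y) J)) ((3 * g + 2) * (d + 1))
      have hedges := numEdges_blockGraph hσ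
        (vectorKind d (groupVectors n g (extendVectors Y) J)) ((3 * g + 2) * (d + 1))
      obtain ⟨t, u, hexec, ht, hquery⟩ := hix _ (blockGraph_isElasticFounderGraph hσ
        (vectorKind d (groupVectors n g (extendVectors Y) J)) ((3 * g + 2) * (d + 1))
        (vectorKind_ne_none hd _)) (by rw [hedges]; omega) (fun v => le_trans
          (by exact_mod_cast label_blockGraph_length_le hσ _ _ v) hL)
      have hE : ((blockGraph hσ (vectorKind d (groupVectors n g (extendVectors Y) J))
          ((3 * g + 2) * (d + 1))).numEdges : ℝ) ≤ 120 * (g * d) := by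
        rw [hedges]
        have : 12 * ((3 * g + 2) * (d + 1) - 1) ≤ 120 * (g * d) := by omega
        exact_mod_cast this
      refine ⟨t, u, ramExec_mono hexec ?_, ?_, fun I _ => ?_⟩
      · exact (Nat.pow_le_pow_right (by omega) (Nat.le_succ c)).trans
          (Nat.pow_le_pow_left (by omega) _)
      · refine htp ▸ Nat.le_floor (ht.trans ?_)
        calc _ ≤ (C' : ℝ) * (120 * (g * d) : ℝ) ^ α := by gcongr
          _ ≤ _ := by gcongr
      · have hQ := map_val_map_letter hσ
          (queryWord_lt_four d (groupVectors n g (extendVectors X) I) (g + 2))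
        have hQl := length_queryWord d (groupVectors n g (extendVectors X) I) (g + 2)
        obtain ⟨t, u', hexec, ht, hocc⟩ := hquery
          ((queryWord d (groupVectors n g (extendVectors X) I) (g + 2)).map (letter hσ))
          (by rw [← List.length_pos_iff, List.length_map, hQl]; omega)
        rw [hQ] at hexec
        rw [List.length_map, hQl] at hexec ht
        refine ⟨t, u', ramExec_mono hexec ?_, ?_, hocc⟩
        · exact (Nat.pow_le_pow_right (by omega) (Nat.le_succ c)).trans
            (Nat.pow_le_pow_left (by omega) _)
        · have hq : ((3 * ((g + 2) * (d + 1)) + 5 : ℕ) : ℝ) ≤ 120 * (g * d) := by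
            have : 3 * ((g + 2) * (d + 1)) + 5 ≤ 120 * (g * d) := by omega
            exact_mod_cast this
          refine htq ▸ Nat.le_floor (ht.trans ?_)
          have := mul_rpow_le_rpow_max (Nat.cast_nonneg _) (Nat.cast_nonneg _) hE hq hZ hβ hδ
          rw [← hη] at this
          calc _ ≤ (C' : ℝ) * (2 * (120 * (g * d) : ℝ) ^ η) := by gcongr
            _ = _ := by ring)
    (RamState.init (encodeOV X Y)) ⟨fun _ => rfl, rfl⟩
  refine ⟨t, m', hexec, ?_, ?_⟩
  · refine (Nat.cast_le.mpr ht).trans ?_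
    exact time_ovProgram_le (Nat.cast_nonneg _) hn hd hg hk hgk hkg hα1 hαk hαe hη1 hη2 he2
      (hεdef ▸ min_le_left _ _) (hεdef ▸ min_le_right _ _) htp_le htq_le
  -- Variable 0 is kept in register `2 * 0`, which is the register of the answer.
  · rw [show m'.reg 0 = s'.reg 0 from hrep.1 0, hans, exists_occurs_iff hσ hd hg hgn,
      hasOrthogonalPair_iff]
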